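/- **Linear $\lambda$-calculus.** Types are $A ::= \alpha \mid A_1 \otimes A_2 \mid A_1 \multimap A_2$ with $\alpha$ ranging over countably many type variables. Untyped terms, up to renaming of bound variables, are $t ::= x \mid t\,s \mid \lambda x.t \mid (s,t) \mid \mathtt{let}\ (x,y)=s\ \mathtt{in}\ t$. Typing contexts are finite lists of declarations $x:A$ of distinct variables, their order being immaterial. Judgements $\Gamma \vdash t : A$ are derived by: $x:A \vdash x:A$; from $x:A,\Gamma \vdash t:B$ infer $\Gamma \vdash \lambda x.t : A\multimap B$; from $\Gamma\vdash t:A\multimap B$ and $\Delta\vdash s:A$ infer $\Gamma,\Delta\vdash t\,s:B$; from $\Gamma\vdash s:A$ and $\Delta\vdash t:B$ infer $\Gamma,\Delta\vdash (s,t):A\otimes B$; from $\Gamma\vdash s:A\otimes B$ and $x:A,y:B,\Delta\vdash t:C$ infer $\Gamma,\Delta\vdash \mathtt{let}\ (x,y)=s\ \mathtt{in}\ t:C$ (in $\Gamma,\Delta$ the two contexts have no common variable). A closed term of type $A$ is a $t$ with $\vdash t:A$. **Equality.** Let $\to_{\beta\eta}$ be the closure under arbitrary one-hole contexts of $(\lambda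 x.t)s \Rightarrow t[s/x]$, $\ \mathtt{let}\ (x,y)=(u,v)\ \mathtt{in}\ w\Rightarrow w[u/x,v/y]$, $\ \lambda x.(t\,x)\Rightarrow t$ ($x$ not free in $t$), $\ \mathtt{let}\ (x,y)=t\ \mathtt{in}\ (x,y)\Rightarrow t$. Let $C[\mathtt{let}\ (x,y)=t\ \mathtt{in}\ u]\leftrightarrow_c \mathtt{let}\ (x,y)=t\ \mathtt{in}\ C[u]$ for one-hole contexts $C[\,]$ in which $x,y$ are not free and which capture no free variable of $t$; let $=_c$ be the congruent equivalence relation generated by $\leftrightarrow_c$; and let $t\to_{\beta\eta c}u$ mean $t=_c t'\to_{\beta\eta}u'=_c u$ for some $t',u'$. The typed equality $\Gamma\vdash t=u:A$ (written $t=_{\beta\eta c}u$) is the least relation that is reflexive on typable terms, symmetric, transitive, is closed under the four typing rules other than the variable rule, and contains $\Gamma\vdash t=t':A$ whenever $\Gamma\vdash t:A$ and $t\leftrightarrow_c t'$ or $t\to_{\beta\eta c}t'$. **Poly-typability.** A principal type of $t$ is a type $P$ such that $\Gamma\vdash t:P$ for some $\Gamma$ and, whenever $\Gamma'\vdash t:A'$,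 there is a type substitution $\theta$ with $A'=P\theta$ and $\Gamma'=\Gamma\theta$; it is unique up to renaming of type variables and is denoted $\mathrm{PT}(t)$. Let $t,s_1,\dots,s_n$ be closed terms such that $\vdash t:A'_1\multimap\cdots\multimap A'_n\multimap B'$ for some types $A'_1,\dots,A'_n,B'$, and $\vdash s_i:A_i$ for each $i$. Then $t$ is *poly-typable by $A_1\multimap\cdots\multimap A_n\multimap B$ with respect to $s_1,\dots,s_n$* if, for suitably renamed principal types, some type substitution $\theta$ and some types $A''_i$ satisfy $\theta(\mathrm{PT}(t))=A''_1\multimap\cdots\multimap A''_n\multimap B$ and $\theta(\mathrm{PT}(s_i))=A''_i$ for all $i$. **Theorem (Poly-type Version of Strong Typed Böhm Theorem).** Let $A,A_0,B$ be types. Let $s_1,s_2$ be closed terms of type $A$ with $s_1\neq_{\beta\eta c}s_2$, and let $r_1,r_2$ be closed terms of type $A_0$. Let $u_1,u_2$ be closed terms, each poly-typable by $A_0\multimap B$ with respect to $r_1$ and with respect to $r_2$, such that $\{u_1r_1,\,u_1r_2,\,u_2r_1,\,u_2r_2\}$ has one or two elements up to $=_{\beta\eta c}$ at type $B$; that is,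 there are closed terms $b_1,b_2$ of type $B$ (possibly equal) such that each $u_ir_j$ is $=_{\beta\eta c}b_1$ or $=_{\beta\eta c}b_2$. Then there is a closed term $t$ that is poly-typable by $A\multimap A_0\multimap B$ with respect to $s_i,r_j$ for all $i,j\in\{1,2\}$, such that, at type $B$, $$t\,s_1\,r_j=_{\beta\eta c}u_1\,r_j\quad\text{and}\quad t\,s_2\,r_j=_{\beta\eta c}u_2\,r_j\qquad\text{for } j=1,2.$$ -/

import Mathlib

namespace LinLam

/-! ## Types and type substitutions -/

/-- Types: type variables, tensor products `A * B`, linear implications `A -> B`. -/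
inductive Ty : Type
  | var : ℕ → Ty
  | tensor : Ty → Ty → Ty
  | arr : Ty → Ty → Ty

/-- The extension of a type substitution to all types. -/
def Ty.subst (θ : ℕ → Ty) : Ty → Ty
  | .var n => θ n
  | .tensor A B => .tensor (A.subst θ) (B.subst θ)
  | .arr A B => .arr (A.subst θ) (B.subst θ)

/-- `arrows [A₁, …, Aₙ] B` is `A₁ -> ⋯ -> Aₙ -> B`. -/
def Ty.arrows (As : List Ty) (B : Ty) : Ty :=
  As.foldr Ty.arr B

/-! ## Untyped terms, up to renaming of bound variables (de Bruijn indices) -/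

/-- Untyped terms. In `lett s t`, that is `let val (x,y) = s in t end`, two variables are bound
in `t`: index `0` is `x`, the first component, and index `1` is `y`, the second component. -/
inductive Term : Type
  | var : ℕ → Term
  | app : Term → Term → Term
  | lam : Term → Term
  | pair : Term → Term → Term
  | lett : Term → Term → Term

/-- A renaming, carried under one binder. -/
def upr (ρ : ℕ → ℕ) : ℕ → ℕ
  | 0 => 0
  | n + 1 => ρ n + 1

def Term.rename (ρ : ℕ → ℕ) : Term → Term
  | .var n => .var (ρ n)
  | .app t s => .app (t.rename ρ) (s.rename ρ)
  | .lam t => .lam (t.rename (upr ρ))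
  | .pair s t => .pair (s.rename ρ) (t.rename ρ)
  | .lett s t => .lett (s.rename ρ) (t.rename (upr (upr ρ)))
termination_by structural t => t

/-- `s` for index `0`, and `σ` for the other indices, shifted by one. -/
def scons (s : Term) (σ : ℕ → Term) : ℕ → Term
  | 0 => s
  | n + 1 => σ n

/-- A substitution, carried under one binder. -/
def ups (σ : ℕ → Term) : ℕ → Term :=
  scons (.var 0) fun n => (σ n).rename Nat.succ

/-- Simultaneous capture-avoiding substitution. -/
def Term.subst (σ : ℕ → Term) : Term → Term
  | .var n => σ n
  | .app t s => .app (t.subst σ) (s.subst σ)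
  | .lam t => .lam (t.subst (ups σ))
  | .pair s t => .pair (s.subst σ) (t.subst σ)
  | .lett s t => .lett (s.subst σ) (t.subst (ups (ups σ)))
termination_by structural t => t

/-! ## The linear type assignment system -/

/-- Linear typing contexts: each variable is given at most one type. The order of the
declarations is immaterial, so that the exchange rule is built in. -/
abbrev TyCtx : Type := ℕ → Option Ty

/-- The empty typing context. -/
def TyCtx.nil : TyCtx := fun _ => none

/-- `x:A, Γ` where `x` becomes index `0`. -/
def TyCtx.cons (A : Ty) (Γ : TyCtx) : TyCtx
  | 0 => some A
  | n + 1 => Γ n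

/-- The typing context `x:A` where `x` is index `i`. -/
def TyCtx.single (i : ℕ) (A : Ty) : TyCtx := fun j => if j = i then some A else none

/-- `Θ` is the juxtaposition `Γ, Δ` of two contexts without common variables. -/
def TyCtx.Join (Γ Δ Θ : TyCtx) : Prop :=
  ∀ i, (Γ i = Θ i ∧ Δ i = none) ∨ (Γ i = none ∧ Δ i = Θ i)

/-- `HasType Γ t A` is the judgement `Γ ⊢ t : A`. -/
inductive HasType : TyCtx → Term → Ty → Prop
  | var {Γ : TyCtx} {i : ℕ} {A : Ty} (h : Γ = TyCtx.single i A) : HasType Γ (.var i) A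
  | lam {Γ : TyCtx} {t : Term} {A B : Ty} (h : HasType (TyCtx.cons A Γ) t B) :
      HasType Γ (.lam t) (.arr A B)
  | app {Γ Δ Θ : TyCtx} {t s : Term} {A B : Ty} (hj : TyCtx.Join Γ Δ Θ)
      (ht : HasType Γ t (.arr A B)) (hs : HasType Δ s A) : HasType Θ (.app t s) B
  | pair {Γ Δ Θ : TyCtx} {s t : Term} {A B : Ty} (hj : TyCtx.Join Γ Δ Θ)
      (hs : HasType Γ s A) (ht : HasType Δ t B) : HasType Θ (.pair s t) (.tensor A B)
  | lett {Γ Δ Θ : TyCtx} {s t : Term} {A B C : Ty} (hj : TyCtx.Join Γ Δ Θ)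
      (hs : HasType Γ s (.tensor A B))
      (ht : HasType (TyCtx.cons A (TyCtx.cons B Δ)) t C) : HasType Θ (.lett s t) C

/-- `t` is a closed (linear) term of type `A`. -/
def ClosedOf (t : Term) (A : Ty) : Prop := HasType TyCtx.nil t A

/-! ## One-hole contexts and reduction -/

/-- Contexts `C[]` with one hole. -/
inductive Context : Type
  | hole : Context
  | appL : Context → Term → Context
  | appR : Term → Context → Context
  | pairL : Context → Term → Context
  | pairR : Term → Context → Context
  | lam : Context → Context
  | lettL : Context → Term → Context
  | lettR : Term → Context → Context

/-- `C[t]`; variables of `t` may be captured. -/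
def Context.fill : Context → Term → Term
  | .hole, t => t
  | .appL C s, t => .app (C.fill t) s
  | .appR s C, t => .app s (C.fill t)
  | .pairL C s, t => .pair (C.fill t) s
  | .pairR s C, t => .pair s (C.fill t)
  | .lam C, t => .lam (C.fill t)
  | .lettL C s, t => .lett (C.fill t) s
  | .lettR s C, t => .lett s (C.fill t)

/-- The number of variables captured by `C[]`, i.e. bound at its hole. -/
def Context.depth : Context → ℕ
  | .hole => 0
  | .appL C _ => C.depth
  | .appR _ C => C.depth
  | .pairL C _ => C.depth
  | .pairR _ C => C.depth
  | .lam C => C.depth + 1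
  | .lettL C _ => C.depth
  | .lettR _ C => C.depth + 2

/-- Renaming of the free variables of a context. -/
def Context.rename (ρ : ℕ → ℕ) : Context → Context
  | .hole => .hole
  | .appL C t => .appL (C.rename ρ) (t.rename ρ)
  | .appR t C => .appR (t.rename ρ) (C.rename ρ)
  | .pairL C t => .pairL (C.rename ρ) (t.rename ρ)
  | .pairR t C => .pairR (t.rename ρ) (C.rename ρ)
  | .lam C => .lam (C.rename (upr ρ))
  | .lettL C t => .lettL (C.rename ρ) (t.rename (upr (upr ρ)))
  | .lettR t C => .lettR (t.rename ρ) (C.rename (upr (upr ρ)))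
termination_by structural C => C

/-- The rules `β₁`, `β₂`, `η₁`, `η₂`, at the root of a term. -/
inductive Redex : Term → Term → Prop
  | beta1 (t s : Term) : Redex (.app (.lam t) s) (t.subst (scons s .var))
  | beta2 (u v w : Term) : Redex (.lett (.pair u v) w) (w.subst (scons u (scons v .var)))
  | eta1 (t : Term) : Redex (.lam (.app (t.rename Nat.succ) (.var 0))) t
  | eta2 (t : Term) : Redex (.lett t (.pair (.var 0) (.var 1))) t

/-- One-step reduction `→βη`, in any context. -/
inductive BetaEta : Term → Term → Prop
  | step (C : Context) {t u : Term} (h : Redex t u) : BetaEta (C.fill t) (C.fill u)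

/-- The change of indices in `u` when, with `d` captured variables, the two variables bound by a
`let` around `u` are moved from inside the `d` binders to outside of them. -/
def swapBinders (d : ℕ) : ℕ → ℕ
  | 0 => d
  | 1 => d + 1
  | n + 2 => if n < d then n else n + 2

/-- `C[let val (x,y) = t in u end] ↔ let val (x,y) = t in C[u] end`, read from left to right. On
the left, `t` is shifted over the variables captured by `C[]`, so that none of them is free in it;
on the right, `C[]` is shifted over `x` and `y`, so that neither is free in it. -/
inductive CommStep : Term → Term → Prop
  | step (C : Context) (t u : Term) :
      CommStep (C.fill (.lett (t.rename (· + C.depth)) u))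
        (.lett t ((C.rename (· + 2)).fill (u.rename (swapBinders C.depth))))

/-- The commutative conversion relation `↔c`. -/
def Comm (t u : Term) : Prop := CommStep t u ∨ CommStep u t

/-- `=c`, the congruent equivalence relation generated by `↔c` and any context. -/
def CommEq : Term → Term → Prop :=
  Relation.EqvGen fun t u =>
    ∃ (C : Context) (t' u' : Term), Comm t' u' ∧ t = C.fill t' ∧ u = C.fill u'

/-- `→βηc`: one `→βη` step modulo `=c`. -/
def BetaEtaC (t u : Term) : Prop :=
  ∃ t' u', CommEq t t' ∧ BetaEta t' u' ∧ CommEq u' u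

/-! ## The equality `=βηc` -/

/-- `TermEq Γ t u A` is the judgement `Γ ⊢ t = u : A`, the equality `=βηc`. -/
inductive TermEq : TyCtx → Term → Term → Ty → Prop
  | refl {Γ : TyCtx} {t : Term} {A : Ty} (h : HasType Γ t A) : TermEq Γ t t A
  | symm {Γ : TyCtx} {t s : Term} {A : Ty} (h : TermEq Γ t s A) : TermEq Γ s t A
  | trans {Γ : TyCtx} {t s u : Term} {A : Ty} (h₁ : TermEq Γ t s A) (h₂ : TermEq Γ s u A) :
      TermEq Γ t u A
  | comm {Γ : TyCtx} {t t' : Term} {A : Ty} (h : HasType Γ t A) (hc : Comm t t') :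
      TermEq Γ t t' A
  | betaEta {Γ : TyCtx} {t t' : Term} {A : Ty} (h : HasType Γ t A) (hr : BetaEtaC t t') :
      TermEq Γ t t' A
  | lam {Γ : TyCtx} {t t' : Term} {A B : Ty} (h : TermEq (TyCtx.cons A Γ) t t' B) :
      TermEq Γ (.lam t) (.lam t') (.arr A B)
  | app {Γ Δ Θ : TyCtx} {t t' s s' : Term} {A B : Ty} (hj : TyCtx.Join Γ Δ Θ)
      (ht : TermEq Γ t t' (.arr A B)) (hs : TermEq Δ s s' A) :
      TermEq Θ (.app t s) (.app t' s') B
  | pair {Γ Δ Θ : TyCtx} {s s' t t' : Term} {A B : Ty} (hj : TyCtx.Join Γ Δ Θ)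
      (hs : TermEq Γ s s' A) (ht : TermEq Δ t t' B) :
      TermEq Θ (.pair s t) (.pair s' t') (.tensor A B)
  | lett {Γ Δ Θ : TyCtx} {s s' t t' : Term} {A B C : Ty} (hj : TyCtx.Join Γ Δ Θ)
      (hs : TermEq Γ s s' (.tensor A B))
      (ht : TermEq (TyCtx.cons A (TyCtx.cons B Δ)) t t' C) :
      TermEq Θ (.lett s t) (.lett s' t') C

/-- `t =βηc u` for closed terms of type `A`. -/
def ClosedEq (A : Ty) (t u : Term) : Prop := TermEq TyCtx.nil t u A

/-! ## Principal types and poly-typability -/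

/-- `P` is a principal type of `t`: it is the type of `t` in a typing of which every typing of `t`
is a substitution instance. It is unique up to a renaming of type variables. -/
def IsPrincipalType (t : Term) (P : Ty) : Prop :=
  ∃ Γ : TyCtx, HasType Γ t P ∧
    ∀ (Γ' : TyCtx) (A' : Ty), HasType Γ' t A' →
      ∃ θ : ℕ → Ty, A' = P.subst θ ∧ Γ' = fun i => (Γ i).map (Ty.subst θ)

/-- `PolyTypable t [A₁, …, Aₙ] B [s₁, …, sₙ]`: the closed term `t` is poly-typable by
`A₁ -> ⋯ -> Aₙ -> B` with respect to the closed terms `s₁ : A₁, …, sₙ : Aₙ`. A principal type being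
given only up to a renaming of its variables, its representatives `P`, `Q₁, …, Qₙ` are free to
choose (for instance without common variables); the substitution `θ` is common to all of them. -/
def PolyTypable (t : Term) (As : List Ty) (B : Ty) (ss : List Term) : Prop :=
  (∃ (As' : List Ty) (B' : Ty), As'.length = As.length ∧ ClosedOf t (Ty.arrows As' B')) ∧
  List.Forall₂ ClosedOf ss As ∧
  ∃ (P : Ty) (Qs : List Ty) (θ : ℕ → Ty),
    IsPrincipalType t P ∧ List.Forall₂ IsPrincipalType ss Qs ∧
    P.subst θ = Ty.arrows (Qs.map (Ty.subst θ)) B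

end LinLam

open LinLam

namespace LinLam

/-! ## Renamings and substitutions -/

/-! Poly-typability of `t` with respect to `s i`, `r j` amounts to typability of the single
application `t (s i) (r j)` at `B`: typable terms have principal types (`HasType.exists_principal`),
and principal types with disjoint variables can be instantiated independently
(`PolyTypable.of_hasType_app`). So `t` may be built as an untyped term. Linear conversion `BC`
neither erases nor copies anything, hence preserves and reflects typing (`BC.hasType_iff`), and on
typable terms it is contained in the equality (`BC.termEq`). It suffices that `t (s i) r` converts
linearly to `u i r`.

To tell `s 0` from `s 1`, cut-free forms are used (`HasType.exists_cf`): in a cut-free derivation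
the atoms at the negative positions can be chosen freely (`CF.exists_labelling`). Hence `s 0` and `s
1` have types `A₁`, `A₂` of the shape of `A` with the same, pairwise distinct, negative atoms. By
coherence (`HasType.coherence`) a sequent with distinct negative atoms has at most one term up to
equality, so `A₁ = A₂` would give `s 0 = s 1`; thus `A₁` and `A₂` differ at a positive position.
Coherence itself rests on two facts: each atom of a cut-free sequent occurs at both polarities
(`CF.seqAtom`), so that the premises of a two-premise rule share no atom; and, when atoms are
coloured by premise, any other term of the sequent must split in the same way (`CF.split_tensor`,
`CF.split_arr`).

The difference between `A₁` and `A₂` is observed by realizability (`Rz`). A realizer of an atom is a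
pair of linear booleans, the value of the atom and a weight in `ZMod 2`; the weight absorbs whatever
linearity forbids to discard. Closed terms realize their types with weight `0`. The untyped term
`prob` feeds values into the negative positions and adds up the values read at chosen positive
positions (`prob_spec`). With value `1` only for the atom of `A₁` at the differing position, `s 0`
and `s 1` yield different booleans (`exists_test`).

This boolean selects `u 0` or `u 1`. The rejected function cannot be dropped; it is applied to `r
0`, the result is a closed term of type `B`, a test for `B` turns it into a boolean, and `eat` turns
the boolean into the identity (`exists_separator`). -/

theorem upr_id : upr id = id := by
  funext n; cases n <;> rfl

theorem upr_comp (ρ ρ' : ℕ → ℕ) : upr ρ' ∘ upr ρ = upr (ρ' ∘ ρ) := by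
  funext n; cases n <;> rfl

theorem upr_injective {ρ : ℕ → ℕ} (h : Function.Injective ρ) : Function.Injective (upr ρ) := by
  intro a b hab
  cases a <;> cases b <;> simp [upr] at hab ⊢
  exact h hab

theorem Term.rename_id (t : Term) : t.rename id = t := by
  induction t <;> simp_all [Term.rename, upr_id]

theorem Term.rename_rename (t : Term) (ρ ρ' : ℕ → ℕ) :
    (t.rename ρ).rename ρ' = t.rename (ρ' ∘ ρ) := by
  induction t generalizing ρ ρ' <;> simp_all [Term.rename, upr_comp]

theorem ups_comp_upr (σ : ℕ → Term) (ρ : ℕ → ℕ) : ups σ ∘ upr ρ = ups (σ ∘ ρ) := by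
  funext n; cases n <;> rfl

theorem Term.subst_rename (t : Term) (ρ : ℕ → ℕ) (σ : ℕ → Term) :
    (t.rename ρ).subst σ = t.subst (σ ∘ ρ) := by
  induction t generalizing ρ σ <;> simp_all [Term.rename, Term.subst, ups_comp_upr]

theorem rename_ups (σ : ℕ → Term) (ρ : ℕ → ℕ) :
    (fun n => (ups σ n).rename (upr ρ)) = ups fun n => (σ n).rename ρ := by
  funext n
  cases n with
  | zero => rfl
  | succ n => simp only [ups, scons, Term.rename_rename]; rfl

theorem Term.rename_subst (t : Term) (σ : ℕ → Term) (ρ : ℕ → ℕ) :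
    (t.subst σ).rename ρ = t.subst fun n => (σ n).rename ρ := by
  induction t generalizing ρ σ <;> simp_all [Term.rename, Term.subst, rename_ups]

theorem subst_ups (σ τ : ℕ → Term) :
    (fun n => (ups σ n).subst (ups τ)) = ups fun n => (σ n).subst τ := by
  funext n
  cases n with
  | zero => rfl
  | succ n => simp only [ups, scons, Term.subst_rename, Term.rename_subst]; rfl

theorem Term.subst_subst (t : Term) (σ τ : ℕ → Term) :
    (t.subst σ).subst τ = t.subst fun n => (σ n).subst τ := by
  induction t generalizing σ τ <;> simp_all [Term.subst, subst_ups]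

theorem ups_var : ups Term.var = Term.var := by
  funext n; cases n <;> rfl

theorem Term.subst_var (t : Term) : t.subst Term.var = t := by
  induction t <;> simp_all [Term.subst, ups_var]

theorem ups_var_comp (ρ : ℕ → ℕ) : ups (Term.var ∘ ρ) = Term.var ∘ upr ρ := by
  funext n; cases n <;> rfl

theorem Term.rename_eq_subst (t : Term) (ρ : ℕ → ℕ) : t.rename ρ = t.subst (Term.var ∘ ρ) := by
  induction t generalizing ρ <;> simp_all [Term.rename, Term.subst, ups_var_comp]

/-- The term `t` with `s` for the variable `0`, the other variables being shifted down. -/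
abbrev Term.inst (t s : Term) : Term := t.subst (scons s .var)

/-- The substitution of `s` for the variable `k`. -/
abbrev repl (k : ℕ) (s : Term) : ℕ → Term := Function.update Term.var k s

theorem ups_repl (k : ℕ) (s : Term) : ups (repl k s) = repl (k + 1) (s.rename Nat.succ) := by
  funext n
  cases n with
  | zero => simp [ups, scons, repl, Function.update]
  | succ n => by_cases h : n = k <;> simp [ups, scons, repl, Function.update, h, Term.rename]

theorem Term.inst_subst (t s : Term) (σ : ℕ → Term) :
    (t.inst s).subst σ = (t.subst (ups σ)).inst (s.subst σ) := by
  simp only [Term.inst, Term.subst_subst]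
  congr 1; funext n
  cases n with
  | zero => rfl
  | succ n =>
    simp only [scons, ups, Term.subst_rename, Term.subst]
    exact (Term.subst_var _).symm

theorem Term.subst_ups_inst (t s : Term) (σ : ℕ → Term) :
    (t.subst (ups σ)).inst s = t.subst (scons s σ) := by
  simp only [Term.inst, Term.subst_subst]
  congr 1; funext n
  cases n with
  | zero => rfl
  | succ n =>
    simp only [scons, ups, Term.subst_rename]
    exact Term.subst_var _

theorem Term.inst_inst (t u v : Term) :
    (t.inst (u.rename Nat.succ)).inst v = t.subst (scons u (scons v .var)) := by
  simp only [Term.inst, Term.subst_subst]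
  congr 1; funext n
  cases n with
  | zero => simp only [scons, Term.subst_rename]; exact Term.subst_var _
  | succ n => cases n <;> rfl

/-! ## Counting the free occurrences of a variable -/

/-- The number of free occurrences of the variable `k`. -/
def Term.occ : ℕ → Term → ℕ
  | k, .var n => if n = k then 1 else 0
  | k, .app t s => t.occ k + s.occ k
  | k, .lam t => t.occ (k + 1)
  | k, .pair s t => s.occ k + t.occ k
  | k, .lett s t => s.occ k + t.occ (k + 2)
termination_by structural _ t => t

theorem Term.subst_congr {t : Term} {σ τ : ℕ → Term} (h : ∀ k, t.occ k ≠ 0 → σ k = τ k) :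
    t.subst σ = t.subst τ := by
  have key : ∀ {σ τ : ℕ → Term} {p : ℕ → Prop}, (∀ k, p (k + 1) → σ k = τ k) →
      ∀ k, p k → ups σ k = ups τ k := by
    intro σ τ p h k hk
    cases k with
    | zero => rfl
    | succ k => simp only [ups, scons]; rw [h k hk]
  induction t generalizing σ τ with
  | var n => exact h n (by simp [Term.occ])
  | app t s iht ihs =>
    simp only [Term.subst]
    rw [iht fun k hk => h k (by simp [Term.occ]; omega), ihs fun k hk => h k (by simp [Term.occ]; omega)]
  | lam t ih => simp only [Term.subst]; rw [ih (key (p := fun k => t.occ k ≠ 0) h)]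
  | pair s t ihs iht =>
    simp only [Term.subst]
    rw [iht fun k hk => h k (by simp [Term.occ]; omega), ihs fun k hk => h k (by simp [Term.occ]; omega)]
  | lett s t ihs iht =>
    simp only [Term.subst]
    rw [ihs fun k hk => h k (by simp [Term.occ]; omega),
      iht (key (p := fun k => t.occ k ≠ 0) (key (p := fun k => t.occ (k + 1) ≠ 0)
        fun k (hk : t.occ (k + 2) ≠ 0) => h k (by simp only [Term.occ]; omega)))]

/-- Terms without free variables. -/
def Term.Closed (t : Term) : Prop := ∀ k, t.occ k = 0

theorem Term.Closed.subst {t : Term} (h : t.Closed) (σ : ℕ → Term) : t.subst σ = t :=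
  (Term.subst_congr fun k hk => absurd (h k) hk).trans t.subst_var

theorem Term.Closed.rename {t : Term} (h : t.Closed) (ρ : ℕ → ℕ) : t.rename ρ = t := by
  rw [Term.rename_eq_subst, h.subst]

theorem Term.occ_rename {t : Term} {ρ : ℕ → ℕ} {k k' : ℕ} (h : ∀ j, ρ j = k' ↔ j = k) :
    (t.rename ρ).occ k' = t.occ k := by
  have key : ∀ {ρ : ℕ → ℕ} {k k' : ℕ}, (∀ j, ρ j = k' ↔ j = k) →
      ∀ j, upr ρ j = k' + 1 ↔ j = k + 1 := by
    intro ρ k k' h j; cases j <;> simp [upr, h]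
  induction t generalizing ρ k k' with
  | var n => simp [Term.occ, Term.rename, h]
  | app t s iht ihs => simp [Term.occ, Term.rename, iht h, ihs h]
  | lam t ih => simp [Term.occ, Term.rename, ih (key h)]
  | pair s t ihs iht => simp [Term.occ, Term.rename, iht h, ihs h]
  | lett s t ihs iht => simp [Term.occ, Term.rename, ihs h, iht (key (key h))]

theorem Term.occ_rename_eq_zero {t : Term} {ρ : ℕ → ℕ} {k : ℕ} (h : ∀ j, ρ j ≠ k) :
    (t.rename ρ).occ k = 0 := by
  have key : ∀ {ρ : ℕ → ℕ} {k : ℕ}, (∀ j, ρ j ≠ k) → ∀ j, upr ρ j ≠ k + 1 := by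
    intro ρ k h j; cases j <;> simp [upr, h]
  induction t generalizing ρ k with
  | var n => simp [Term.occ, Term.rename, h]
  | app t s iht ihs => simp [Term.occ, Term.rename, iht h, ihs h]
  | lam t ih => simp [Term.occ, Term.rename, ih (key h)]
  | pair s t ihs iht => simp [Term.occ, Term.rename, iht h, ihs h]
  | lett s t ihs iht => simp [Term.occ, Term.rename, ihs h, iht (key (key h))]

theorem Term.occ_succ_rename_succ (t : Term) (k : ℕ) :
    (t.rename Nat.succ).occ (k + 1) = t.occ k :=
  Term.occ_rename fun j => by simp

theorem Term.occ_zero_rename_succ (t : Term) : (t.rename Nat.succ).occ 0 = 0 :=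
  Term.occ_rename_eq_zero fun j => by simp

theorem Term.occ_subst {t : Term} {σ : ℕ → Term} {k k' : ℕ} (h : σ k = .var k')
    (h' : ∀ j, j ≠ k → (σ j).occ k' = 0) : (t.subst σ).occ k' = t.occ k := by
  have key : ∀ {σ : ℕ → Term} {k k' : ℕ}, σ k = .var k' → (∀ j, j ≠ k → (σ j).occ k' = 0) →
      ups σ (k + 1) = .var (k' + 1) ∧ ∀ j, j ≠ k + 1 → (ups σ j).occ (k' + 1) = 0 := by
    intro σ k k' h h'
    refine ⟨by simp [ups, scons, h, Term.rename], fun j hj => ?_⟩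
    cases j with
    | zero => simp [ups, scons, Term.occ]
    | succ j => simp only [ups, scons, Term.occ_succ_rename_succ]; exact h' j (by omega)
  induction t generalizing σ k k' with
  | var n =>
    by_cases hn : n = k
    · subst hn; simp [Term.subst, h, Term.occ]
    · simp [Term.subst, h' n hn, Term.occ, hn]
  | app t s iht ihs => simp [Term.occ, Term.subst, iht h h', ihs h h']
  | lam t ih => simp [Term.occ, Term.subst, ih (key h h').1 (key h h').2]
  | pair s t ihs iht => simp [Term.occ, Term.subst, iht h h', ihs h h']
  | lett s t ihs iht =>
    have h₁ := key h h'
    have h₂ := key h₁.1 h₁.2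
    simp [Term.occ, Term.subst, ihs h h', iht h₂.1 h₂.2]

theorem Term.occ_zero_ups (t : Term) (σ : ℕ → Term) : (t.subst (ups σ)).occ 0 = t.occ 0 := by
  refine Term.occ_subst rfl fun j hj => ?_
  obtain ⟨j, rfl⟩ := Nat.exists_eq_succ_of_ne_zero hj
  exact Term.occ_zero_rename_succ _

theorem Term.occ_zero_ups_ups (t : Term) (σ : ℕ → Term) :
    (t.subst (ups (ups σ))).occ 0 = t.occ 0 := Term.occ_zero_ups _ _

theorem Term.occ_one_ups_ups (t : Term) (σ : ℕ → Term) :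
    (t.subst (ups (ups σ))).occ 1 = t.occ 1 := by
  refine Term.occ_subst rfl fun j hj => ?_
  match j, hj with
  | 0, _ => rfl
  | j + 2, _ =>
    simp only [ups, scons]
    rw [Term.occ_succ_rename_succ, Term.occ_zero_rename_succ]

/-! ## Substitution for one variable -/

/-- `σ` puts `e` for the variable `k`, and renames the other variables, those in the range of
`ι`, to the variables that `ι` comes from. -/
structure OneHole (k : ℕ) (ι : ℕ → ℕ) (e : Term) (σ : ℕ → Term) : Prop where
  inj : Function.Injective ι
  cases : ∀ j, j = k ∨ ∃ i, j = ι i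
  ne : ∀ i, ι i ≠ k
  at_hole : σ k = e
  off_hole : ∀ i, σ (ι i) = .var i

theorem OneHole.scons (e : Term) : OneHole 0 Nat.succ e (scons e .var) where
  inj := Nat.succ_injective
  cases j := by cases j <;> simp
  ne := by simp
  at_hole := rfl
  off_hole _ := rfl

theorem OneHole.ups {k : ℕ} {ι : ℕ → ℕ} {e : Term} {σ : ℕ → Term} (h : OneHole k ι e σ) :
    OneHole (k + 1) (upr ι) (e.rename Nat.succ) (ups σ) where
  inj := upr_injective h.inj
  cases j := by
    cases j with
    | zero => exact .inr ⟨0, rfl⟩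
    | succ j =>
      obtain rfl | ⟨i, rfl⟩ := h.cases j
      · exact .inl rfl
      · exact .inr ⟨i + 1, rfl⟩
  ne i := by cases i <;> simp [upr, h.ne]
  at_hole := by simp [LinLam.ups, LinLam.scons, h.at_hole]
  off_hole i := by cases i <;> simp [LinLam.ups, LinLam.scons, upr, h.off_hole, Term.rename]

/-- Where the hole does not occur, the substitution is only a renaming, which `ι` undoes. -/
theorem OneHole.rename_subst {k : ℕ} {ι : ℕ → ℕ} {e : Term} {σ : ℕ → Term} (h : OneHole k ι e σ)
    {t : Term} (ht : t.occ k = 0) : (t.subst σ).rename ι = t := by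
  rw [Term.rename_subst]
  refine (Term.subst_congr fun j hj => ?_).trans t.subst_var
  obtain rfl | ⟨i, rfl⟩ := h.cases j
  · exact absurd ht hj
  · simp [h.off_hole, Term.rename]

/-! ### Size under linear substitution -/

/-- The number of nodes of a term. -/
def Term.size : Term → ℕ
  | .var _ => 1
  | .app t s => t.size + s.size + 1
  | .lam t => t.size + 1
  | .pair s t => s.size + t.size + 1
  | .lett s t => s.size + t.size + 1

theorem Term.size_rename (t : Term) (ρ : ℕ → ℕ) : (t.rename ρ).size = t.size := by
  induction t generalizing ρ <;> simp_all [Term.size, Term.rename]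

theorem OneHole.size_subst_of_occ_eq_zero {k : ℕ} {ι : ℕ → ℕ} {e : Term} {σ : ℕ → Term}
    (h : OneHole k ι e σ) {t : Term} (ht : t.occ k = 0) : (t.subst σ).size = t.size := by
  conv_rhs => rw [← h.rename_subst ht, Term.size_rename]

/-- The one occurrence of `k`, a node of size `1`, is traded for `e`. Hence linear β shrinks terms,
which makes `HasType.exists_cf` terminate. -/
theorem OneHole.size_subst {k : ℕ} {ι : ℕ → ℕ} {e : Term} {σ : ℕ → Term} (h : OneHole k ι e σ)
    {t : Term} (ht : t.occ k = 1) : (t.subst σ).size + 1 = t.size + e.size := by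
  induction t generalizing k ι e σ with
  | var n =>
    by_cases hn : n = k
    · subst hn; simp [Term.subst, h.at_hole, Term.size]; omega
    · simp [Term.occ, hn] at ht
  | app t s iht ihs =>
    simp only [Term.occ] at ht
    simp only [Term.subst, Term.size]
    obtain ⟨h₁, h₂⟩ | ⟨h₁, h₂⟩ : (t.occ k = 1 ∧ s.occ k = 0) ∨ (t.occ k = 0 ∧ s.occ k = 1) := by
      omega
    · have := iht h h₁; have := h.size_subst_of_occ_eq_zero h₂; omega
    · have := ihs h h₂; have := h.size_subst_of_occ_eq_zero h₁; omega
  | lam t ih =>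
    have := ih h.ups ht
    simp only [Term.subst, Term.size, Term.size_rename] at this ⊢; omega
  | pair t s iht ihs =>
    simp only [Term.occ] at ht
    simp only [Term.subst, Term.size]
    obtain ⟨h₁, h₂⟩ | ⟨h₁, h₂⟩ : (t.occ k = 1 ∧ s.occ k = 0) ∨ (t.occ k = 0 ∧ s.occ k = 1) := by
      omega
    · have := iht h h₁; have := h.size_subst_of_occ_eq_zero h₂; omega
    · have := ihs h h₂; have := h.size_subst_of_occ_eq_zero h₁; omega
  | lett t s iht ihs =>
    simp only [Term.occ] at ht
    simp only [Term.subst, Term.size]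
    obtain ⟨h₁, h₂⟩ | ⟨h₁, h₂⟩ :
        (t.occ k = 1 ∧ s.occ (k + 2) = 0) ∨ (t.occ k = 0 ∧ s.occ (k + 2) = 1) := by
      omega
    · have := iht h h₁; have := h.ups.ups.size_subst_of_occ_eq_zero h₂; omega
    · have := ihs h.ups.ups h₂; have := h.size_subst_of_occ_eq_zero h₁
      simp only [Term.size_rename] at *; omega

/-- The renaming that makes room for the variable `0`, which replaces the variable `k`. -/
def toFront (k : ℕ) : ℕ → ℕ := fun j => if j = k then 0 else j + 1

theorem toFront_injective (k : ℕ) : Function.Injective (toFront k) := by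
  intro a b; simp only [toFront]; split_ifs <;> simp_all

/-- Unlike `inst`, `repl k e` does not remove the index `k`, so `e` may mention `k` itself, as when
`f u` is put for `f`. Moving `k` to the front reduces the one to the other. -/
theorem Term.subst_repl (t : Term) (k : ℕ) (e : Term) :
    t.subst (repl k e) = (t.rename (toFront k)).inst e := by
  rw [Term.inst, Term.subst_rename]
  congr 1; funext j
  by_cases h : j = k
  · subst h; simp [toFront, scons]
  · simp [toFront, h, scons]

theorem Term.occ_toFront (t : Term) (k : ℕ) : (t.rename (toFront k)).occ 0 = t.occ k :=
  Term.occ_rename fun j => by simp only [toFront]; split_ifs <;> simp_all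

theorem Term.subst_repl_of_occ_eq_zero {t : Term} {k : ℕ} (h : t.occ k = 0) (e : Term) :
    t.subst (repl k e) = t := by
  refine (Term.subst_congr fun j hj => ?_).trans t.subst_var
  rw [repl, Function.update_of_ne]; rintro rfl; exact hj h

/-! ## Typing contexts -/

theorem TyCtx.Join.comm {Γ Δ Θ : TyCtx} (h : Γ.Join Δ Θ) : Δ.Join Γ Θ := fun i =>
  (h i).symm.imp And.symm And.symm

theorem TyCtx.Join.comp {Γ Δ Θ : TyCtx} (h : Γ.Join Δ Θ) (ρ : ℕ → ℕ) :
    TyCtx.Join (Γ ∘ ρ) (Δ ∘ ρ) (Θ ∘ ρ) := fun i => h (ρ i)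

theorem TyCtx.join_nil_left (Γ : TyCtx) : TyCtx.nil.Join Γ Γ := fun _ => .inr ⟨rfl, rfl⟩

theorem TyCtx.join_nil_right (Γ : TyCtx) : Γ.Join TyCtx.nil Γ := fun _ => .inl ⟨rfl, rfl⟩

/-- The union of two contexts. -/
def TyCtx.union (Γ Δ : TyCtx) : TyCtx := fun i => (Γ i).or (Δ i)

theorem TyCtx.join_union {Γ Δ : TyCtx} (h : ∀ i, Γ i = none ∨ Δ i = none) :
    Γ.Join Δ (Γ.union Δ) := by
  intro i
  obtain h | h := h i
  · right; simp [TyCtx.union, h]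
  · left; simp [TyCtx.union, h]

theorem TyCtx.Join.assoc {Γ Δ Θ Γ₁ Γ₂ : TyCtx} (h : Γ.Join Δ Θ) (h' : Γ₁.Join Γ₂ Γ) :
    ∃ E, Γ₂.Join Δ E ∧ Γ₁.Join E Θ := by
  refine ⟨Γ₂.union Δ, TyCtx.join_union fun i => ?_, fun i => ?_⟩
  · have := h i; have := h' i; grind
  · have := h i; have := h' i; simp only [TyCtx.union]; grind

theorem TyCtx.eq_cons {Γ : TyCtx} {A : Ty} (h : Γ 0 = some A) :
    Γ = TyCtx.cons A (Γ ∘ Nat.succ) := by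
  funext i; cases i
  · exact h
  · rfl

/-! ## Typing -/

theorem hasType_var {Γ : TyCtx} {i : ℕ} {A : Ty} :
    HasType Γ (.var i) A ↔ Γ = TyCtx.single i A :=
  ⟨fun h => by cases h; assumption, .var⟩

theorem hasType_app {Θ : TyCtx} {t s : Term} {B : Ty} :
    HasType Θ (.app t s) B ↔
      ∃ Γ Δ A, TyCtx.Join Γ Δ Θ ∧ HasType Γ t (.arr A B) ∧ HasType Δ s A :=
  ⟨fun h => by cases h; exact ⟨_, _, _, ‹_›, ‹_›, ‹_›⟩, fun ⟨_, _, _, h, h₁, h₂⟩ => .app h h₁ h₂⟩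

theorem hasType_lam {Γ : TyCtx} {t : Term} {T : Ty} :
    HasType Γ (.lam t) T ↔ ∃ A B, T = .arr A B ∧ HasType (TyCtx.cons A Γ) t B :=
  ⟨fun h => by cases h; exact ⟨_, _, rfl, ‹_›⟩, fun ⟨_, _, e, h⟩ => e ▸ .lam h⟩

theorem hasType_pair {Θ : TyCtx} {s t : Term} {T : Ty} :
    HasType Θ (.pair s t) T ↔
      ∃ Γ Δ A B, T = .tensor A B ∧ TyCtx.Join Γ Δ Θ ∧ HasType Γ s A ∧ HasType Δ t B :=
  ⟨fun h => by cases h; exact ⟨_, _, _, _, rfl, ‹_›, ‹_›, ‹_›⟩,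
    fun ⟨_, _, _, _, e, h, h₁, h₂⟩ => e ▸ .pair h h₁ h₂⟩

theorem hasType_lett {Θ : TyCtx} {s t : Term} {C : Ty} :
    HasType Θ (.lett s t) C ↔
      ∃ Γ Δ A B, TyCtx.Join Γ Δ Θ ∧ HasType Γ s (.tensor A B) ∧
        HasType (TyCtx.cons A (TyCtx.cons B Δ)) t C :=
  ⟨fun h => by cases h; exact ⟨_, _, _, _, ‹_›, ‹_›, ‹_›⟩, fun ⟨_, _, _, _, h, h₁, h₂⟩ => .lett h h₁ h₂⟩

/-- The counts depend on the term alone, so all typings of a term have contexts with the same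
domain. This is how linearity of typing supplies the side conditions of `BC`. -/
theorem HasType.occ {Γ : TyCtx} {t : Term} {A : Ty} (h : HasType Γ t A) (k : ℕ) :
    (Γ k = none ∧ t.occ k = 0) ∨ (Γ k ≠ none ∧ t.occ k = 1) := by
  induction h generalizing k with
  | @var Γ i A h =>
    subst h
    by_cases hi : i = k
    · right; simp [TyCtx.single, Term.occ, hi]
    · left; simp [TyCtx.single, Term.occ, hi, Ne.symm hi]
  | lam _ ih => exact ih (k + 1)
  | app hj _ _ ih₁ ih₂ =>
    have := hj k; have := ih₁ k; have := ih₂ k; simp only [Term.occ]; grind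
  | pair hj _ _ ih₁ ih₂ =>
    have := hj k; have := ih₁ k; have := ih₂ k; simp only [Term.occ]; grind
  | lett hj _ _ ih₁ ih₂ =>
    have := hj k; have := ih₁ k; have := ih₂ (k + 2)
    simp only [Term.occ, TyCtx.cons] at *; grind

theorem HasType.occ_eq_one {Γ : TyCtx} {t : Term} {A B : Ty} (h : HasType Γ t A) {k : ℕ}
    (hk : Γ k = some B) : t.occ k = 1 := by
  have := h.occ k; simp_all

theorem HasType.occ_eq_zero {Γ : TyCtx} {t : Term} {A : Ty} (h : HasType Γ t A) {k : ℕ}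
    (hk : Γ k = none) : t.occ k = 0 := by
  have := h.occ k; simp_all

theorem HasType.eq_none_iff {Γ Γ' : TyCtx} {t : Term} {A A' : Ty} (h : HasType Γ t A)
    (h' : HasType Γ' t A') (k : ℕ) : Γ k = none ↔ Γ' k = none := by
  have := h.occ k; have := h'.occ k; grind

theorem HasType.closed {t : Term} {A : Ty} (h : HasType TyCtx.nil t A) : t.Closed :=
  fun _ => h.occ_eq_zero rfl

theorem hasType_rename {ρ : ℕ → ℕ} (hρ : Function.Injective ρ) {Γ : TyCtx} {t : Term} {A : Ty} :
    HasType Γ (t.rename ρ) A ↔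
      (∀ i, (∀ j, ρ j ≠ i) → Γ i = none) ∧ HasType (Γ ∘ ρ) t A := by
  refine ⟨fun h => ⟨fun i hi => ?_, ?_⟩, ?_⟩
  · have := h.occ i
    have := Term.occ_rename_eq_zero (t := t) hi
    grind
  · induction t generalizing ρ Γ A with
    | var n =>
      rw [Term.rename, hasType_var] at h; rw [hasType_var]; subst h
      funext i; simp [TyCtx.single, hρ.eq_iff]
    | app t s iht ihs =>
      obtain ⟨Γ', Δ, B, hj, ht, hs⟩ := hasType_app.1 h
      exact .app (hj.comp ρ) (iht hρ ht) (ihs hρ hs)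
    | lam t ih =>
      obtain ⟨B, C, rfl, ht⟩ := hasType_lam.1 h
      have := ih (upr_injective hρ) ht
      refine .lam ?_
      convert this using 1
      funext i; cases i <;> rfl
    | pair s t ihs iht =>
      obtain ⟨Γ', Δ, B, C, rfl, hj, hs, ht⟩ := hasType_pair.1 h
      exact .pair (hj.comp ρ) (ihs hρ hs) (iht hρ ht)
    | lett s t ihs iht =>
      obtain ⟨Γ', Δ, B, C, hj, hs, ht⟩ := hasType_lett.1 h
      have := iht (upr_injective (upr_injective hρ)) ht
      refine .lett (hj.comp ρ) (ihs hρ hs) ?_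
      convert this using 1
      funext i; rcases i with _ | _ | i <;> rfl
  · rintro ⟨h₁, h₂⟩
    generalize hΔ : Γ ∘ ρ = Δ at h₂
    have key : ∀ {Γ Δ : TyCtx} {ρ : ℕ → ℕ} (A), (∀ i, (∀ j, ρ j ≠ i) → Γ i = none) → Γ ∘ ρ = Δ →
        (∀ i, (∀ j, upr ρ j ≠ i) → TyCtx.cons A Γ i = none) ∧
          TyCtx.cons A Γ ∘ upr ρ = TyCtx.cons A Δ := by
      intro Γ Δ ρ A h₁ hΔ
      refine ⟨fun i hi => ?_, ?_⟩
      · cases i with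
        | zero => exact absurd rfl (hi 0)
        | succ i => exact h₁ i fun j hj => hi (j + 1) (by simp [upr, hj])
      · subst hΔ; funext i; cases i <;> rfl
    have key' : ∀ {Γ Δ₁ Δ₂ : TyCtx} {ρ : ℕ → ℕ}, Function.Injective ρ →
        (∀ i, (∀ j, ρ j ≠ i) → Γ i = none) → Δ₁.Join Δ₂ (Γ ∘ ρ) →
        ∃ Γ₁ Γ₂ : TyCtx, Γ₁.Join Γ₂ Γ ∧ Γ₁ ∘ ρ = Δ₁ ∧ Γ₂ ∘ ρ = Δ₂ ∧
          (∀ i, (∀ j, ρ j ≠ i) → Γ₁ i = none) ∧ ∀ i, (∀ j, ρ j ≠ i) → Γ₂ i = none := by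
      intro Γ Δ₁ Δ₂ ρ hρ h₁ hj
      -- A splitting of the pulled-back context is pushed forward along `ρ`, with nothing declared
      -- outside its range.
      refine ⟨Function.extend ρ Δ₁ fun _ => none, Function.extend ρ Δ₂ fun _ => none, fun i => ?_,
        funext fun i => hρ.extend_apply _ _ _, funext fun i => hρ.extend_apply _ _ _,
        fun i hi => Function.extend_apply' _ _ _ (by simpa using hi),
        fun i hi => Function.extend_apply' _ _ _ (by simpa using hi)⟩
      by_cases hi : ∃ j, ρ j = i
      · obtain ⟨j, rfl⟩ := hi
        rw [hρ.extend_apply, hρ.extend_apply]; exact hj j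
      · rw [Function.extend_apply' _ _ _ hi, Function.extend_apply' _ _ _ hi,
          h₁ i (by simpa using hi)]
        simp
    induction h₂ generalizing Γ ρ with
    | @var Δ i A h =>
      rw [Term.rename, hasType_var]; subst h
      funext j
      by_cases hj : ∃ n, ρ n = j
      · obtain ⟨n, rfl⟩ := hj
        have := congrFun hΔ n
        simpa [TyCtx.single, hρ.eq_iff] using this
      · rw [h₁ j (by simpa using hj)]
        have : j ≠ ρ i := fun h => hj ⟨i, h.symm⟩
        simp [TyCtx.single, this]
    | lam _ ih => exact .lam (ih (upr_injective hρ) (key _ h₁ hΔ).1 (key _ h₁ hΔ).2)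
    | app hj _ _ ih₁ ih₂ =>
      subst hΔ
      obtain ⟨Γ₁, Γ₂, hj', e₁, e₂, h₃, h₄⟩ := key' hρ h₁ hj
      exact .app hj' (ih₁ hρ h₃ e₁) (ih₂ hρ h₄ e₂)
    | pair hj _ _ ih₁ ih₂ =>
      subst hΔ
      obtain ⟨Γ₁, Γ₂, hj', e₁, e₂, h₃, h₄⟩ := key' hρ h₁ hj
      exact .pair hj' (ih₁ hρ h₃ e₁) (ih₂ hρ h₄ e₂)
    | lett hj _ _ ih₁ ih₂ =>
      subst hΔ
      obtain ⟨Γ₁, Γ₂, hj', e₁, e₂, h₃, h₄⟩ := key' hρ h₁ hj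
      exact .lett hj' (ih₁ hρ h₃ e₁) (ih₂ (upr_injective (upr_injective hρ))
        (key _ (key _ h₄ e₂).1 (key _ h₄ e₂).2).1 (key _ (key _ h₄ e₂).1 (key _ h₄ e₂).2).2)

theorem hasType_rename_succ {Γ : TyCtx} {t : Term} {A : Ty} :
    HasType Γ (t.rename Nat.succ) A ↔ Γ 0 = none ∧ HasType (Γ ∘ Nat.succ) t A := by
  rw [hasType_rename Nat.succ_injective]
  refine and_congr_left fun _ => ⟨fun h => h 0 (by simp), fun h i hi => ?_⟩
  cases i with
  | zero => exact h
  | succ i => exact absurd rfl (hi i)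

/-- A term whose context lacks the variable `0` is shifted. -/
theorem HasType.exists_rename_succ {Γ : TyCtx} {t : Term} {A : Ty} (h : HasType Γ t A)
    (h₀ : Γ 0 = none) : ∃ t', t = t'.rename Nat.succ ∧ HasType (Γ ∘ Nat.succ) t' A := by
  have : t = (t.subst (scons (.var 0) .var)).rename Nat.succ := by
    rw [Term.rename_subst]
    refine t.subst_var.symm.trans (Term.subst_congr fun k hk => ?_)
    cases k with
    | zero => exact absurd (h.occ_eq_zero h₀) hk
    | succ k => rfl
  refine ⟨_, this, ?_⟩
  rw [this, hasType_rename_succ] at h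
  exact h.2

theorem OneHole.hasType_off {k : ℕ} {ι : ℕ → ℕ} {e : Term} {σ : ℕ → Term} (h : OneHole k ι e σ)
    {t : Term} (ht : t.occ k = 0) {Γ : TyCtx} {A : Ty} :
    HasType Γ (t.subst σ) A ↔ ∃ Δ : TyCtx, Δ k = none ∧ Δ ∘ ι = Γ ∧ HasType Δ t A := by
  constructor
  · intro h'
    have e₁ : Function.extend ι Γ (fun _ => none) ∘ ι = Γ := funext fun i => h.inj.extend_apply _ _ _
    refine ⟨Function.extend ι Γ fun _ => none, ?_, e₁, ?_⟩
    · exact Function.extend_apply' _ _ _ fun ⟨i, hi⟩ => h.ne i hi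
    · rw [← h.rename_subst ht, hasType_rename h.inj, e₁]
      exact ⟨fun i hi => Function.extend_apply' _ _ _ (by simpa using hi), h'⟩
  · rintro ⟨Δ, -, rfl, h'⟩
    rw [← h.rename_subst ht, hasType_rename h.inj] at h'
    exact h'.2

/-- The regrouping of contexts common to all two-premise rules: the hole lies in the premise `P`,
which the context of `e` joins; `Q` is the premise without the hole. -/
theorem OneHole.join_iff {k : ℕ} {ι : ℕ → ℕ} {e : Term} {σ : ℕ → Term} (h : OneHole k ι e σ)
    {P Q : TyCtx → Prop} (hQ : ∀ Δ, Q Δ → Δ k = none) {Θ : TyCtx} :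
    (∃ Γ Δ B, Γ.Join (Δ ∘ ι) Θ ∧ Δ k = some B ∧ HasType Γ e B ∧
        ∃ Δ₁ Δ₂ : TyCtx, Δ₁.Join Δ₂ Δ ∧ P Δ₁ ∧ Q Δ₂) ↔
      ∃ Θ₁ Θ₂ : TyCtx, Θ₁.Join Θ₂ Θ ∧
        (∃ Γ Δ B, Γ.Join (Δ ∘ ι) Θ₁ ∧ Δ k = some B ∧ HasType Γ e B ∧ P Δ) ∧
        ∃ Δ, Δ k = none ∧ Δ ∘ ι = Θ₂ ∧ Q Δ := by
  constructor
  · rintro ⟨Γ, Δ, B, h₁, hB, he, Δ₁, Δ₂, h₂, hP, hQ'⟩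
    obtain ⟨E, h₃, h₄⟩ := h₁.comm.assoc (h₂.comm.comp ι)
    have := hQ _ hQ'
    exact ⟨E, _, h₄.comm, ⟨Γ, Δ₁, B, h₃.comm, by have := h₂ k; grind, he, hP⟩, Δ₂, this, rfl, hQ'⟩
  · rintro ⟨Θ₁, _, h₁, ⟨Γ, Δ₁, B, h₂, hB, he, hP⟩, Δ₂, hn, rfl, hQ'⟩
    refine ⟨Γ, Δ₁.union Δ₂, B, fun i => ?_, ?_, he, Δ₁, Δ₂, TyCtx.join_union fun j => ?_, hP, hQ'⟩
    · have := h₁ i; have := h₂ i; simp only [TyCtx.union, Function.comp] at *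
      grind
    · simp [TyCtx.union, hn, hB]
    · obtain rfl | ⟨i, rfl⟩ := h.cases j
      · exact .inr hn
      · have := h₁ i; have := h₂ i; simp only [Function.comp] at *; grind

/-- Typability of `t` with `e` for the hole `k`, in both directions. -/
theorem OneHole.hasType {k : ℕ} {ι : ℕ → ℕ} {e : Term} {σ : ℕ → Term} (h : OneHole k ι e σ)
    {t : Term} (ht : t.occ k = 1) {Θ : TyCtx} {A : Ty} :
    HasType Θ (t.subst σ) A ↔ ∃ (Γ Δ : TyCtx) (B : Ty),
      Γ.Join (Δ ∘ ι) Θ ∧ Δ k = some B ∧ HasType Γ e B ∧ HasType Δ t A := by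
  induction t generalizing k ι e σ Θ A with
  | var n =>
    have hn : n = k := by by_contra hn; simp [Term.occ, hn] at ht
    subst hn
    rw [Term.subst, h.at_hole]
    constructor
    · intro h'
      refine ⟨Θ, TyCtx.single n A, A, fun i => ?_, by simp [TyCtx.single], h', .var rfl⟩
      simp [TyCtx.single, h.ne]
    · rintro ⟨Γ, Δ, B, hj, hB, he, hv⟩
      rw [hasType_var] at hv; subst hv
      simp only [TyCtx.single, if_true, Option.some.injEq] at hB; subst hB
      convert he using 1
      funext i; have := hj i; simp [TyCtx.single, h.ne] at this; grind
  | app t s iht ihs =>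
    simp only [Term.occ] at ht
    obtain ⟨h₁, h₂⟩ | ⟨h₁, h₂⟩ : (t.occ k = 1 ∧ s.occ k = 0) ∨ (t.occ k = 0 ∧ s.occ k = 1) := by
      omega
    · have key := fun C => h.join_iff (Θ := Θ) (P := fun Δ => HasType Δ t (.arr C A))
        (Q := fun Δ => HasType Δ s C) fun Δ hΔ => by have := hΔ.occ k; grind
      simp only [Term.subst, hasType_app, iht h h₁, h.hasType_off h₂]
      constructor
      · rintro ⟨Θ₁, Θ₂, C, hj, ht, hs⟩
        obtain ⟨Γ, Δ, B, h₁, h₂, h₃, Δ₁, Δ₂, h₄⟩ := (key C).2 ⟨Θ₁, Θ₂, hj, ht, hs⟩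
        exact ⟨Γ, Δ, B, h₁, h₂, h₃, Δ₁, Δ₂, C, h₄⟩
      · rintro ⟨Γ, Δ, B, h₁, h₂, h₃, Δ₁, Δ₂, C, h₄⟩
        obtain ⟨Θ₁, Θ₂, h₅⟩ := (key C).1 ⟨Γ, Δ, B, h₁, h₂, h₃, Δ₁, Δ₂, h₄⟩
        exact ⟨Θ₁, Θ₂, C, h₅⟩
    · have key := fun C => h.join_iff (Θ := Θ) (Q := fun Δ => HasType Δ t (.arr C A))
        (P := fun Δ => HasType Δ s C) fun Δ hΔ => by have := hΔ.occ k; grind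
      simp only [Term.subst, hasType_app, ihs h h₂, h.hasType_off h₁]
      constructor
      · rintro ⟨Θ₁, Θ₂, C, hj, ht, hs⟩
        obtain ⟨Γ, Δ, B, h₁, h₂, h₃, Δ₁, Δ₂, h₄, h₅, h₆⟩ := (key C).2 ⟨Θ₂, Θ₁, hj.comm, hs, ht⟩
        exact ⟨Γ, Δ, B, h₁, h₂, h₃, Δ₂, Δ₁, C, h₄.comm, h₆, h₅⟩
      · rintro ⟨Γ, Δ, B, h₁, h₂, h₃, Δ₁, Δ₂, C, h₄, h₅, h₆⟩
        obtain ⟨Θ₁, Θ₂, h₇, h₈, h₉⟩ := (key C).1 ⟨Γ, Δ, B, h₁, h₂, h₃, Δ₂, Δ₁, h₄.comm, h₆, h₅⟩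
        exact ⟨Θ₂, Θ₁, C, h₇.comm, h₉, h₈⟩
  | lam t ih =>
    simp only [Term.subst, hasType_lam, ih h.ups ht, hasType_rename_succ]
    constructor
    · rintro ⟨C, D, rfl, Γ, Δ, B, hj, hB, ⟨hn, he⟩, ht⟩
      refine ⟨Γ ∘ Nat.succ, Δ ∘ Nat.succ, B, fun i => hj (i + 1), hB, he, C, D, rfl, ?_⟩
      convert ht using 1
      refine (TyCtx.eq_cons ?_).symm
      have := hj 0; simp only [Function.comp, upr, TyCtx.cons] at this; grind
    · rintro ⟨Γ, Δ, B, hj, hB, he, C, D, rfl, ht⟩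
      refine ⟨C, D, rfl, fun | 0 => none | n + 1 => Γ n, TyCtx.cons C Δ, B, ?_, hB, ⟨rfl, he⟩, ht⟩
      rintro (_ | i)
      · exact .inr ⟨rfl, rfl⟩
      · exact hj i
  | pair t s iht ihs =>
    simp only [Term.occ] at ht
    obtain ⟨h₁, h₂⟩ | ⟨h₁, h₂⟩ : (t.occ k = 1 ∧ s.occ k = 0) ∨ (t.occ k = 0 ∧ s.occ k = 1) := by
      omega
    · have key := fun C D => h.join_iff (Θ := Θ) (P := fun Δ => HasType Δ t C)
        (Q := fun Δ => HasType Δ s D) fun Δ hΔ => by have := hΔ.occ k; grind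
      simp only [Term.subst, hasType_pair, iht h h₁, h.hasType_off h₂]
      constructor
      · rintro ⟨Θ₁, Θ₂, C, D, rfl, hj, ht, hs⟩
        obtain ⟨Γ, Δ, B, h₁, h₂, h₃, Δ₁, Δ₂, h₄⟩ := (key C D).2 ⟨Θ₁, Θ₂, hj, ht, hs⟩
        exact ⟨Γ, Δ, B, h₁, h₂, h₃, Δ₁, Δ₂, C, D, rfl, h₄⟩
      · rintro ⟨Γ, Δ, B, h₁, h₂, h₃, Δ₁, Δ₂, C, D, rfl, h₄⟩
        obtain ⟨Θ₁, Θ₂, h₅⟩ := (key C D).1 ⟨Γ, Δ, B, h₁, h₂, h₃, Δ₁, Δ₂, h₄⟩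
        exact ⟨Θ₁, Θ₂, C, D, rfl, h₅⟩
    · have key := fun C D => h.join_iff (Θ := Θ) (Q := fun Δ => HasType Δ t C)
        (P := fun Δ => HasType Δ s D) fun Δ hΔ => by have := hΔ.occ k; grind
      simp only [Term.subst, hasType_pair, ihs h h₂, h.hasType_off h₁]
      constructor
      · rintro ⟨Θ₁, Θ₂, C, D, rfl, hj, ht, hs⟩
        obtain ⟨Γ, Δ, B, h₁, h₂, h₃, Δ₁, Δ₂, h₄, h₅, h₆⟩ := (key C D).2 ⟨Θ₂, Θ₁, hj.comm, hs, ht⟩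
        exact ⟨Γ, Δ, B, h₁, h₂, h₃, Δ₂, Δ₁, C, D, rfl, h₄.comm, h₆, h₅⟩
      · rintro ⟨Γ, Δ, B, h₁, h₂, h₃, Δ₁, Δ₂, C, D, rfl, h₄, h₅, h₆⟩
        obtain ⟨Θ₁, Θ₂, h₇, h₈, h₉⟩ := (key C D).1 ⟨Γ, Δ, B, h₁, h₂, h₃, Δ₂, Δ₁, h₄.comm, h₆, h₅⟩
        exact ⟨Θ₂, Θ₁, C, D, rfl, h₇.comm, h₉, h₈⟩
  | lett t s iht ihs =>
    simp only [Term.occ] at ht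
    obtain ⟨h₁, h₂⟩ | ⟨h₁, h₂⟩ :
        (t.occ k = 1 ∧ s.occ (k + 2) = 0) ∨ (t.occ k = 0 ∧ s.occ (k + 2) = 1) := by
      omega
    · have key := fun C D => h.join_iff (Θ := Θ) (P := fun Δ => HasType Δ t (.tensor C D))
        (Q := fun Δ => HasType (TyCtx.cons C (TyCtx.cons D Δ)) s A)
        fun Δ hΔ => by have : Δ k = none ∧ _ ∨ Δ k ≠ none ∧ _ := hΔ.occ (k + 2); grind
      have hs : ∀ {Γ : TyCtx} {C D}, HasType (TyCtx.cons C (TyCtx.cons D Γ)) (s.subst (LinLam.ups (LinLam.ups σ))) A ↔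
          ∃ Δ : TyCtx, Δ k = none ∧ Δ ∘ ι = Γ ∧ HasType (TyCtx.cons C (TyCtx.cons D Δ)) s A := by
        intro Γ C D
        rw [h.ups.ups.hasType_off h₂]
        constructor
        · rintro ⟨Δ, h₁, h₂, h₃⟩
          refine ⟨Δ ∘ Nat.succ ∘ Nat.succ, h₁, funext fun i => congrFun h₂ (i + 2), ?_⟩
          convert h₃ using 1
          have e₀ := congrFun h₂ 0
          have e₁ := congrFun h₂ 1
          funext i; match i with
          | 0 => exact e₀.symm
          | 1 => exact e₁.symm
          | i + 2 => rfl
        · rintro ⟨Δ, h₁, rfl, h₃⟩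
          refine ⟨_, h₁, ?_, h₃⟩
          funext i; match i with
          | 0 => rfl
          | 1 => rfl
          | i + 2 => rfl
      simp only [Term.subst, hasType_lett, iht h h₁, hs]
      constructor
      · rintro ⟨Θ₁, Θ₂, C, D, hj, ht, hs⟩
        obtain ⟨Γ, Δ, B, h₁, h₂, h₃, Δ₁, Δ₂, h₄⟩ := (key C D).2 ⟨Θ₁, Θ₂, hj, ht, hs⟩
        exact ⟨Γ, Δ, B, h₁, h₂, h₃, Δ₁, Δ₂, C, D, h₄⟩
      · rintro ⟨Γ, Δ, B, h₁, h₂, h₃, Δ₁, Δ₂, C, D, h₄⟩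
        obtain ⟨Θ₁, Θ₂, h₅⟩ := (key C D).1 ⟨Γ, Δ, B, h₁, h₂, h₃, Δ₁, Δ₂, h₄⟩
        exact ⟨Θ₁, Θ₂, C, D, h₅⟩
    · have key := fun C D => h.join_iff (Θ := Θ) (Q := fun Δ => HasType Δ t (.tensor C D))
        (P := fun Δ => HasType (TyCtx.cons C (TyCtx.cons D Δ)) s A)
        fun Δ hΔ => by have := hΔ.occ k; grind
      have hs : ∀ {Θ : TyCtx} {C D}, HasType (TyCtx.cons C (TyCtx.cons D Θ)) (s.subst (LinLam.ups (LinLam.ups σ))) A ↔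
          ∃ (Γ Δ : TyCtx) (B : Ty), Γ.Join (Δ ∘ ι) Θ ∧ Δ k = some B ∧ HasType Γ e B ∧
            HasType (TyCtx.cons C (TyCtx.cons D Δ)) s A := by
        intro Θ C D
        simp only [ihs h.ups.ups h₂, hasType_rename_succ]
        constructor
        · rintro ⟨Γ, Δ, B, hj, hB, ⟨h₁, h₁', h₂⟩, h₃⟩
          refine ⟨Γ ∘ Nat.succ ∘ Nat.succ, Δ ∘ Nat.succ ∘ Nat.succ, B, fun i => hj (i + 2), hB, h₂, ?_⟩
          convert h₃ using 1
          have e₀ := hj 0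
          have e₁ := hj 1
          simp only [Function.comp, upr, TyCtx.cons, zero_add, Nat.succ_eq_add_one] at *
          funext i; match i with
          | 0 => show some C = _; grind
          | 1 => show some D = _; grind
          | i + 2 => rfl
        · rintro ⟨Γ, Δ, B, hj, hB, h₁, h₂⟩
          refine ⟨fun | 0 => none | 1 => none | n + 2 => Γ n, TyCtx.cons C (TyCtx.cons D Δ), B, ?_,
            hB, ⟨rfl, rfl, h₁⟩, h₂⟩
          rintro (_ | _ | i)
          · exact .inr ⟨rfl, rfl⟩
          · exact .inr ⟨rfl, rfl⟩
          · exact hj i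
      simp only [Term.subst, hasType_lett, hs, h.hasType_off h₁]
      constructor
      · rintro ⟨Θ₁, Θ₂, C, D, hj, ht, hs⟩
        obtain ⟨Γ, Δ, B, h₁, h₂, h₃, Δ₁, Δ₂, h₄, h₅, h₆⟩ := (key C D).2 ⟨Θ₂, Θ₁, hj.comm, hs, ht⟩
        exact ⟨Γ, Δ, B, h₁, h₂, h₃, Δ₂, Δ₁, C, D, h₄.comm, h₆, h₅⟩
      · rintro ⟨Γ, Δ, B, h₁, h₂, h₃, Δ₁, Δ₂, C, D, h₄, h₅, h₆⟩
        obtain ⟨Θ₁, Θ₂, h₇, h₈, h₉⟩ := (key C D).1 ⟨Γ, Δ, B, h₁, h₂, h₃, Δ₂, Δ₁, h₄.comm, h₆, h₅⟩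
        exact ⟨Θ₂, Θ₁, C, D, h₇.comm, h₉, h₈⟩

/-- From left to right `t.occ 0 = 1` is essential: an erased `e` need not be typable, and the copies
of a duplicated `e` could have different types. -/
theorem hasType_inst {t e : Term} (ht : t.occ 0 = 1) {Θ : TyCtx} {A : Ty} :
    HasType Θ (t.inst e) A ↔
      ∃ (Γ Δ : TyCtx) (B : Ty), Γ.Join Δ Θ ∧ HasType Γ e B ∧ HasType (TyCtx.cons B Δ) t A := by
  rw [Term.inst, (OneHole.scons e).hasType ht]
  constructor
  · rintro ⟨Γ, Δ, B, hj, hB, he, h⟩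
    exact ⟨Γ, Δ ∘ Nat.succ, B, hj, he, by rwa [← TyCtx.eq_cons hB]⟩
  · rintro ⟨Γ, Δ, B, hj, he, h⟩
    exact ⟨Γ, TyCtx.cons B Δ, B, hj, rfl, he, h⟩

theorem hasType_subst_repl {t e : Term} {k : ℕ} (ht : t.occ k = 1) {Θ : TyCtx} {A : Ty} :
    HasType Θ (t.subst (repl k e)) A ↔ ∃ (Γ Δ : TyCtx) (B : Ty),
      Γ.Join (Function.update Δ k none) Θ ∧ Δ k = some B ∧ HasType Γ e B ∧ HasType Δ t A := by
  rw [Term.subst_repl, hasType_inst (by rwa [Term.occ_toFront])]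
  simp only [hasType_rename (toFront_injective k)]
  constructor
  · rintro ⟨Γ, Δ, B, hj, he, h₁, h₂⟩
    refine ⟨Γ, _, B, ?_, by simp [toFront, TyCtx.cons], he, h₂⟩
    convert hj using 1
    funext i
    by_cases hi : i = k
    · subst hi
      have := h₁ (i + 1) fun j => by simp only [toFront]; split_ifs <;> omega
      simpa [TyCtx.cons] using this.symm
    · simp [hi, toFront, TyCtx.cons]
  · rintro ⟨Γ, Δ, B, hj, hB, he, h⟩
    refine ⟨Γ, _, B, hj, he, fun i hi => ?_, ?_⟩
    · cases i with
      | zero => exact absurd (by simp [toFront]) (hi k)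
      | succ i =>
        by_cases hik : i = k
        · simp [hik, TyCtx.cons]
        · exact absurd (by simp [toFront, hik]) (hi i)
    · convert h using 1
      funext i
      by_cases hi : i = k
      · subst hi; simp [toFront, TyCtx.cons, hB]
      · simp [toFront, TyCtx.cons, hi]

/-! ## Substitution in types -/

theorem TyCtx.map_single (f : Ty → Ty) (i : ℕ) (A : Ty) :
    (fun j => (TyCtx.single i A j).map f) = TyCtx.single i (f A) := by
  funext j; simp only [TyCtx.single]; split_ifs <;> rfl

theorem TyCtx.map_cons (f : Ty → Ty) (A : Ty) (Γ : TyCtx) :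
    (fun j => (TyCtx.cons A Γ j).map f) = TyCtx.cons (f A) fun j => (Γ j).map f := by
  funext j; cases j <;> rfl

theorem TyCtx.Join.map {Γ Δ Θ : TyCtx} (h : Γ.Join Δ Θ) (f : Ty → Ty) :
    TyCtx.Join (fun j => (Γ j).map f) (fun j => (Δ j).map f) (fun j => (Θ j).map f) := fun i =>
  (h i).imp (fun h => ⟨by simp [h.1], by simp [h.2]⟩) fun h => ⟨by simp [h.1], by simp [h.2]⟩

theorem HasType.tySubst {Γ : TyCtx} {t : Term} {A : Ty} (h : HasType Γ t A) (θ : ℕ → Ty) :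
    HasType (fun i => (Γ i).map (Ty.subst θ)) t (A.subst θ) := by
  induction h with
  | var h => subst h; exact .var (TyCtx.map_single _ _ _)
  | lam _ ih => rw [TyCtx.map_cons] at ih; exact .lam ih
  | app hj _ _ ih₁ ih₂ => exact .app (hj.map _) ih₁ ih₂
  | pair hj _ _ ih₁ ih₂ => exact .pair (hj.map _) ih₁ ih₂
  | lett hj _ _ ih₁ ih₂ =>
    rw [TyCtx.map_cons, TyCtx.map_cons] at ih₂; exact .lett (hj.map _) ih₁ ih₂

theorem TermEq.tySubst {Γ : TyCtx} {t u : Term} {A : Ty} (h : TermEq Γ t u A) (θ : ℕ → Ty) :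
    TermEq (fun i => (Γ i).map (Ty.subst θ)) t u (A.subst θ) := by
  induction h with
  | refl h => exact .refl (h.tySubst θ)
  | symm _ ih => exact .symm ih
  | trans _ _ ih₁ ih₂ => exact .trans ih₁ ih₂
  | comm h hc => exact .comm (h.tySubst θ) hc
  | betaEta h hr => exact .betaEta (h.tySubst θ) hr
  | lam _ ih => rw [TyCtx.map_cons] at ih; exact .lam ih
  | app hj _ _ ih₁ ih₂ => exact .app (hj.map _) ih₁ ih₂
  | pair hj _ _ ih₁ ih₂ => exact .pair (hj.map _) ih₁ ih₂
  | lett hj _ _ ih₁ ih₂ =>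
    rw [TyCtx.map_cons, TyCtx.map_cons] at ih₂; exact .lett (hj.map _) ih₁ ih₂

/-! ## Linear conversion -/

/-- The congruence generated by the `β` rules for binders that bind exactly one occurrence, and by
the commutation of `let` with a linear hole. -/
inductive BC : Term → Term → Prop
  | refl (t : Term) : BC t t
  | symm {t u : Term} (h : BC t u) : BC u t
  | trans {t u v : Term} (h₁ : BC t u) (h₂ : BC u v) : BC t v
  | app {t t' s s' : Term} (h₁ : BC t t') (h₂ : BC s s') : BC (.app t s) (.app t' s')
  | lam {t t' : Term} (h : BC t t') : BC (.lam t) (.lam t')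
  | pair {t t' s s' : Term} (h₁ : BC s s') (h₂ : BC t t') : BC (.pair s t) (.pair s' t')
  | lett {t t' s s' : Term} (h₁ : BC s s') (h₂ : BC t t') : BC (.lett s t) (.lett s' t')
  | beta1 {t : Term} (h : t.occ 0 = 1) (s : Term) : BC (.app (.lam t) s) (t.inst s)
  | beta2 {t : Term} (h₀ : t.occ 0 = 1) (h₁ : t.occ 1 = 1) (u v : Term) :
      BC (.lett (.pair u v) t) (t.subst (scons u (scons v .var)))
  | comm {t : Term} (h : t.occ 0 = 1) (e w : Term) :
      BC (t.inst (.lett e w)) (.lett e ((t.rename (upr (· + 2))).inst w))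

theorem BC.subst {t u : Term} (h : BC t u) (σ : ℕ → Term) : BC (t.subst σ) (u.subst σ) := by
  induction h generalizing σ with
  | refl t => exact .refl _
  | symm _ ih => exact .symm (ih σ)
  | trans _ _ ih₁ ih₂ => exact .trans (ih₁ σ) (ih₂ σ)
  | app _ _ ih₁ ih₂ => exact .app (ih₁ σ) (ih₂ σ)
  | lam _ ih => exact .lam (ih _)
  | pair _ _ ih₁ ih₂ => exact .pair (ih₁ σ) (ih₂ σ)
  | lett _ _ ih₁ ih₂ => exact .lett (ih₁ σ) (ih₂ _)
  | beta1 h s =>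
    rw [Term.inst_subst]
    exact .beta1 (by rwa [Term.occ_zero_ups]) _
  | @beta2 t h₀ h₁ u v =>
    have := BC.beta2 (t := t.subst (ups (ups σ))) (by rwa [Term.occ_zero_ups_ups])
      (by rwa [Term.occ_one_ups_ups]) (u.subst σ) (v.subst σ)
    simp only [Term.subst, Term.subst_subst] at this ⊢
    convert this using 2
    funext n
    match n with
    | 0 => rfl
    | 1 => rfl
    | n + 2 =>
      simp only [scons, ups, Term.subst_rename, Term.rename_rename, Term.subst]
      exact (Term.subst_var _).symm
  | @comm t h e w =>
    have := BC.comm (t := t.subst (ups σ)) (by rwa [Term.occ_zero_ups]) (e.subst σ)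
      (w.subst (ups (ups σ)))
    rw [Term.inst_subst]
    simp only [Term.subst, Term.inst, Term.subst_rename, Term.subst_subst, Term.rename_subst]
      at this ⊢
    convert this using 3
    funext n
    cases n with
    | zero => rfl
    | succ n =>
      simp only [Function.comp, upr, ups, scons, Term.subst, Term.rename_rename, Term.subst_rename]
      rw [Term.rename_eq_subst]; rfl

theorem BC.rename {t u : Term} (h : BC t u) (ρ : ℕ → ℕ) : BC (t.rename ρ) (u.rename ρ) := by
  rw [Term.rename_eq_subst, Term.rename_eq_subst]; exact h.subst _

theorem BC.subst_congr (t : Term) {σ τ : ℕ → Term} (h : ∀ n, BC (σ n) (τ n)) :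
    BC (t.subst σ) (t.subst τ) := by
  have key : ∀ {σ τ : ℕ → Term}, (∀ n, BC (σ n) (τ n)) → ∀ n, BC (ups σ n) (ups τ n) := by
    intro σ τ h n
    cases n with
    | zero => exact .refl _
    | succ n => exact (h n).rename _
  induction t generalizing σ τ with
  | var n => exact h n
  | app t s iht ihs => exact .app (iht h) (ihs h)
  | lam t ih => exact .lam (ih (key h))
  | pair t s iht ihs => exact .pair (iht h) (ihs h)
  | lett t s iht ihs => exact .lett (iht h) (ihs (key (key h)))

theorem BC.subst_repl {t t' : Term} (ht : BC t t') (k : ℕ) {e e' : Term} (he : BC e e') :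
    BC (t.subst (repl k e)) (t'.subst (repl k e')) := by
  refine (ht.subst _).trans (BC.subst_congr _ fun n => ?_)
  by_cases h : n = k
  · subst h; simpa using he
  · simp [h, BC.refl]

/-- The commutation of `let` with the linear variable `k` of `t`. -/
theorem BC.comm_repl {t : Term} {k : ℕ} (h : t.occ k = 1) (e w : Term) :
    BC (t.subst (repl k (.lett e w))) (.lett e ((t.rename (· + 2)).subst (repl (k + 2) w))) := by
  rw [Term.subst_repl]
  convert BC.comm (t := t.rename (toFront k)) (by rwa [Term.occ_toFront]) e w using 2
  simp only [Term.inst, Term.subst_rename]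
  congr 1; funext n
  by_cases hn : n = k
  · subst hn; simp [toFront, upr, scons]
  · simp [toFront, hn, upr, scons]

/-! ## Linear conversion preserves and reflects typing -/

theorem Term.occ_one_inst_rename (t u : Term) :
    (t.inst (u.rename Nat.succ)).occ 0 = t.occ 1 := by
  refine Term.occ_subst (k := 1) rfl fun j hj => ?_
  match j, hj with
  | 0, _ => exact Term.occ_zero_rename_succ _
  | j + 2, _ => simp [scons, Term.occ]

/-- The two substitutions are made one at a time, so that each is a linear `inst`; the rest is
reassociation of contexts. -/
theorem hasType_beta2 {t : Term} (h₀ : t.occ 0 = 1) (h₁ : t.occ 1 = 1) {u v : Term} {Θ : TyCtx}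
    {A : Ty} : HasType Θ (.lett (.pair u v) t) A ↔
      HasType Θ (t.subst (scons u (scons v .var))) A := by
  rw [← Term.inst_inst, hasType_inst (by rwa [Term.occ_one_inst_rename])]
  simp only [hasType_inst h₀, hasType_rename_succ, hasType_lett, hasType_pair]
  constructor
  · rintro ⟨_, Δ, B, C, hj, ⟨Γ₁, Γ₂, _, _, e, hj', hu, hv⟩, ht⟩
    cases e
    obtain ⟨E, h₂, h₃⟩ := hj.assoc hj'.comm
    refine ⟨Γ₂, E, C, h₃, hv, fun | 0 => none | n + 1 => Γ₁ n, TyCtx.cons C Δ, B, ?_, ⟨rfl, hu⟩, ht⟩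
    rintro (_ | i)
    · exact .inr ⟨rfl, rfl⟩
    · exact h₂ i
  · rintro ⟨Γ₂, E, C, h₃, hv, Γ₁, Δ, B, h₂, ⟨hn, hu⟩, ht⟩
    obtain ⟨F, h₄, h₅⟩ := h₃.comm.assoc (h₂.comp Nat.succ)
    have hC : Δ 0 = some C := by
      have := h₂ 0; simp only [TyCtx.cons] at this; grind
    obtain ⟨G, h₆, h₇⟩ := h₅.comm.assoc h₄
    refine ⟨G, Δ ∘ Nat.succ, B, C, h₇.comm, ⟨_, _, _, _, rfl, h₆.comm, hu, hv⟩, ?_⟩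
    rwa [← TyCtx.eq_cons hC]

theorem hasType_comm {t : Term} (h : t.occ 0 = 1) {e w : Term} {Θ : TyCtx} {A : Ty} :
    HasType Θ (t.inst (.lett e w)) A ↔
      HasType Θ (.lett e ((t.rename (upr (· + 2))).inst w)) A := by
  have hinj : Function.Injective (upr (· + 2)) := upr_injective fun a b => by simp
  have hocc : (t.rename (upr (· + 2))).occ 0 = 1 := by
    rw [Term.occ_rename (k := 0), h]
    intro j; cases j <;> simp [upr]
  simp only [hasType_inst h, hasType_lett, hasType_inst hocc, hasType_rename hinj]
  constructor
  · rintro ⟨Γ, Δ, B, hj, ⟨Γ₁, Γ₂, C, D, hj', he, hw⟩, ht⟩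
    obtain ⟨E, h₁, h₂⟩ := hj.assoc hj'
    refine ⟨Γ₁, E, C, D, h₂, he, TyCtx.cons C (TyCtx.cons D Γ₂),
      fun | 0 => none | 1 => none | n + 2 => Δ n, B, ?_, hw, fun i hi => ?_, ?_⟩
    · rintro (_ | _ | i)
      · exact .inl ⟨rfl, rfl⟩
      · exact .inl ⟨rfl, rfl⟩
      · exact h₁ i
    · match i with
      | 0 => exact absurd rfl (hi 0)
      | 1 => rfl
      | 2 => rfl
      | i + 3 => exact absurd rfl (hi (i + 1))
    · convert ht using 1
      funext i; cases i <;> rfl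
  · rintro ⟨Γ₁, E, C, D, h₂, he, Γ₂, Δ, B, h₁, hw, hn, ht⟩
    -- `upr (· + 2)` misses exactly the indices `1` and `2`, the two variables of the `let` as seen
    -- under the hole variable.
    have hn₀ : Δ 0 = none := hn 1 fun j => by cases j <;> simp [upr]
    have hn₁ : Δ 1 = none := hn 2 fun j => by cases j <;> simp [upr]
    have e₀ : Γ₂ 0 = some C := by have := h₁ 0; simp only [TyCtx.cons] at this; grind
    have e₁ : (Γ₂ ∘ Nat.succ) 0 = some D := by
      have := h₁ 1; simp only [TyCtx.cons] at this; simp only [Function.comp]; grind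
    have h₃ := (h₁.comp Nat.succ).comp Nat.succ
    obtain ⟨F, h₄, h₅⟩ := h₂.comm.assoc h₃.comm
    refine ⟨F, Δ ∘ Nat.succ ∘ Nat.succ, B, h₅.comm, ⟨Γ₁, _, C, D, h₄.comm, he, ?_⟩, ?_⟩
    · rwa [TyCtx.eq_cons e₀, TyCtx.eq_cons e₁] at hw
    · convert ht using 1
      funext i; cases i <;> rfl

/-- Subject expansion holds along with reduction because the occurrence conditions in `BC` exclude
erasing and copying. Untyped terms can thus be converted first and typed afterwards. -/
theorem BC.hasType_iff {t u : Term} (h : BC t u) {Γ : TyCtx} {A : Ty} :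
    HasType Γ t A ↔ HasType Γ u A := by
  induction h generalizing Γ A with
  | refl t => rfl
  | symm _ ih => exact ih.symm
  | trans _ _ ih₁ ih₂ => exact ih₁.trans ih₂
  | app _ _ ih₁ ih₂ => simp only [hasType_app, ih₁, ih₂]
  | lam _ ih => simp only [hasType_lam, ih]
  | pair _ _ ih₁ ih₂ => simp only [hasType_pair, ih₁, ih₂]
  | lett _ _ ih₁ ih₂ => simp only [hasType_lett, ih₁, ih₂]
  | beta1 h s =>
    simp only [hasType_inst h, hasType_app, hasType_lam, Ty.arr.injEq]
    constructor
    · rintro ⟨Γ, Δ, B, hj, ⟨_, _, ⟨rfl, rfl⟩, ht⟩, hs⟩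
      exact ⟨Δ, Γ, B, hj.comm, hs, ht⟩
    · rintro ⟨Δ, Γ, B, hj, hs, ht⟩
      exact ⟨Γ, Δ, B, hj.comm, ⟨_, _, ⟨rfl, rfl⟩, ht⟩, hs⟩
  | beta2 h₀ h₁ u v => exact hasType_beta2 h₀ h₁
  | comm h e w => exact hasType_comm h

/-! ## Linear conversion is contained in the equality -/

theorem Context.rename_id (C : Context) : C.rename id = C := by
  induction C <;> simp_all [Context.rename, upr_id, Term.rename_id]

theorem OneHole.eq_rename {k : ℕ} {ι : ℕ → ℕ} {e : Term} {σ : ℕ → Term} (h : OneHole k ι e σ)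
    {t : Term} (ht : t.occ k = 0) {τ : ℕ → Term} {ρ : ℕ → ℕ} (hτ : ∀ i, τ (ι i) = .var (ρ i)) :
    t.subst τ = (t.subst σ).rename ρ := by
  conv_lhs => rw [← h.rename_subst ht]
  rw [Term.subst_rename, Term.rename_eq_subst]
  congr 1; funext i; exact hτ i

/-- A linear variable is the hole of a context. -/
theorem OneHole.exists_context {k : ℕ} {ι : ℕ → ℕ} {e : Term} {σ : ℕ → Term}
    (h : OneHole k ι e σ) {t : Term} (ht : t.occ k = 1) :
    ∃ C : Context, ∀ (ρ : ℕ → ℕ) (x : Term) (τ : ℕ → Term), τ k = x →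
      (∀ i, τ (ι i) = .var (ρ i)) → t.subst τ = (C.rename ρ).fill (x.rename (· + C.depth)) := by
  have key : ∀ {k : ℕ} {ι ρ : ℕ → ℕ} {x : Term} {τ : ℕ → Term}, τ k = x →
      (∀ i, τ (ι i) = .var (ρ i)) → LinLam.ups τ (k + 1) = x.rename Nat.succ ∧
      ∀ i, LinLam.ups τ (upr ι i) = .var (upr ρ i) := by
    intro k ι ρ x τ h₁ h₂
    refine ⟨by simp [LinLam.ups, LinLam.scons, h₁], fun i => ?_⟩
    cases i <;> simp [LinLam.ups, LinLam.scons, upr, h₂, Term.rename]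
  induction t generalizing k ι e σ with
  | var n =>
    have hn : n = k := by by_contra hn; simp [Term.occ, hn] at ht
    subst hn
    exact ⟨.hole, fun ρ x τ h₁ _ => h₁.trans (Term.rename_id x).symm⟩
  | app t s iht ihs =>
    simp only [Term.occ] at ht
    obtain ⟨h₁, h₂⟩ | ⟨h₁, h₂⟩ : (t.occ k = 1 ∧ s.occ k = 0) ∨ (t.occ k = 0 ∧ s.occ k = 1) := by
      omega
    · obtain ⟨C, hC⟩ := iht h h₁
      refine ⟨.appL C (s.subst σ), fun ρ x τ h₃ h₄ => ?_⟩
      simp only [Term.subst, Context.rename, Context.fill, Context.depth, hC ρ x τ h₃ h₄,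
        h.eq_rename h₂ h₄]
    · obtain ⟨C, hC⟩ := ihs h h₂
      refine ⟨.appR (t.subst σ) C, fun ρ x τ h₃ h₄ => ?_⟩
      simp only [Term.subst, Context.rename, Context.fill, Context.depth, hC ρ x τ h₃ h₄,
        h.eq_rename h₁ h₄]
  | lam t ih =>
    obtain ⟨C, hC⟩ := ih h.ups ht
    refine ⟨.lam C, fun ρ x τ h₃ h₄ => ?_⟩
    simp only [Term.subst, Context.rename, Context.fill, Context.depth,
      hC _ _ _ (key h₃ h₄).1 (key h₃ h₄).2, Term.rename_rename]
    congr 3; funext i; simp; omega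
  | pair t s iht ihs =>
    simp only [Term.occ] at ht
    obtain ⟨h₁, h₂⟩ | ⟨h₁, h₂⟩ : (t.occ k = 1 ∧ s.occ k = 0) ∨ (t.occ k = 0 ∧ s.occ k = 1) := by
      omega
    · obtain ⟨C, hC⟩ := iht h h₁
      refine ⟨.pairL C (s.subst σ), fun ρ x τ h₃ h₄ => ?_⟩
      simp only [Term.subst, Context.rename, Context.fill, Context.depth, hC ρ x τ h₃ h₄,
        h.eq_rename h₂ h₄]
    · obtain ⟨C, hC⟩ := ihs h h₂
      refine ⟨.pairR (t.subst σ) C, fun ρ x τ h₃ h₄ => ?_⟩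
      simp only [Term.subst, Context.rename, Context.fill, Context.depth, hC ρ x τ h₃ h₄,
        h.eq_rename h₁ h₄]
  | lett t s iht ihs =>
    simp only [Term.occ] at ht
    obtain ⟨h₁, h₂⟩ | ⟨h₁, h₂⟩ :
        (t.occ k = 1 ∧ s.occ (k + 2) = 0) ∨ (t.occ k = 0 ∧ s.occ (k + 2) = 1) := by
      omega
    · obtain ⟨C, hC⟩ := iht h h₁
      refine ⟨.lettL C (s.subst (LinLam.ups (LinLam.ups σ))), fun ρ x τ h₃ h₄ => ?_⟩
      have h₅ := key h₃ h₄
      simp only [Term.subst, Context.rename, Context.fill, Context.depth, hC ρ x τ h₃ h₄,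
        h.ups.ups.eq_rename h₂ (key h₅.1 h₅.2).2]
    · obtain ⟨C, hC⟩ := ihs h.ups.ups h₂
      refine ⟨.lettR (t.subst σ) C, fun ρ x τ h₃ h₄ => ?_⟩
      have h₅ := key h₃ h₄
      simp only [Term.subst, Context.rename, Context.fill, Context.depth,
        hC _ _ _ (key h₅.1 h₅.2).1 (key h₅.1 h₅.2).2, h.eq_rename h₁ h₄, Term.rename_rename]
      congr 3; funext i; simp; omega

theorem comm_inst_lett {t : Term} (h : t.occ 0 = 1) (e w : Term) :
    Comm (t.inst (.lett e w)) (.lett e ((t.rename (upr (· + 2))).inst w)) := by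
  obtain ⟨C, hC⟩ := (OneHole.scons e).exists_context h
  left
  -- One context is filled both with the whole `let` and, shifted over its two variables, with its
  -- body, as the two sides of `CommStep` require.
  have h₁ := hC id (.lett e w) (scons (.lett e w) .var) rfl fun _ => rfl
  have h₂ := hC (· + 2) w (scons w .var ∘ upr (· + 2)) rfl fun _ => rfl
  have h₃ := CommStep.step C e (w.rename (upr (upr (· + C.depth))))
  rw [Term.rename_rename] at h₃
  rw [Term.inst, h₁, Context.rename_id, Term.inst, Term.subst_rename, h₂]
  simp only [Term.rename]
  convert h₃ using 4
  funext n
  match n with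
  | 0 => simp [upr, swapBinders]
  | 1 => simp [upr, swapBinders]; omega
  | n + 2 => simp [upr, swapBinders]; omega

theorem Redex.termEq {t u : Term} (h : Redex t u) {Γ : TyCtx} {A : Ty} (ht : HasType Γ t A) :
    TermEq Γ t u A :=
  .betaEta ht ⟨t, u, .refl _, .step .hole h, .refl _⟩

theorem BC.termEq {t u : Term} (h : BC t u) {Γ : TyCtx} {A : Ty} (ht : HasType Γ t A) :
    TermEq Γ t u A := by
  induction h generalizing Γ A with
  | refl t => exact .refl ht
  | symm h ih => exact .symm (ih (h.hasType_iff.2 ht))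
  | trans h _ ih₁ ih₂ => exact .trans (ih₁ ht) (ih₂ (h.hasType_iff.1 ht))
  | app _ _ ih₁ ih₂ =>
    obtain ⟨_, _, _, hj, h₁, h₂⟩ := hasType_app.1 ht
    exact .app hj (ih₁ h₁) (ih₂ h₂)
  | lam _ ih =>
    obtain ⟨_, _, rfl, h⟩ := hasType_lam.1 ht
    exact .lam (ih h)
  | pair _ _ ih₁ ih₂ =>
    obtain ⟨_, _, _, _, rfl, hj, h₁, h₂⟩ := hasType_pair.1 ht
    exact .pair hj (ih₁ h₁) (ih₂ h₂)
  | lett _ _ ih₁ ih₂ =>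
    obtain ⟨_, _, _, _, hj, h₁, h₂⟩ := hasType_lett.1 ht
    exact .lett hj (ih₁ h₁) (ih₂ h₂)
  | beta1 h s => exact (Redex.beta1 _ _).termEq ht
  | beta2 _ _ u v => exact (Redex.beta2 _ _ _).termEq ht
  | comm h e w => exact .comm ht (comm_inst_lett h e w)

/-! ## Commutations of `let` with the term constructors -/

theorem BC.comm_app (e w s : Term) :
    BC (.app (.lett e w) s) (.lett e (.app w (s.rename (· + 2)))) := by
  have := BC.comm (t := .app (.var 0) (s.rename Nat.succ))
    (by simp [Term.occ, Term.occ_zero_rename_succ]) e w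
  simp only [Term.inst, Term.rename, Term.subst, Term.rename_rename, Term.subst_rename] at this
  rwa [show s.subst (scons (.lett e w) .var ∘ Nat.succ) = s from s.subst_var,
    show s.subst (scons w .var ∘ upr (· + 2) ∘ Nat.succ) = s.rename (· + 2) from
      (s.rename_eq_subst _).symm] at this

theorem BC.comm_pairL (e w s : Term) :
    BC (.pair (.lett e w) s) (.lett e (.pair w (s.rename (· + 2)))) := by
  have := BC.comm (t := .pair (.var 0) (s.rename Nat.succ))
    (by simp [Term.occ, Term.occ_zero_rename_succ]) e w
  simp only [Term.inst, Term.rename, Term.subst, Term.rename_rename, Term.subst_rename] at this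
  rwa [show s.subst (scons (.lett e w) .var ∘ Nat.succ) = s from s.subst_var,
    show s.subst (scons w .var ∘ upr (· + 2) ∘ Nat.succ) = s.rename (· + 2) from
      (s.rename_eq_subst _).symm] at this

theorem BC.comm_pairR (e w s : Term) :
    BC (.pair s (.lett e w)) (.lett e (.pair (s.rename (· + 2)) w)) := by
  have := BC.comm (t := .pair (s.rename Nat.succ) (.var 0))
    (by simp [Term.occ, Term.occ_zero_rename_succ]) e w
  simp only [Term.inst, Term.rename, Term.subst, Term.rename_rename, Term.subst_rename] at this
  rwa [show s.subst (scons (.lett e w) .var ∘ Nat.succ) = s from s.subst_var,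
    show s.subst (scons w .var ∘ upr (· + 2) ∘ Nat.succ) = s.rename (· + 2) from
      (s.rename_eq_subst _).symm] at this

theorem BC.comm_appR (e w s : Term) :
    BC (.app s (.lett e w)) (.lett e (.app (s.rename (· + 2)) w)) := by
  have := BC.comm (t := .app (s.rename Nat.succ) (.var 0))
    (by simp [Term.occ, Term.occ_zero_rename_succ]) e w
  simp only [Term.inst, Term.rename, Term.subst, Term.rename_rename, Term.subst_rename] at this
  rwa [show s.subst (scons (.lett e w) .var ∘ Nat.succ) = s from s.subst_var,
    show s.subst (scons w .var ∘ upr (· + 2) ∘ Nat.succ) = s.rename (· + 2) from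
      (s.rename_eq_subst _).symm] at this

theorem BC.comm_lett (e w s : Term) :
    BC (.lett (.lett e w) s) (.lett e (.lett w (s.rename (upr (upr (· + 2)))))) := by
  have hocc : (s.rename (upr (upr Nat.succ))).occ 2 = 0 :=
    Term.occ_rename_eq_zero fun j => by
      match j with
      | 0 => simp [upr]
      | 1 => simp [upr]
      | j + 2 => simp [upr]
  have := BC.comm (t := .lett (.var 0) (s.rename (upr (upr Nat.succ))))
    (by simp [Term.occ, hocc]) e w
  simp only [Term.inst, Term.rename, Term.subst, Term.rename_rename, Term.subst_rename] at this
  have e₁ : ups (ups (scons (.lett e w) .var)) ∘ upr (upr Nat.succ) = Term.var := by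
    funext n
    match n with
    | 0 => rfl
    | 1 => rfl
    | n + 2 => rfl
  have e₂ : ups (ups (scons w .var)) ∘ upr (upr (upr (· + 2))) ∘ upr (upr Nat.succ) =
      Term.var ∘ upr (upr (· + 2)) := by
    funext n
    match n with
    | 0 => rfl
    | 1 => rfl
    | n + 2 => rfl
  rwa [e₁, e₂, Term.subst_var, ← Term.rename_eq_subst] at this

/-! ## Head forms and cut-free terms -/

/-- The possible heads of a typable term, up to linear conversion. -/
inductive HeadForm (s : Term) : Prop
  | var (i : ℕ) (h : s = .var i)
  | lam (t : Term) (h : s = .lam t)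
  | pair (t u : Term) (h : s = .pair t u)
  | lett (z : ℕ) (t : Term) (h : BC s (.lett (.var z) t)) (hs : t.size + 1 < s.size)
  | arr (f : ℕ) (u t : Term) (h : BC s (t.subst (repl f (.app (.var f) u)))) (hf : t.occ f = 1)
      (hs : t.size + u.size < s.size)
  | step (s' : Term) (h : BC s s') (hs : s'.size < s.size)

/-- `f` is still free in the substituted `f u`, so it is declared in `Γ`; by linearity it is then
absent from whatever `t` is applied to or bound in. -/
theorem HasType.head_ne_none {Γ : TyCtx} {f : ℕ} {t u : Term} {A : Ty} (hf : t.occ f = 1)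
    (h : HasType Γ (t.subst (repl f (.app (.var f) u))) A) : Γ f ≠ none := by
  obtain ⟨Γ₁, Δ, B, hj, hB, h₁, h₂⟩ := (hasType_subst_repl hf).1 h
  obtain ⟨Γ₃, Γ₄, C, hj', h₃, h₄⟩ := hasType_app.1 h₁
  rw [hasType_var] at h₃
  subst h₃
  have := hj f; have := hj' f
  simp only [TyCtx.single] at this; grind

/-- Only the head matters: around an applied variable, further applications and `let`s are absorbed
into the surrounding term; a `let` at the head is commuted outwards; a head redex is contracted. The
size bounds drive the induction in `HasType.exists_cf`. -/
theorem HasType.headForm {Γ : TyCtx} {s : Term} {A : Ty} (h : HasType Γ s A) : HeadForm s := by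
  induction h with
  | var h => exact .var _ rfl
  | lam h => exact .lam _ rfl
  | pair => exact .pair _ _ rfl
  | @app Γ Δ Θ t s A B hj ht hs iht _ =>
    cases iht with
    | var i h =>
      subst h
      refine .arr i s (.var i) ?_ (by simp [Term.occ]) (by simp only [Term.size]; omega)
      simp [Term.subst, BC.refl]
    | lam t' h =>
      subst h
      obtain ⟨_, _, e, ht'⟩ := hasType_lam.1 ht
      have hocc := ht'.occ_eq_one (k := 0) rfl
      refine .step _ (.beta1 hocc s) ?_
      have := (OneHole.scons s).size_subst hocc
      simp only [Term.inst, Term.size]; omega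
    | pair t' u' h =>
      subst h
      obtain ⟨_, _, _, _, e, _⟩ := hasType_pair.1 ht
      cases e
    | lett z t' h hsz =>
      refine .lett z (.app t' (s.rename (· + 2))) ((BC.app h (.refl s)).trans (.comm_app _ _ _)) ?_
      simp only [Term.size, Term.size_rename]; omega
    | arr f u t' h hf hsz =>
      have h₁ := HasType.head_ne_none hf (h.hasType_iff.1 ht)
      have h₂ : s.occ f = 0 := hs.occ_eq_zero (by have := hj f; grind)
      refine .arr f u (.app t' s) ?_ (by simp [Term.occ, hf, h₂]) (by simp only [Term.size]; omega)
      rw [Term.subst, Term.subst_repl_of_occ_eq_zero h₂]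
      exact .app h (.refl s)
    | step t' h hsz =>
      exact .step _ (.app h (.refl s)) (by simp only [Term.size]; omega)
  | @lett Γ Δ Θ s t A B C hj hs ht ihs _ =>
    cases ihs with
    | var i h => subst h; exact .lett i t (.refl _) (by simp only [Term.size]; omega)
    | lam t' h =>
      subst h
      obtain ⟨_, _, e, ht'⟩ := hasType_lam.1 hs
      cases e
    | pair u v h =>
      subst h
      have h₀ := ht.occ_eq_one (k := 0) rfl
      have h₁ := ht.occ_eq_one (k := 1) rfl
      refine .step _ (.beta2 h₀ h₁ u v) ?_
      have e₁ := (OneHole.scons (u.rename Nat.succ)).size_subst h₀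
      have e₂ := (OneHole.scons v).size_subst (t := t.inst (u.rename Nat.succ))
        (by rwa [Term.occ_one_inst_rename])
      rw [show (t.inst (u.rename Nat.succ)).subst (scons v .var) = _ from Term.inst_inst t u v] at e₂
      simp only [Term.size, Term.inst, Term.size_rename] at *; omega
    | lett z t' h hsz =>
      refine .lett z (.lett t' (t.rename (upr (upr (· + 2)))))
        ((BC.lett h (.refl t)).trans (.comm_lett _ _ _)) ?_
      simp only [Term.size, Term.size_rename]; omega
    | arr f u t' h hf hsz =>
      have h₁ := HasType.head_ne_none hf (h.hasType_iff.1 hs)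
      have h₂ : t.occ (f + 2) = 0 := ht.occ_eq_zero (by have := hj f; simp only [TyCtx.cons]; grind)
      refine .arr f u (.lett t' t) ?_ (by simp [Term.occ, hf, h₂]) (by simp only [Term.size]; omega)
      rw [Term.subst, ups_repl, ups_repl, Term.subst_repl_of_occ_eq_zero h₂]
      exact .lett h (.refl t)
    | step t' h hsz =>
      exact .step _ (.lett h (.refl t)) (by simp only [Term.size]; omega)

/-- Cut-free typing derivations, in the style of the sequent calculus. In the left rule for `⊸` the
variable `f` is used again for the result of the application. -/
inductive CF : TyCtx → Term → Ty → Prop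
  | ax (i : ℕ) (A : Ty) : CF (TyCtx.single i A) (.var i) A
  | lam {Γ : TyCtx} {t : Term} {A B : Ty} (h : CF (TyCtx.cons A Γ) t B) : CF Γ (.lam t) (.arr A B)
  | pair {Γ Δ Θ : TyCtx} {s t : Term} {A B : Ty} (hj : TyCtx.Join Γ Δ Θ) (hs : CF Γ s A)
      (ht : CF Δ t B) : CF Θ (.pair s t) (.tensor A B)
  | lett {Δ : TyCtx} {z : ℕ} {t : Term} {A B C : Ty} (hz : Δ z = none)
      (ht : CF (TyCtx.cons A (TyCtx.cons B Δ)) t C) :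
      CF (Function.update Δ z (some (.tensor A B))) (.lett (.var z) t) C
  | arr {Γ Δ Θ : TyCtx} {f : ℕ} {u t : Term} {A B C : Ty} (hf : Δ f = some B)
      (hj : TyCtx.Join Γ (Function.update Δ f (some (.arr A B))) Θ) (hu : CF Γ u A)
      (ht : CF Δ t C) : CF Θ (t.subst (repl f (.app (.var f) u))) C

theorem HasType.lett_var {Δ : TyCtx} {z : ℕ} {t : Term} {A B C : Ty} (hz : Δ z = none)
    (ht : HasType (TyCtx.cons A (TyCtx.cons B Δ)) t C) :
    HasType (Function.update Δ z (some (.tensor A B))) (.lett (.var z) t) C := by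
  refine .lett (fun i => ?_) (.var rfl) ht
  by_cases hi : i = z
  · subst hi; simp [TyCtx.single, hz]
  · simp [TyCtx.single, hi]

theorem HasType.subst_app {Γ Δ Θ : TyCtx} {f : ℕ} {u t : Term} {A B C : Ty} (hf : Δ f = some B)
    (hj : TyCtx.Join Γ (Function.update Δ f (some (.arr A B))) Θ) (hu : HasType Γ u A)
    (ht : HasType Δ t C) : HasType Θ (t.subst (repl f (.app (.var f) u))) C := by
  rw [hasType_subst_repl (ht.occ_eq_one hf)]
  have hn : Γ f = none := by have := hj f; simp at this; grind
  refine ⟨Function.update Γ f (some (.arr A B)), Δ, B, fun i => ?_, hf,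
    .app (Γ := TyCtx.single f (.arr A B)) (fun i => ?_) (.var rfl) hu, ht⟩
  · have := hj i
    by_cases hi : i = f
    · subst hi; simp [hn] at this ⊢; exact this
    · simpa [hi] using this
  · by_cases hi : i = f
    · subst hi; simp [TyCtx.single, hn]
    · simp [TyCtx.single, hi]

theorem CF.hasType {Γ : TyCtx} {t : Term} {A : Ty} (h : CF Γ t A) : HasType Γ t A := by
  induction h with
  | ax i A => exact .var rfl
  | lam _ ih => exact .lam ih
  | pair hj _ _ ih₁ ih₂ => exact .pair hj ih₁ ih₂
  | lett hz _ ih => exact .lett_var hz ih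
  | arr hf hj _ _ ih₁ ih₂ => exact .subst_app hf hj ih₁ ih₂

/-- Every typable term has a cut-free form. -/
theorem HasType.exists_cf {Γ : TyCtx} {s : Term} {A : Ty} (h : HasType Γ s A) :
    ∃ s', CF Γ s' A ∧ BC s s' := by
  induction hn : s.size using Nat.strong_induction_on generalizing Γ s A with
  | _ n ih =>
    subst hn
    cases h.headForm with
    | var i e =>
      subst e; rw [hasType_var] at h; subst h
      exact ⟨_, .ax i A, .refl _⟩
    | lam t e =>
      subst e
      obtain ⟨B, C, rfl, ht⟩ := hasType_lam.1 h
      obtain ⟨t', h₁, h₂⟩ := ih _ (by simp [Term.size]) ht rfl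
      exact ⟨_, .lam h₁, .lam h₂⟩
    | pair t u e =>
      subst e
      obtain ⟨Γ₁, Γ₂, B, C, rfl, hj, ht, hu⟩ := hasType_pair.1 h
      obtain ⟨t', h₁, h₂⟩ := ih _ (by simp only [Term.size]; omega) ht rfl
      obtain ⟨u', h₃, h₄⟩ := ih _ (by simp only [Term.size]; omega) hu rfl
      exact ⟨_, .pair hj h₁ h₃, .pair h₂ h₄⟩
    | lett z t e hs =>
      obtain ⟨Γ₁, Δ, B, C, hj, hz, ht⟩ := hasType_lett.1 (e.hasType_iff.1 h)
      rw [hasType_var] at hz; subst hz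
      obtain ⟨t', h₁, h₂⟩ := ih _ (by omega) ht rfl
      have e' : Γ = Function.update Δ z (some (.tensor B C)) := by
        funext i; have := hj i
        by_cases hi : i = z
        · subst hi; simp [TyCtx.single] at this; simp [this]
        · simp [TyCtx.single, hi] at this; simp [hi]; grind
      refine ⟨_, e' ▸ .lett ?_ h₁, e.trans (.lett (.refl _) h₂)⟩
      have := hj z; simp [TyCtx.single] at this; exact this.2
    | arr f u t e hf hs =>
      obtain ⟨Γ₁, Δ, B, hj, hB, hfu, ht⟩ := (hasType_subst_repl hf).1 (e.hasType_iff.1 h)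
      obtain ⟨Γ₂, Γ₃, C, hj', hf', hu⟩ := hasType_app.1 hfu
      rw [hasType_var] at hf'; subst hf'
      obtain ⟨t', h₁, h₂⟩ := ih _ (by omega) ht rfl
      obtain ⟨u', h₃, h₄⟩ := ih _ (by omega) hu rfl
      refine ⟨_, .arr hB (fun i => ?_) h₃ h₁,
        e.trans (h₂.subst_repl f (.app (.refl _) h₄))⟩
      have h₅ := hj i; have h₆ := hj' i
      by_cases hi : i = f
      · subst hi; simp [TyCtx.single] at h₅ h₆ ⊢; grind
      · simp [TyCtx.single, hi] at h₅ h₆ ⊢; grind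
    | step s' e hs =>
      obtain ⟨s'', h₁, h₂⟩ := ih _ hs (e.hasType_iff.1 h) rfl
      exact ⟨s'', h₁, e.trans h₂⟩

/-! ## Polarities of the atoms of a type -/

/-- `A.Agree b B`: the types `A` and `B` have the same shape, and the same variables at the
positive positions (`b = true`) or at the negative positions (`b = false`). -/
def Ty.Agree : Bool → Ty → Ty → Prop
  | b, .var m, .var n => b = true → m = n
  | b, .tensor A B, .tensor A' B' => A.Agree b A' ∧ B.Agree b B'
  | b, .arr A B, .arr A' B' => A.Agree (!b) A' ∧ B.Agree b B'
  | _, _, _ => False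

/-- The variables at the positive (`b = true`) or negative (`b = false`) positions. -/
def Ty.atoms : Bool → Ty → List ℕ
  | b, .var m => if b then [m] else []
  | b, .tensor A B => A.atoms b ++ B.atoms b
  | b, .arr A B => A.atoms (!b) ++ B.atoms b

theorem Ty.Agree.trans {b : Bool} {A B C : Ty} (h₁ : A.Agree b B) (h₂ : B.Agree b C) :
    A.Agree b C := by
  induction A generalizing b B C with
  | var m =>
    cases B <;> try exact h₁.elim
    cases C <;> try exact h₂.elim
    exact fun hb => (h₁ hb).trans (h₂ hb)
  | tensor A₁ A₂ ih₁ ih₂ | arr A₁ A₂ ih₁ ih₂ =>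
    cases B <;> try exact h₁.elim
    cases C <;> try exact h₂.elim
    exact ⟨ih₁ h₁.1 h₂.1, ih₂ h₁.2 h₂.2⟩

theorem Ty.Agree.symm {b : Bool} {A B : Ty} (h : A.Agree b B) : B.Agree b A := by
  induction A generalizing b B with
  | var m =>
    cases B <;> try exact h.elim
    exact fun hb => (h hb).symm
  | tensor A₁ A₂ ih₁ ih₂ | arr A₁ A₂ ih₁ ih₂ =>
    cases B <;> try exact h.elim
    exact ⟨ih₁ h.1, ih₂ h.2⟩

theorem Ty.Agree.atoms_eq {b : Bool} {A B : Ty} (h : A.Agree b B) : A.atoms b = B.atoms b := by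
  induction A generalizing b B with
  | var m =>
    cases B <;> try exact h.elim
    cases b
    · rfl
    · simp [Ty.atoms, h rfl]
  | tensor A₁ A₂ ih₁ ih₂ | arr A₁ A₂ ih₁ ih₂ =>
    cases B <;> try exact h.elim
    simp only [Ty.atoms, ih₁ h.1, ih₂ h.2]

/-- The renaming of the variables of a type. -/
abbrev Ty.ren (θ : ℕ → ℕ) (A : Ty) : Ty := A.subst fun n => .var (θ n)

/-- At each leaf the polarity decides which of `X` and `Y` prescribes the variable. -/
theorem Ty.Agree.merge {b : Bool} {θ : ℕ → ℕ} {X Y A : Ty} (hX : (X.ren θ).Agree b A)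
    (hY : (Y.ren θ).Agree (!b) A) :
    ∃ Z : Ty, X.Agree b Z ∧ Y.Agree (!b) Z ∧ Z.ren θ = A := by
  induction A generalizing b X Y with
  | var m =>
    cases X <;> cases Y <;> simp [Ty.ren, Ty.subst, Ty.Agree] at hX hY
    rename_i x y
    cases b with
    | true => exact ⟨.var x, by simp [Ty.Agree], by simp [Ty.Agree], by simpa [Ty.subst] using hX⟩
    | false => exact ⟨.var y, by simp [Ty.Agree], by simp [Ty.Agree], by simpa [Ty.subst] using hY⟩
  | tensor A₁ A₂ ih₁ ih₂ =>
    cases X <;> cases Y <;> simp [Ty.ren, Ty.subst, Ty.Agree] at hX hY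
    obtain ⟨Z₁, h₁, h₂, h₃⟩ := ih₁ hX.1 hY.1
    obtain ⟨Z₂, h₄, h₅, h₆⟩ := ih₂ hX.2 hY.2
    exact ⟨.tensor Z₁ Z₂, ⟨h₁, h₄⟩, ⟨h₂, h₅⟩, by simp only [Ty.subst, h₃, h₆]⟩
  | arr A₁ A₂ ih₁ ih₂ =>
    cases X <;> cases Y <;> simp [Ty.ren, Ty.subst, Ty.Agree] at hX hY
    obtain ⟨Z₁, h₁, h₂, h₃⟩ := ih₁ (b := !b) hX.1 (by simpa using hY.1)
    obtain ⟨Z₂, h₄, h₅, h₆⟩ := ih₂ hX.2 hY.2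
    exact ⟨.arr Z₁ Z₂, ⟨h₁, h₄⟩, ⟨h₂, h₅⟩, by simp only [Ty.subst, h₃, h₆]⟩

theorem TyCtx.map_eq_none {f : Ty → Ty} {Γ Γ' : TyCtx} (h : (fun i => (Γ' i).map f) = Γ) (i : ℕ) :
    Γ' i = none ↔ Γ i = none := by
  rw [← congrFun h i]; simp

theorem TyCtx.Join.exists_map {f : Ty → Ty} {Γ Δ Θ Γ' Δ' : TyCtx} (h : Γ.Join Δ Θ)
    (h₁ : (fun i => (Γ' i).map f) = Γ) (h₂ : (fun i => (Δ' i).map f) = Δ) :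
    ∃ Θ' : TyCtx, Γ'.Join Δ' Θ' ∧ (fun i => (Θ' i).map f) = Θ := by
  refine ⟨Γ'.union Δ', TyCtx.join_union fun i => ?_, funext fun i => ?_⟩
  · rw [TyCtx.map_eq_none h₁, TyCtx.map_eq_none h₂]; have := h i; grind
  · have := h i; have := congrFun h₁ i; have := congrFun h₂ i
    have := TyCtx.map_eq_none h₁ i; have := TyCtx.map_eq_none h₂ i
    simp only [TyCtx.union] at *; grind

/-- The variables at the negative positions of a typing can be chosen freely. -/
theorem CF.exists_labelling {Γ : TyCtx} {t : Term} {A : Ty} (h : CF Γ t A) (θ : ℕ → ℕ)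
    (Γ₀ : ℕ → Ty) (A₀ : Ty) (hA : (A₀.ren θ).Agree false A)
    (hΓ : ∀ x T, Γ x = some T → ((Γ₀ x).ren θ).Agree true T) :
    ∃ (Γ' : TyCtx) (A' : Ty), HasType Γ' t A' ∧ A₀.Agree false A' ∧ A'.ren θ = A ∧
      (∀ x T, Γ' x = some T → (Γ₀ x).Agree true T) ∧ (fun i => (Γ' i).map (Ty.ren θ)) = Γ := by
  induction h generalizing Γ₀ A₀ with
  | ax i A =>
    -- The negative positions of a sequent are the negative ones of the goal and the positive ones
    -- of the hypotheses, so an axiom receives exactly one label for each position of `A`.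
    obtain ⟨Z, h₁, h₂, h₃⟩ := Ty.Agree.merge (hΓ i A (by simp [TyCtx.single])) hA
    refine ⟨_, Z, .var rfl, h₂, h₃, fun x T hx => ?_, ?_⟩
    · simp only [TyCtx.single] at hx; split_ifs at hx with hi
      cases hx; exact hi ▸ h₁
    · rw [TyCtx.map_single, h₃]
  | @lam Γ t A B h ih =>
    cases A₀ with
    | arr A₁ A₂ =>
      simp only [Ty.subst, Ty.Agree, Bool.not_false] at hA
      obtain ⟨Γ', B', h₁, h₂, h₃, h₄, h₅⟩ := ih (fun | 0 => A₁ | n + 1 => Γ₀ n) A₂ hA.2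
        (fun x T hx => by
          cases x with
          | zero => cases hx; exact hA.1
          | succ x => exact hΓ x T hx)
      have h₆ := congrFun h₅ 0
      simp only [TyCtx.cons, Option.map_eq_some_iff] at h₆
      obtain ⟨A', h₇, h₈⟩ := h₆
      rw [TyCtx.eq_cons h₇] at h₁
      refine ⟨_, _, .lam h₁, ⟨h₄ 0 A' h₇, h₂⟩, by simp only [Ty.subst, h₃, ← h₈], fun x T hx =>
        h₄ (x + 1) T hx, funext fun i => congrFun h₅ (i + 1)⟩
    | _ => simp [Ty.subst, Ty.Agree] at hA
  | @pair Γ Δ Θ s t A B hj _ _ ihs iht =>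
    cases A₀ with
    | tensor A₁ A₂ =>
      simp only [Ty.subst, Ty.Agree] at hA
      obtain ⟨Γ', A', h₁, h₂, h₃, h₄, h₅⟩ := ihs Γ₀ A₁ hA.1 fun x T hx =>
        hΓ x T (by have := hj x; grind)
      obtain ⟨Δ', B', k₁, k₂, k₃, k₄, k₅⟩ := iht Γ₀ A₂ hA.2 fun x T hx =>
        hΓ x T (by have := hj x; grind)
      obtain ⟨Θ', h₆, h₇⟩ := hj.exists_map h₅ k₅
      refine ⟨Θ', _, .pair h₆ h₁ k₁, ⟨h₂, k₂⟩, by simp only [Ty.subst, h₃, k₃], fun x T hx => ?_, h₇⟩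
      have := h₆ x; have := h₄ x T; have := k₄ x T; grind
    | _ => simp [Ty.subst, Ty.Agree] at hA
  | @lett Δ z t A B C hz _ ih =>
    have hz' := hΓ z (.tensor A B) (by simp)
    cases hX : Γ₀ z with
    | tensor X Y =>
      rw [hX] at hz'
      simp only [Ty.subst, Ty.Agree] at hz'
      obtain ⟨Γ', C', h₁, h₂, h₃, h₄, h₅⟩ := ih (fun | 0 => X | 1 => Y | n + 2 => Γ₀ n) A₀ hA
        (fun x T hx => by
          match x with
          | 0 => cases hx; exact hz'.1
          | 1 => cases hx; exact hz'.2
          | x + 2 =>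
            refine hΓ x T ?_
            rw [Function.update_of_ne]
            · exact hx
            · rintro rfl; simp [TyCtx.cons, hz] at hx)
      have h₆ := congrFun h₅ 0
      have h₇ := congrFun h₅ 1
      simp only [TyCtx.cons, Option.map_eq_some_iff] at h₆ h₇
      obtain ⟨A', h₈, h₉⟩ := h₆
      obtain ⟨B', h₁₀, h₁₁⟩ := h₇
      rw [TyCtx.eq_cons h₈, TyCtx.eq_cons (Γ := Γ' ∘ Nat.succ) h₁₀] at h₁
      have hn : Γ' (z + 2) = none := (TyCtx.map_eq_none h₅ (z + 2)).2 hz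
      refine ⟨_, C', .lett_var hn h₁, h₂, h₃, fun x T hx => ?_, ?_⟩
      · by_cases hxz : x = z
        · subst hxz; simp at hx; subst hx
          rw [hX]; exact ⟨h₄ 0 _ h₈, h₄ 1 _ h₁₀⟩
        · rw [Function.update_of_ne hxz] at hx; exact h₄ (x + 2) T hx
      · funext i
        by_cases hi : i = z
        · subst hi; simp [Ty.subst, h₉, h₁₁]
        · rw [Function.update_of_ne hi, Function.update_of_ne hi]; exact congrFun h₅ (i + 2)
    | _ => simp [hX, Ty.subst, Ty.Agree] at hz'
  | @arr Γ Δ Θ f u t A B C hf hj _ _ ihu iht =>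
    have hΘ : Θ f = some (.arr A B) ∧ Γ f = none := by have := hj f; simp at this; grind
    have hz' := hΓ f (.arr A B) hΘ.1
    cases hX : Γ₀ f with
    | arr X Y =>
      rw [hX] at hz'
      simp only [Ty.subst, Ty.Agree, Bool.not_true] at hz'
      obtain ⟨Γ', A', h₁, h₂, h₃, h₄, h₅⟩ := ihu Γ₀ X hz'.1 fun x T hx =>
        hΓ x T (by have := hj x; grind)
      -- In the second premise `f` names the result of the application, so its prescribed labels
      -- become `Y`.
      obtain ⟨Δ', C', k₁, k₂, k₃, k₄, k₅⟩ := iht (Function.update Γ₀ f Y) A₀ hA fun x T hx => by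
        by_cases hxf : x = f
        · subst hxf; rw [hf] at hx; cases hx; simpa using hz'.2
        · rw [Function.update_of_ne hxf]
          have := hj x; rw [Function.update_of_ne hxf] at this
          exact hΓ x T (by grind)
      have k₆ := congrFun k₅ f
      simp only [hf, Option.map_eq_some_iff] at k₆
      obtain ⟨B', k₇, k₈⟩ := k₆
      have k₉ : (fun i => (Function.update Δ' f (some (.arr A' B')) i).map (Ty.ren θ)) =
          Function.update Δ f (some (.arr A B)) := by
        funext i
        by_cases hi : i = f
        · subst hi; simp [Ty.subst, h₃, k₈]
        · rw [Function.update_of_ne hi, Function.update_of_ne hi]; exact congrFun k₅ i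
      obtain ⟨Θ', h₆, h₇⟩ := hj.exists_map h₅ k₉
      refine ⟨Θ', C', .subst_app k₇ h₆ h₁ k₁, k₂, k₃, fun x T hx => ?_, h₇⟩
      have h₈ := h₆ x; have h₉ := h₄ x T
      have k₁₀ := k₄ x T
      by_cases hxf : x = f
      · subst hxf
        have := (TyCtx.map_eq_none h₅ x).2 hΘ.2
        simp [hx, this] at h₈; subst h₈
        have := k₄ x B' k₇
        simp at this
        rw [hX]; exact ⟨h₂, this⟩
      · rw [Function.update_of_ne hxf] at k₁₀ h₈; grind
    | _ => simp [hX, Ty.subst, Ty.Agree] at hz'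

/-! ## Each atom of a typing occurs at both polarities -/

/-- `v` is the variable of a position of polarity `b` in a type of `Γ`. -/
def TyCtx.HasAtom (b : Bool) (Γ : TyCtx) (v : ℕ) : Prop :=
  ∃ x T, Γ x = some T ∧ v ∈ T.atoms b

theorem TyCtx.hasAtom_cons {b : Bool} {Γ : TyCtx} {A : Ty} {v : ℕ} :
    (TyCtx.cons A Γ).HasAtom b v ↔ v ∈ A.atoms b ∨ Γ.HasAtom b v := by
  constructor
  · rintro ⟨_ | x, T, hx, hv⟩
    · cases hx; exact .inl hv
    · exact .inr ⟨x, T, hx, hv⟩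
  · rintro (h | ⟨x, T, hx, hv⟩)
    · exact ⟨0, A, rfl, h⟩
    · exact ⟨x + 1, T, hx, hv⟩

theorem TyCtx.Join.hasAtom {b : Bool} {Γ Δ Θ : TyCtx} (h : Γ.Join Δ Θ) {v : ℕ} :
    Θ.HasAtom b v ↔ Γ.HasAtom b v ∨ Δ.HasAtom b v := by
  constructor
  · rintro ⟨x, T, hx, hv⟩
    obtain ⟨h₁, -⟩ | ⟨-, h₁⟩ := h x
    · exact .inl ⟨x, T, h₁.trans hx, hv⟩
    · exact .inr ⟨x, T, h₁.trans hx, hv⟩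
  · rintro (⟨x, T, hx, hv⟩ | ⟨x, T, hx, hv⟩)
    · exact ⟨x, T, by have := h x; grind, hv⟩
    · exact ⟨x, T, by have := h x; grind, hv⟩

theorem TyCtx.hasAtom_single {b : Bool} {i : ℕ} {A : Ty} {v : ℕ} :
    (TyCtx.single i A).HasAtom b v ↔ v ∈ A.atoms b := by
  constructor
  · rintro ⟨x, T, hx, hv⟩
    simp only [TyCtx.single] at hx; split_ifs at hx; cases hx; exact hv
  · exact fun h => ⟨i, A, by simp [TyCtx.single], h⟩

theorem TyCtx.hasAtom_update {b : Bool} {Γ : TyCtx} {i : ℕ} {A : Ty} {v : ℕ} :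
    TyCtx.HasAtom b (Function.update Γ i (some A)) v ↔
      v ∈ A.atoms b ∨ TyCtx.HasAtom b (Function.update Γ i none) v := by
  have : TyCtx.Join (TyCtx.single i A) (Function.update Γ i none)
      (Function.update Γ i (some A)) := by
    intro j
    by_cases hj : j = i
    · subst hj; simp [TyCtx.single]
    · simp [TyCtx.single, hj]
  rw [this.hasAtom, TyCtx.hasAtom_single]

/-- `v` is the variable of a position of polarity `b` in the sequent `Γ ⊢ A`. -/
def SeqAtom (b : Bool) (Γ : TyCtx) (A : Ty) (v : ℕ) : Prop :=
  v ∈ A.atoms b ∨ Γ.HasAtom (!b) v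

/-- An axiom has its atoms at both polarities, and every cut-free rule carries exactly the positions
of its premises, with their polarities, to its conclusion. -/
theorem CF.seqAtom {Γ : TyCtx} {t : Term} {A : Ty} (h : CF Γ t A) {b : Bool} {v : ℕ}
    (hv : SeqAtom b Γ A v) : SeqAtom (!b) Γ A v := by
  induction h generalizing b with
  | ax i A =>
    simp only [SeqAtom, TyCtx.hasAtom_single, Bool.not_not] at *; exact hv.symm
  | lam _ ih =>
    have := @ih b
    simp only [SeqAtom, TyCtx.hasAtom_cons, Ty.atoms, List.mem_append, Bool.not_not] at *; tauto
  | pair hj _ _ ih₁ ih₂ =>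
    have := @ih₁ b; have := @ih₂ b
    simp only [SeqAtom, hj.hasAtom, Ty.atoms, List.mem_append, Bool.not_not] at *; tauto
  | @lett Δ z _ A B C hz _ ih =>
    have := @ih b
    have e : Function.update Δ z none = Δ := by rw [← hz, Function.update_eq_self]
    simp only [SeqAtom, TyCtx.hasAtom_cons, TyCtx.hasAtom_update, e, Ty.atoms, List.mem_append,
      Bool.not_not] at *
    tauto
  | @arr Γ Δ Θ f u t A B C hf hj _ _ ih₁ ih₂ =>
    have h₁ := @ih₁ b; have h₂ := @ih₂ b
    have e : Function.update Δ f (some B) = Δ := by rw [← hf, Function.update_eq_self]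
    rw [← e] at h₂
    simp only [SeqAtom, hj.hasAtom, TyCtx.hasAtom_update, Ty.atoms, List.mem_append,
      Bool.not_not] at *
    tauto

/-! ## Monochromatic types -/

/-- All the variables of the type have the colour `c`. -/
def Ty.Mono (χ : ℕ → Bool) (c : Bool) : Ty → Prop
  | .var v => χ v = c
  | .tensor A B => A.Mono χ c ∧ B.Mono χ c
  | .arr A B => A.Mono χ c ∧ B.Mono χ c

/-- Every type contains a variable, so no colour is vacuous. -/
theorem Ty.Mono.unique {χ : ℕ → Bool} {c d : Bool} {A : Ty} (h : A.Mono χ c) (h' : A.Mono χ d) :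
    c = d := by
  induction A with
  | var v => exact h.symm.trans h'
  | tensor A B ih _ => exact ih h.1 h'.1
  | arr A B ih _ => exact ih h.1 h'.1

theorem Ty.mono_iff {χ : ℕ → Bool} {c : Bool} {A : Ty} (b : Bool) :
    A.Mono χ c ↔ (∀ v ∈ A.atoms b, χ v = c) ∧ ∀ v ∈ A.atoms (!b), χ v = c := by
  induction A generalizing b with
  | var v => cases b <;> simp [Ty.Mono, Ty.atoms]
  | tensor A B ih₁ ih₂ =>
    simp only [Ty.Mono, Ty.atoms, List.mem_append, or_imp, forall_and, ih₁ b, ih₂ b]; tauto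
  | arr A B ih₁ ih₂ =>
    simp only [Ty.Mono, Ty.atoms, List.mem_append, or_imp, forall_and, ih₁ b, ih₂ b, Bool.not_not]
    tauto

/-- A typing with monochromatic types is monochromatic. -/
theorem CF.mono {χ : ℕ → Bool} {Γ : TyCtx} {t : Term} {A : Ty} (h : CF Γ t A) {c : Bool}
    (hA : A.Mono χ c) (hΓ : ∀ x T, Γ x = some T → ∃ d, T.Mono χ d) {x : ℕ} {T : Ty}
    (hx : Γ x = some T) : T.Mono χ c := by
  induction h generalizing c x T with
  | ax i A =>
    simp only [TyCtx.single] at hx; split_ifs at hx; cases hx; exact hA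
  | lam _ ih =>
    refine ih hA.2 (fun x T hx => ?_) (x := x + 1) hx
    cases x with
    | zero => cases hx; exact ⟨c, hA.1⟩
    | succ x => exact hΓ x T hx
  | pair hj _ _ ih₁ ih₂ =>
    obtain ⟨h₁, -⟩ | ⟨-, h₁⟩ := hj x
    · exact ih₁ hA.1 (fun x T hx => hΓ x T (by have := hj x; grind)) (h₁.trans hx)
    · exact ih₂ hA.2 (fun x T hx => hΓ x T (by have := hj x; grind)) (h₁.trans hx)
  | @lett Δ z t A B C hz _ ih =>
    obtain ⟨d, hd⟩ := hΓ z _ (Function.update_self ..)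
    have key : ∀ {x T}, TyCtx.cons A (TyCtx.cons B Δ) x = some T → T.Mono χ c := by
      refine ih hA fun x T hx => ?_
      match x with
      | 0 => cases hx; exact ⟨d, hd.1⟩
      | 1 => cases hx; exact ⟨d, hd.2⟩
      | x + 2 =>
        refine hΓ x T ?_
        rw [Function.update_of_ne]
        · exact hx
        · intro e; replace hx : Δ x = some T := hx; rw [e, hz] at hx; cases hx
    by_cases hxz : x = z
    · rw [hxz, Function.update_self] at hx; cases hx
      exact ⟨key (x := 0) rfl, key (x := 1) rfl⟩
    · rw [Function.update_of_ne hxz] at hx; exact key (x := x + 2) hx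
  | @arr Γ Δ Θ f u t A B C hf hj _ _ ihu iht =>
    have hΘ : Θ f = some (.arr A B) := by have := hj f; simp at this; grind
    obtain ⟨d, hd⟩ := hΓ f _ hΘ
    have key : ∀ {x T}, Δ x = some T → T.Mono χ c := by
      refine iht hA fun x T hx => ?_
      by_cases hxf : x = f
      · subst hxf; rw [hf] at hx; cases hx; exact ⟨d, hd.2⟩
      · have := hj x; rw [Function.update_of_ne hxf] at this
        exact hΓ x T (by grind)
    -- The result of `f` has colour `c` by induction; as `f` is monochromatic, its argument has
    -- colour `c` too, which settles the context of `u`.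
    have hdc : d = c := hd.2.unique (key hf)
    subst hdc
    by_cases hxf : x = f
    · subst hxf; rw [hΘ] at hx; cases hx; exact hd
    · have := hj x; rw [Function.update_of_ne hxf] at this
      obtain ⟨h₁, -⟩ | ⟨-, h₁⟩ := this
      · exact ihu hd.1 (fun x T hx => hΓ x T (by have := hj x; grind)) (h₁.trans hx)
      · exact key (h₁.trans hx)

open Classical in
/-- The part of a context that consists of the types of colour `c`. -/
noncomputable def TyCtx.col (χ : ℕ → Bool) (c : Bool) (Θ : TyCtx) : TyCtx :=
  fun i => (Θ i).filter fun T => T.Mono χ c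

/-- All types of the context are monochromatic. -/
def TyCtx.AllMono (χ : ℕ → Bool) (Θ : TyCtx) : Prop := ∀ x T, Θ x = some T → ∃ d, T.Mono χ d

section
variable {χ : ℕ → Bool} {c d : Bool} {Γ Δ Θ : TyCtx} {A B C : Ty} {i : ℕ}

theorem TyCtx.col_eq_some : Θ.col χ c i = some A ↔ Θ i = some A ∧ A.Mono χ c := by
  simp [TyCtx.col, Option.filter_eq_some_iff]

theorem TyCtx.col_of_mono (h : Θ i = some A) (hA : A.Mono χ c) : Θ.col χ c i = some A :=
  TyCtx.col_eq_some.2 ⟨h, hA⟩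

theorem TyCtx.col_eq_none (h : Θ i = some A) (hA : ¬ A.Mono χ c) : Θ.col χ c i = none := by
  simp [TyCtx.col, h, hA]

theorem TyCtx.col_of_none (h : Θ i = none) : Θ.col χ c i = none := by
  simp [TyCtx.col, h]

theorem TyCtx.col_congr (h : Γ i = Θ i) : Γ.col χ c i = Θ.col χ c i := by
  simp [TyCtx.col, h]

theorem TyCtx.col_eq_self (h : ∀ x T, Γ x = some T → T.Mono χ c) : Γ.col χ c i = Γ i := by
  cases hi : Γ i with
  | none => exact TyCtx.col_of_none hi
  | some T => exact TyCtx.col_of_mono hi (h i T hi)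

theorem TyCtx.col_eq_none_of_ne (h : ∀ x T, Γ x = some T → T.Mono χ c) (hcd : c ≠ d) :
    Γ.col χ d i = none := by
  cases hi : Γ i with
  | none => exact TyCtx.col_of_none hi
  | some T => exact TyCtx.col_eq_none hi fun h' => hcd ((h i T hi).unique h')

theorem Ty.Mono.not (h : A.Mono χ c) (hcd : c ≠ d) : ¬ A.Mono χ d := fun h' => hcd (h.unique h')

theorem TyCtx.col_cons (h : A.Mono χ c) : (TyCtx.cons A Γ).col χ c = TyCtx.cons A (Γ.col χ c) := by
  funext j; cases j with
  | zero => exact TyCtx.col_of_mono rfl h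
  | succ j => rfl

theorem TyCtx.col_cons_ne (h : A.Mono χ d) (hcd : d ≠ c) :
    (TyCtx.cons A Γ).col χ c 0 = none ∧ (TyCtx.cons A Γ).col χ c ∘ Nat.succ = Γ.col χ c :=
  ⟨TyCtx.col_eq_none rfl (h.not hcd), rfl⟩

theorem TyCtx.AllMono.left (h : Θ.AllMono χ) (hj : Γ.Join Δ Θ) : Γ.AllMono χ := fun x T hx =>
  h x T (by have := hj x; grind)

theorem TyCtx.AllMono.cons (h : Γ.AllMono χ) (hA : A.Mono χ d) : (TyCtx.cons A Γ).AllMono χ := by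
  rintro (_ | x) T hx
  · cases hx; exact ⟨d, hA⟩
  · exact h x T hx

/-- A term with a monochromatic context of colours `true`, `false` of a tensor of these colours is a
pair. -/
theorem CF.split_tensor {s : Term} {T A₁ A₂ : Ty} (h : CF Θ s T) (e : T = .tensor A₁ A₂)
    (h₁ : A₁.Mono χ true) (h₂ : A₂.Mono χ false) (hΘ : Θ.AllMono χ) :
    ∃ s₁ s₂, BC s (.pair s₁ s₂) ∧ HasType (Θ.col χ true) s₁ A₁ ∧
      HasType (Θ.col χ false) s₂ A₂ := by
  induction h with
  | ax i A =>
    subst e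
    obtain ⟨d, hd⟩ := hΘ i _ (by simp [TyCtx.single]; rfl)
    cases (h₁.unique hd.1).trans (hd.2.unique h₂)
  | lam => cases e
  | @pair Γ Δ Θ s t A B hj hs ht _ _ =>
    cases e
    have hΓ := fun x T => hs.mono (x := x) (T := T) h₁ (hΘ.left hj)
    have hΔ := fun x T => ht.mono (x := x) (T := T) h₂ (hΘ.left hj.comm)
    refine ⟨s, t, .refl _, ?_, ?_⟩
    · convert hs.hasType using 1
      funext i
      obtain ⟨h₁, h₂⟩ | ⟨h₁, h₂⟩ := hj i
      · rw [← TyCtx.col_congr h₁, TyCtx.col_eq_self hΓ]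
      · rw [← TyCtx.col_congr h₂, h₁, TyCtx.col_eq_none_of_ne hΔ (by simp)]
    · convert ht.hasType using 1
      funext i
      obtain ⟨h₁, h₂⟩ | ⟨h₁, h₂⟩ := hj i
      · rw [← TyCtx.col_congr h₁, h₂, TyCtx.col_eq_none_of_ne hΓ (by simp)]
      · rw [← TyCtx.col_congr h₂, TyCtx.col_eq_self hΔ]
  | @lett Δ z t A B C hz ht ih =>
    obtain ⟨d, hd⟩ := hΘ z _ (Function.update_self ..)
    have hΔ : Δ.AllMono χ := fun x T hx => hΘ x T (by
      rw [Function.update_of_ne]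
      · exact hx
      · intro e; rw [e, hz] at hx; cases hx)
    obtain ⟨s₁, s₂, h₃, h₄, h₅⟩ := ih e ((hΔ.cons hd.2).cons hd.1)
    have e₁ : ∀ {c}, c = d → Function.update (Δ.col χ c) z (some (.tensor A B)) =
        TyCtx.col χ c (Function.update Δ z (some (.tensor A B))) := by
      rintro _ rfl
      funext i
      by_cases hi : i = z
      · subst hi; rw [Function.update_self, TyCtx.col_of_mono (Function.update_self ..) hd]
      · rw [Function.update_of_ne hi, TyCtx.col_congr]; rw [Function.update_of_ne hi]
    have e₂ : ∀ {c}, d ≠ c → Δ.col χ c =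
        TyCtx.col χ c (Function.update Δ z (some (.tensor A B))) := by
      intro c hc
      funext i
      by_cases hi : i = z
      · subst hi
        rw [TyCtx.col_of_none hz, TyCtx.col_eq_none (Function.update_self ..) (hd.not hc)]
      · rw [TyCtx.col_congr]; rw [Function.update_of_ne hi]
    cases d with
    | true =>
      rw [TyCtx.col_cons hd.1, TyCtx.col_cons hd.2] at h₄
      -- The component of the other colour cannot use the two variables of the `let`, so the `let`
      -- moves into the component of its own colour.
      obtain ⟨s₃, rfl, h₆⟩ := h₅.exists_rename_succ (TyCtx.col_cons_ne hd.1 (by simp)).1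
      rw [(TyCtx.col_cons_ne hd.1 (by simp)).2] at h₆
      obtain ⟨s₄, rfl, h₇⟩ := h₆.exists_rename_succ (TyCtx.col_cons_ne hd.2 (by simp)).1
      rw [(TyCtx.col_cons_ne hd.2 (by simp)).2] at h₇
      refine ⟨.lett (.var z) s₁, s₄, (BC.lett (.refl _) h₃).trans ?_, ?_, ?_⟩
      · rw [Term.rename_rename]; exact (BC.comm_pairL _ _ _).symm
      · rw [← e₁ rfl]; exact .lett_var (TyCtx.col_of_none hz) h₄
      · rw [← e₂ (by simp)]; exact h₇
    | false =>
      rw [TyCtx.col_cons hd.1, TyCtx.col_cons hd.2] at h₅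
      obtain ⟨s₃, rfl, h₆⟩ := h₄.exists_rename_succ (TyCtx.col_cons_ne hd.1 (by simp)).1
      rw [(TyCtx.col_cons_ne hd.1 (by simp)).2] at h₆
      obtain ⟨s₄, rfl, h₇⟩ := h₆.exists_rename_succ (TyCtx.col_cons_ne hd.2 (by simp)).1
      rw [(TyCtx.col_cons_ne hd.2 (by simp)).2] at h₇
      refine ⟨s₄, .lett (.var z) s₂, (BC.lett (.refl _) h₃).trans ?_, ?_, ?_⟩
      · rw [Term.rename_rename]; exact (BC.comm_pairR _ _ _).symm
      · rw [← e₂ (by simp)]; exact h₇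
      · rw [← e₁ rfl]; exact .lett_var (TyCtx.col_of_none hz) h₅
  | @arr Γ Δ Θ f u t A B C hf hj hu ht _ ih =>
    have hΘf : Θ f = some (.arr A B) ∧ Γ f = none := by have := hj f; simp at this; grind
    obtain ⟨d, hd⟩ := hΘ f _ hΘf.1
    have hΔ : Δ.AllMono χ := by
      intro x T hx
      by_cases hxf : x = f
      · subst hxf; rw [hf] at hx; cases hx; exact ⟨d, hd.2⟩
      · have := hj x; rw [Function.update_of_ne hxf] at this
        exact hΘ x T (by grind)
    obtain ⟨s₁, s₂, h₃, h₄, h₅⟩ := ih e hΔ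
    have hΓ := fun x T => hu.mono (x := x) (T := T) hd.1 (hΘ.left hj)
    have e₁ : ∀ {c}, c = d →
        Γ.Join (Function.update (Δ.col χ c) f (some (.arr A B))) (Θ.col χ c) := by
      rintro _ rfl i
      by_cases hi : i = f
      · subst hi; right
        rw [Function.update_self, TyCtx.col_of_mono hΘf.1 hd]; exact ⟨hΘf.2, rfl⟩
      · have := hj i
        rw [Function.update_of_ne hi] at this ⊢
        obtain ⟨h₁, h₂⟩ | ⟨h₁, h₂⟩ := this
        · left; rw [← TyCtx.col_congr h₁, TyCtx.col_eq_self hΓ]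
          exact ⟨rfl, TyCtx.col_of_none h₂⟩
        · right; exact ⟨h₁, TyCtx.col_congr h₂⟩
    have e₂ : ∀ {c}, d ≠ c → Δ.col χ c = Θ.col χ c := by
      intro c hc; funext i
      by_cases hi : i = f
      · subst hi
        rw [TyCtx.col_eq_none hf (hd.2.not hc), TyCtx.col_eq_none hΘf.1 (hd.not hc)]
      · have := hj i
        rw [Function.update_of_ne hi] at this
        obtain ⟨h₁, h₂⟩ | ⟨h₁, h₂⟩ := this
        · rw [TyCtx.col_of_none h₂, ← TyCtx.col_congr h₁, TyCtx.col_eq_none_of_ne hΓ hc]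
        · exact TyCtx.col_congr h₂
    -- The component of the other colour does not contain `f`, so the substitution for `f` changes
    -- only one component.
    have h₆ : ∀ {c T} {s : Term}, d ≠ c → HasType (Δ.col χ c) s T → s.occ f = 0 :=
      fun hc hs => hs.occ_eq_zero (TyCtx.col_eq_none hf (hd.2.not hc))
    have h₇ := h₃.subst (repl f (.app (.var f) u))
    cases d with
    | true =>
      refine ⟨_, s₂, ?_, .subst_app (TyCtx.col_of_mono hf hd.2) (e₁ rfl) hu.hasType h₄,
        (e₂ (c := false) (by simp)) ▸ h₅⟩
      rwa [Term.subst, Term.subst_repl_of_occ_eq_zero (h₆ (by simp) h₅)] at h₇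
    | false =>
      refine ⟨s₁, _, ?_, (e₂ (c := true) (by simp)) ▸ h₄,
        .subst_app (TyCtx.col_of_mono hf hd.2) (e₁ rfl) hu.hasType h₅⟩
      rwa [Term.subst, Term.subst_repl_of_occ_eq_zero (h₆ (by simp) h₄)] at h₇

end

/-! ### Splitting at a function from one colour to the other -/

section
variable {χ : ℕ → Bool} {c d : Bool} {Γ Δ Θ : TyCtx} {A B C : Ty} {i f : ℕ}

theorem TyCtx.update_cons (A : Ty) (Γ : TyCtx) (i : ℕ) (X : Option Ty) :
    Function.update (TyCtx.cons A Γ) (i + 1) X = TyCtx.cons A (Function.update Γ i X) := by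
  funext j
  cases j with
  | zero => rw [Function.update_of_ne (by simp)]; rfl
  | succ j =>
    by_cases h : j = i
    · subst h; simp [TyCtx.cons]
    · rw [Function.update_of_ne (by omega)]; simp [TyCtx.cons, h]

theorem TyCtx.update_comp_succ (Γ : TyCtx) (i : ℕ) (X : Option Ty) :
    Function.update Γ (i + 1) X ∘ Nat.succ = Function.update (Γ ∘ Nat.succ) i X := by
  funext j
  by_cases h : j = i
  · subst h; simp
  · simp [h]

theorem Ty.not_mono_arr (hB : B.Mono χ true) (hC : C.Mono χ false) : ¬ (Ty.arr B C).Mono χ c :=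
  fun h => by cases (hB.unique h.1).trans (h.2.unique hC)

/-- A term with a monochromatic context apart from a function `f` from colour `true` to colour
`false`, of a type of colour `false`, uses `f` for an argument from the types of colour `true`. -/
theorem CF.split_arr {s : Term} (h : CF Θ s A) (hf : Θ f = some (.arr B C))
    (hB : B.Mono χ true) (hC : C.Mono χ false) (hA : A.Mono χ false)
    (hΘ : ∀ x T, x ≠ f → Θ x = some T → ∃ d, T.Mono χ d) :
    ∃ u t, BC s (t.subst (repl f (.app (.var f) u))) ∧ HasType (Θ.col χ true) u B ∧
      HasType (Function.update (Θ.col χ false) f (some C)) t A := by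
  induction h generalizing f with
  | ax i A =>
    simp only [TyCtx.single] at hf; split_ifs at hf; cases hf
    exact absurd hA (Ty.not_mono_arr hB hC)
  | @lam Γ t A A' h ih =>
    obtain ⟨u, t, h₁, h₂, h₃⟩ := ih (f := f + 1) hf hA.2 (fun x T hx hT => by
      cases x with
      | zero => cases hT; exact ⟨_, hA.1⟩
      | succ x => exact hΘ x T (by omega) hT)
    obtain ⟨u, rfl, h₄⟩ := h₂.exists_rename_succ (TyCtx.col_cons_ne hA.1 (by simp)).1
    rw [(TyCtx.col_cons_ne hA.1 (by simp)).2] at h₄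
    rw [TyCtx.col_cons hA.1, TyCtx.update_cons] at h₃
    refine ⟨u, .lam t, ?_, h₄, .lam h₃⟩
    rw [Term.subst, ups_repl]; exact .lam h₁
  | @pair Γ Δ Θ s t A A' hj hs ht ihs iht =>
    -- The premise without `f` has colour `false` throughout, by `CF.mono`, and contributes nothing
    -- to the part of colour `true`.
    have key : ∀ {Γ Δ : TyCtx} {t A'}, Γ.Join Δ Θ → Γ f = some (.arr B C) → CF Δ t A' →
        A'.Mono χ false → Δ f = none ∧ t.occ f = 0 ∧ Γ.col χ true = Θ.col χ true ∧
        TyCtx.Join (Function.update (Γ.col χ false) f (some C)) Δ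
          (Function.update (Θ.col χ false) f (some C)) := by
      intro Γ Δ t A' hj hΓ ht hA'
      have hn : Δ f = none := by have := hj f; grind
      have hΔ := fun x T => ht.mono (x := x) (T := T) hA' fun x T hx =>
        hΘ x T (by rintro rfl; rw [hn] at hx; cases hx) (by have := hj x; grind)
      refine ⟨hn, ht.hasType.occ_eq_zero hn, funext fun i => ?_, fun i => ?_⟩
      · obtain ⟨h₁, h₂⟩ | ⟨h₁, h₂⟩ := hj i
        · exact TyCtx.col_congr h₁
        · rw [TyCtx.col_of_none h₁, ← TyCtx.col_congr h₂, TyCtx.col_eq_none_of_ne hΔ (by simp)]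
      · by_cases hi : i = f
        · subst hi; simp [hn]
        · rw [Function.update_of_ne hi, Function.update_of_ne hi]
          obtain ⟨h₁, h₂⟩ | ⟨h₁, h₂⟩ := hj i
          · exact .inl ⟨TyCtx.col_congr h₁, h₂⟩
          · exact .inr ⟨TyCtx.col_of_none h₁, by rw [← TyCtx.col_congr h₂, TyCtx.col_eq_self hΔ]⟩
    have hfj : Γ f = some (.arr B C) ∨ Δ f = some (.arr B C) := by have := hj f; grind
    rcases hfj with hΓ | hΔ
    · obtain ⟨hn, ho, h₁, h₂⟩ := key hj hΓ ht hA.2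
      obtain ⟨u, s', h₃, h₄, h₅⟩ := ihs hΓ hA.1 fun x T hx hT => hΘ x T hx (by have := hj x; grind)
      refine ⟨u, .pair s' t, ?_, h₁ ▸ h₄, .pair h₂ h₅ ht.hasType⟩
      rw [Term.subst, Term.subst_repl_of_occ_eq_zero ho]; exact .pair h₃ (.refl _)
    · obtain ⟨hn, ho, h₁, h₂⟩ := key hj.comm hΔ hs hA.1
      obtain ⟨u, t', h₃, h₄, h₅⟩ := iht hΔ hA.2 fun x T hx hT => hΘ x T hx (by have := hj x; grind)
      refine ⟨u, .pair s t', ?_, h₁ ▸ h₄, .pair h₂.comm hs.hasType h₅⟩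
      rw [Term.subst, Term.subst_repl_of_occ_eq_zero ho]; exact .pair (.refl _) h₃
  | @lett Δ z t A₁ A₂ A hz ht ih =>
    have hfz : f ≠ z := by rintro rfl; simp at hf
    rw [Function.update_of_ne hfz] at hf
    obtain ⟨d, hd⟩ := hΘ z _ hfz.symm (Function.update_self ..)
    obtain ⟨u, t', h₁, h₂, h₃⟩ := ih (f := f + 2) hf hA (fun x T hx hT => by
      match x with
      | 0 => cases hT; exact ⟨d, hd.1⟩
      | 1 => cases hT; exact ⟨d, hd.2⟩
      | x + 2 =>
        refine hΘ x T (by omega) ?_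
        rw [Function.update_of_ne]
        · exact hT
        · intro e; replace hT : Δ x = some T := hT; rw [e, hz] at hT; cases hT)
    have e₁ : ∀ {c}, c = d → Function.update (Δ.col χ c) z (some (.tensor A₁ A₂)) =
        TyCtx.col χ c (Function.update Δ z (some (.tensor A₁ A₂))) := by
      rintro _ rfl
      funext i
      by_cases hi : i = z
      · subst hi; rw [Function.update_self, TyCtx.col_of_mono (Function.update_self ..) hd]
      · rw [Function.update_of_ne hi, TyCtx.col_congr]; rw [Function.update_of_ne hi]
    have e₂ : ∀ {c}, d ≠ c → Δ.col χ c =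
        TyCtx.col χ c (Function.update Δ z (some (.tensor A₁ A₂))) := by
      intro c hc
      funext i
      by_cases hi : i = z
      · subst hi
        rw [TyCtx.col_of_none hz, TyCtx.col_eq_none (Function.update_self ..) (hd.not hc)]
      · rw [TyCtx.col_congr]; rw [Function.update_of_ne hi]
    cases d with
    | true =>
      rw [TyCtx.col_cons hd.1, TyCtx.col_cons hd.2] at h₂
      obtain ⟨t₁, rfl, h₄⟩ := h₃.exists_rename_succ (by
        rw [Function.update_of_ne (by omega)]; exact (TyCtx.col_cons_ne hd.1 (by simp)).1)
      rw [TyCtx.update_comp_succ, (TyCtx.col_cons_ne hd.1 (by simp)).2] at h₄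
      obtain ⟨t₂, rfl, h₅⟩ := h₄.exists_rename_succ (by
        rw [Function.update_of_ne (by omega)]; exact (TyCtx.col_cons_ne hd.2 (by simp)).1)
      rw [TyCtx.update_comp_succ, (TyCtx.col_cons_ne hd.2 (by simp)).2] at h₅
      refine ⟨.lett (.var z) u, t₂, (BC.lett (.refl _) h₁).trans ?_, ?_, ?_⟩
      -- A `let` of colour `true` is not used around `f u`: it is commuted inwards to the place of
      -- `f u`, and from there into the argument.
      · rw [Term.rename_rename]
        refine (BC.comm_repl (h₅.occ_eq_one (Function.update_self ..)) _ _).symm.trans ?_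
        exact BC.subst_repl (.refl _) _ (BC.comm_appR (.var z) u (.var f)).symm
      · rw [← e₁ rfl]; exact .lett_var (TyCtx.col_of_none hz) h₂
      · rw [← e₂ (by simp)]; exact h₅
    | false =>
      obtain ⟨u₁, rfl, h₄⟩ := h₂.exists_rename_succ (TyCtx.col_cons_ne hd.1 (by simp)).1
      rw [(TyCtx.col_cons_ne hd.1 (by simp)).2] at h₄
      obtain ⟨u₂, rfl, h₅⟩ := h₄.exists_rename_succ (TyCtx.col_cons_ne hd.2 (by simp)).1
      rw [(TyCtx.col_cons_ne hd.2 (by simp)).2] at h₅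
      rw [TyCtx.col_cons hd.1, TyCtx.col_cons hd.2, TyCtx.update_cons, TyCtx.update_cons] at h₃
      refine ⟨u₂, .lett (.var z) t', ?_, ?_, ?_⟩
      · rw [Term.subst, ups_repl, ups_repl, Term.subst, repl, Function.update_of_ne hfz.symm]
        exact BC.lett (.refl _) h₁
      · rw [← e₂ (by simp)]; exact h₅
      · rw [← e₁ rfl, Function.update_comm hfz.symm]
        exact .lett_var (by rw [Function.update_of_ne hfz.symm]; exact TyCtx.col_of_none hz) h₃
  | @arr Γ Δ Θ g v w B' C' A hg hj hv hw ihv ihw =>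
    have hΘg : Θ g = some (.arr B' C') ∧ Γ g = none := by have := hj g; simp at this; grind
    have hjn : ∀ i, i ≠ g → (Γ i = Θ i ∧ Δ i = none) ∨ (Γ i = none ∧ Δ i = Θ i) := by
      intro i hi; have := hj i; rwa [Function.update_of_ne hi] at this
    by_cases hgf : f = g
    · subst hgf
      rw [hΘg.1] at hf; cases hf
      have hΓ := fun x T => hv.mono (x := x) (T := T) hB fun x T hx =>
        hΘ x T (by rintro rfl; rw [hΘg.2] at hx; cases hx) (by have := hj x; grind)
      have hΔ := fun x T => hw.mono (x := x) (T := T) hA fun x T hx => by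
        by_cases hxf : x = f
        · subst hxf; rw [hg] at hx; cases hx; exact ⟨_, hC⟩
        · exact hΘ x T hxf (by have := hjn x hxf; grind)
      refine ⟨v, w, .refl _, ?_, ?_⟩
      · convert hv.hasType using 1
        funext i
        by_cases hi : i = f
        · subst hi; rw [hΘg.2, TyCtx.col_eq_none hΘg.1 (Ty.not_mono_arr hB hC)]
        · obtain ⟨h₁, h₂⟩ | ⟨h₁, h₂⟩ := hjn i hi
          · rw [← TyCtx.col_congr h₁, TyCtx.col_eq_self hΓ]
          · rw [← TyCtx.col_congr h₂, h₁, TyCtx.col_eq_none_of_ne hΔ (by simp)]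
      · convert hw.hasType using 1
        funext i
        by_cases hi : i = f
        · subst hi; rw [Function.update_self, hg]
        · rw [Function.update_of_ne hi]
          obtain ⟨h₁, h₂⟩ | ⟨h₁, h₂⟩ := hjn i hi
          · rw [← TyCtx.col_congr h₁, h₂, TyCtx.col_eq_none_of_ne hΓ (by simp)]
          · rw [← TyCtx.col_congr h₂, TyCtx.col_eq_self hΔ]
    obtain ⟨d, hd⟩ := hΘ g _ (Ne.symm hgf) hΘg.1
    have hΔg : ∀ x T, x ≠ f → Δ x = some T → ∃ d, T.Mono χ d := by
      intro x T hxf hx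
      by_cases hxg : x = g
      · subst hxg; rw [hg] at hx; cases hx; exact ⟨_, hd.2⟩
      · exact hΘ x T hxf (by have := hjn x hxg; grind)
    have hΓg : ∀ x T, x ≠ f → Γ x = some T → ∃ d, T.Mono χ d := by
      intro x T hxf hx
      exact hΘ x T hxf (by have := hj x; grind)
    obtain ⟨hΓf, hΔf⟩ | ⟨hΓf, hΔf⟩ := hjn f hgf
    · rw [hf] at hΓf
      have hΔ := fun x T => hw.mono (x := x) (T := T) hA fun x T hx =>
        hΔg x T (by rintro rfl; rw [hΔf] at hx; cases hx) hx
      -- Since `f` is used in the argument `v` of `g`, the body `w` has only colour `false`, which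
      -- forces the colour of `g`. The part of `v` around `f u` becomes the new argument of `g`.
      cases hd.2.unique (hΔ g _ hg)
      obtain ⟨u, t, h₁, h₂, h₃⟩ := ihv hΓf hd.1 hΓg
      refine ⟨u, w.subst (repl g (.app (.var g) t)), ?_, ?_, .subst_app hg ?_ h₃ hw.hasType⟩
      · refine (BC.subst_repl (.refl _) g (.app (.refl _) h₁)).trans ?_
        rw [Term.subst_subst, Term.subst_congr (σ := repl g _)]; · exact .refl _
        intro k hk
        have hkf : k ≠ f := by rintro rfl; exact hk (hw.hasType.occ_eq_zero hΔf)
        by_cases hkg : k = g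
        · subst hkg; simp [Term.subst, hkf]
        · simp [Term.subst, hkf, hkg]
      · convert h₂ using 1
        funext i
        by_cases hi : i = g
        · subst hi; rw [TyCtx.col_of_none hΘg.2, TyCtx.col_eq_none hΘg.1 (hd.not (by simp))]
        · obtain ⟨h₃, h₄⟩ | ⟨h₃, h₄⟩ := hjn i hi
          · exact (TyCtx.col_congr h₃).symm
          · rw [TyCtx.col_of_none h₃, ← TyCtx.col_congr h₄, TyCtx.col_eq_none_of_ne hΔ (by simp)]
      · intro i
        by_cases hi : i = f
        · subst hi; simp [hgf, hΔf]
        by_cases hig : i = g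
        · subst hig; right
          simp only [Function.update_self, Function.update_of_ne hi]
          exact ⟨TyCtx.col_of_none hΘg.2, (TyCtx.col_of_mono hΘg.1 hd).symm⟩
        rw [Function.update_of_ne hi, Function.update_of_ne hi, Function.update_of_ne hig]
        obtain ⟨h₃, h₄⟩ | ⟨h₃, h₄⟩ := hjn i hig
        · exact .inl ⟨TyCtx.col_congr h₃, h₄⟩
        · exact .inr ⟨TyCtx.col_of_none h₃, by rw [← TyCtx.col_congr h₄, TyCtx.col_eq_self hΔ]⟩
    · rw [hf] at hΔf
      have hΓ := fun x T => hv.mono (x := x) (T := T) hd.1 fun x T hx =>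
        hΓg x T (by rintro rfl; rw [hΓf] at hx; cases hx) hx
      obtain ⟨u, t, h₁, h₂, h₃⟩ := ihw hΔf hA hΔg
      have h₄ := h₁.subst (repl g (.app (.var g) v))
      have e₁ : ∀ {c}, d = c → TyCtx.Join Γ
          (Function.update (Δ.col χ c) g (some (.arr B' C'))) (Θ.col χ c) := by
        rintro _ rfl i
        by_cases hi : i = g
        · subst hi; right
          rw [Function.update_self, TyCtx.col_of_mono hΘg.1 hd]; exact ⟨hΘg.2, rfl⟩
        · rw [Function.update_of_ne hi]
          obtain ⟨h₁, h₂⟩ | ⟨h₁, h₂⟩ := hjn i hi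
          · left; rw [← TyCtx.col_congr h₁, TyCtx.col_eq_self hΓ]
            exact ⟨rfl, TyCtx.col_of_none h₂⟩
          · right; exact ⟨h₁, TyCtx.col_congr h₂⟩
      have e₂ : ∀ {c}, d ≠ c → Δ.col χ c = Θ.col χ c := by
        intro c hc; funext i
        by_cases hi : i = g
        · subst hi
          rw [TyCtx.col_eq_none hg (hd.2.not hc), TyCtx.col_eq_none hΘg.1 (hd.not hc)]
        · obtain ⟨h₁, h₂⟩ | ⟨h₁, h₂⟩ := hjn i hi
          · rw [TyCtx.col_of_none h₂, ← TyCtx.col_congr h₁, TyCtx.col_eq_none_of_ne hΓ hc]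
          · exact TyCtx.col_congr h₂
      -- Here `f` occurs in `w`: the application of `g` belongs to the argument of `f` or to the
      -- part around it, according to the colour of `g`.
      cases d with
      | true =>
        have ho : t.occ g = 0 := h₃.occ_eq_zero (by
          rw [Function.update_of_ne (Ne.symm hgf), TyCtx.col_eq_none hg (hd.2.not (by simp))])
        refine ⟨u.subst (repl g (.app (.var g) v)), t, h₄.trans ?_,
          .subst_app (TyCtx.col_of_mono hg hd.2) (e₁ rfl) hv.hasType h₂,
          (e₂ (c := false) (by simp)) ▸ h₃⟩
        rw [Term.subst_subst, Term.subst_congr (τ := repl f _)]; · exact .refl _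
        intro k hk
        have hkg : k ≠ g := by rintro rfl; exact hk ho
        by_cases hkf : k = f
        · subst hkf; simp [Term.subst, hkg]
        · simp [Term.subst, hkf, hkg]
      | false =>
        have ho : u.occ g = 0 := h₂.occ_eq_zero (TyCtx.col_eq_none hg (hd.2.not (by simp)))
        have ho' : v.occ f = 0 := hv.hasType.occ_eq_zero hΓf
        refine ⟨u, t.subst (repl g (.app (.var g) v)), h₄.trans ?_,
          (e₂ (c := true) (by simp)) ▸ h₂, ?_⟩
        · rw [Term.subst_subst, Term.subst_subst]
          convert BC.refl _ using 2
          funext k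
          by_cases hkf : k = f
          · subst hkf; simp [Term.subst, hgf, Term.subst_repl_of_occ_eq_zero ho]
          by_cases hkg : k = g
          · subst hkg; simp [Term.subst, hkf, Term.subst_repl_of_occ_eq_zero ho']
          · simp [Term.subst, hkf, hkg]
        · refine .subst_app (B := C') (A := B') ?_ ?_ hv.hasType h₃
          · rw [Function.update_of_ne (Ne.symm hgf)]; exact TyCtx.col_of_mono hg hd.2
          · rw [Function.update_comm hgf]
            intro i
            by_cases hi : i = f
            · subst hi; simp [hΓf]
            · rw [Function.update_of_ne hi, Function.update_of_ne hi]; exact e₁ rfl i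

end

/-! ## Sums over the types of a context -/

/-- The sum of `φ` over the types of the first `N` variables of a context. -/
def TyCtx.sum (φ : Ty → ℕ) (N : ℕ) (Γ : TyCtx) : ℕ :=
  ∑ i ∈ Finset.range N, (Γ i).elim 0 φ

section
variable {φ : Ty → ℕ} {N : ℕ} {Γ Δ Θ : TyCtx}

theorem TyCtx.sum_cons (A : Ty) : (TyCtx.cons A Γ).sum φ (N + 1) = φ A + Γ.sum φ N := by
  rw [TyCtx.sum, Finset.sum_range_succ', add_comm]; rfl

theorem TyCtx.Join.sum (h : Γ.Join Δ Θ) : Θ.sum φ N = Γ.sum φ N + Δ.sum φ N := by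
  rw [TyCtx.sum, TyCtx.sum, TyCtx.sum, ← Finset.sum_add_distrib]
  refine Finset.sum_congr rfl fun i _ => ?_
  obtain ⟨h₁, h₂⟩ | ⟨h₁, h₂⟩ := h i <;> simp [h₁, h₂]

theorem TyCtx.sum_update {z : ℕ} (hz : z < N) (T : Ty) :
    TyCtx.sum φ N (Function.update Γ z (some T)) =
      φ T + TyCtx.sum φ N (Function.update Γ z none) := by
  simp only [TyCtx.sum]
  rw [← Finset.add_sum_erase _ _ (Finset.mem_range.2 hz), ← Finset.add_sum_erase _
    (fun i => (Function.update Γ z none i).elim 0 φ) (Finset.mem_range.2 hz)]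
  simp only [Function.update_self, Option.elim_some, Option.elim_none, zero_add]
  congr 1
  refine Finset.sum_congr rfl fun i hi => ?_
  rw [Function.update_of_ne (Finset.ne_of_mem_erase hi),
    Function.update_of_ne (Finset.ne_of_mem_erase hi)]

theorem TyCtx.le_sum {x : ℕ} {T : Ty} (hx : Γ x = some T) (hN : x < N) : φ T ≤ Γ.sum φ N := by
  rw [TyCtx.sum, ← Finset.add_sum_erase _ _ (Finset.mem_range.2 hN), hx]
  exact Nat.le_add_right _ _

end

/-! ### Sequents with distinct negative atoms -/

def Ty.size : Ty → ℕ
  | .var _ => 1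
  | .tensor A B => A.size + B.size + 1
  | .arr A B => A.size + B.size + 1

/-- All variables of the context are less than `N`. -/
def TyCtx.Bound (N : ℕ) (Γ : TyCtx) : Prop := ∀ i, N ≤ i → Γ i = none

/-- The negative positions of the sequent `Γ ⊢ A` have distinct variables. -/
def DistNeg (N : ℕ) (Γ : TyCtx) (A : Ty) : Prop :=
  ∀ v, (A.atoms false).count v + Γ.sum (fun T => (T.atoms true).count v) N ≤ 1

theorem SeqAtom.one_le {N : ℕ} {Γ : TyCtx} {A : Ty} {v : ℕ} (h : SeqAtom false Γ A v)
    (hN : Γ.Bound N) : 1 ≤ (A.atoms false).count v + Γ.sum (fun T => (T.atoms true).count v) N := by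
  obtain h | ⟨x, T, hx, hv⟩ := h
  · have := List.one_le_count_iff.2 h; omega
  · have h₁ := List.one_le_count_iff.2 hv
    have := TyCtx.le_sum (φ := fun T => (T.atoms true).count v) (N := N) hx (by
      by_contra h; rw [hN x (by omega)] at hx; cases hx)
    rw [Bool.not_false] at h₁
    omega

/-- Colouring the negative atoms suffices, since by `CF.seqAtom` every positive atom is also a
negative one. -/
theorem CF.mono_of_seqAtom {χ : ℕ → Bool} {c : Bool} {Γ : TyCtx} {t : Term} {A : Ty} (h : CF Γ t A)
    (hχ : ∀ v, SeqAtom false Γ A v → χ v = c) :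
    A.Mono χ c ∧ ∀ x T, Γ x = some T → T.Mono χ c := by
  have h' : ∀ v, SeqAtom true Γ A v → χ v = c := fun v hv => hχ v (h.seqAtom hv)
  refine ⟨(Ty.mono_iff true).2 ⟨fun v hv => h' v (.inl hv), fun v hv => hχ v (.inl hv)⟩,
    fun x T hx => (Ty.mono_iff true).2 ⟨fun v hv => hχ v (.inr ⟨x, T, hx, hv⟩),
      fun v hv => h' v (.inr ⟨x, T, hx, hv⟩)⟩⟩

/-! ## Compatibility of the equality with substitution -/

/-- Substitution is not among the congruence rules of `TermEq`; both sides are β-expanded to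
applications, where those rules apply. -/
theorem TermEq.inst {Γ Δ Θ : TyCtx} {e e' t t' : Term} {A B : Ty} (hj : Γ.Join Δ Θ)
    (he : TermEq Γ e e' B) (ht : TermEq (TyCtx.cons B Δ) t t' A) (he₁ : HasType Γ e B)
    (he₂ : HasType Γ e' B) (ht₁ : HasType (TyCtx.cons B Δ) t A)
    (ht₂ : HasType (TyCtx.cons B Δ) t' A) : TermEq Θ (t.inst e) (t'.inst e') A :=
  ((BC.beta1 (ht₁.occ_eq_one (k := 0) rfl) e).termEq (.app hj.comm (.lam ht₁) he₁)).symm.trans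
    ((TermEq.app hj.comm (.lam ht) he).trans
      ((BC.beta1 (ht₂.occ_eq_one (k := 0) rfl) e').termEq (.app hj.comm (.lam ht₂) he₂)))

theorem hasType_toFront {Δ : TyCtx} {f : ℕ} {B C : Ty} {t : Term} (hf : Δ f = some B)
    (ht : HasType Δ t C) :
    HasType (TyCtx.cons B (Function.update Δ f none)) (t.rename (toFront f)) C := by
  rw [hasType_rename (toFront_injective f)]
  refine ⟨fun i hi => ?_, ?_⟩
  · cases i with
    | zero => exact absurd (by simp [toFront]) (hi f)
    | succ i =>
      by_cases hik : i = f
      · simp [hik, TyCtx.cons]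
      · exact absurd (by simp [toFront, hik]) (hi i)
  · convert ht using 1
    funext i
    by_cases hi : i = f
    · subst hi; simp [toFront, TyCtx.cons, hf]
    · simp [toFront, TyCtx.cons, hi]

theorem TyCtx.join_single_update {Γ : TyCtx} {z : ℕ} {T : Ty} (hz : Γ z = some T) :
    (TyCtx.single z T).Join (Function.update Γ z none) Γ := by
  intro i
  by_cases hi : i = z
  · subst hi; simp [TyCtx.single, hz]
  · simp [TyCtx.single, hi]

/-- A variable of a tensor type can be decomposed. -/
theorem HasType.tensor_expand {Γ : TyCtx} {s : Term} {z : ℕ} {A B C : Ty} (h : HasType Γ s C)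
    (hz : Γ z = some (.tensor A B)) :
    ∃ s', HasType (TyCtx.cons A (TyCtx.cons B (Function.update Γ z none))) s' C ∧
      TermEq Γ s (.lett (.var z) s') C := by
  have hj := TyCtx.join_single_update hz
  have ht := hasType_toFront hz h
  have he : HasType (TyCtx.single z (.tensor A B)) (.lett (.var z) (.pair (.var 0) (.var 1)))
      (.tensor A B) := by
    refine .lett (Γ := TyCtx.single z (.tensor A B)) (Δ := TyCtx.nil) (TyCtx.join_nil_right _)
      (.var rfl) (.pair (Γ := TyCtx.single 0 A) (Δ := TyCtx.single 1 B) ?_ (.var rfl) (.var rfl))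
    rintro (_ | _ | i) <;> simp [TyCtx.single, TyCtx.cons, TyCtx.nil]
  -- `z` is η-expanded to a `let` that rebuilds the pair; this `let` is then commuted to the root.
  have h₁ := TermEq.inst hj (.symm ((Redex.eta2 (.var z)).termEq he)) (.refl ht) (.var rfl) he ht ht
  have h₂ : HasType Γ _ C := (hasType_inst (ht.occ_eq_one (k := 0) rfl)).2 ⟨_, _, _, hj, he, ht⟩
  rw [← Term.subst_repl] at h₂
  rw [← Term.subst_repl, ← Term.subst_repl, show repl z (.var z) = Term.var from
    Function.update_eq_self _ _, Term.subst_var] at h₁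
  have hc := BC.comm_repl (h.occ_eq_one hz) (.var z) (.pair (.var 0) (.var 1))
  refine ⟨_, ?_, h₁.trans (hc.termEq h₂)⟩
  obtain ⟨Γ₁, Δ, A', B', hj', hv, h₃⟩ := hasType_lett.1 (hc.hasType_iff.1 h₂)
  rw [hasType_var] at hv; subst hv
  have h₄ := hj' z
  simp only [TyCtx.single, hz] at h₄
  simp at h₄
  obtain ⟨⟨rfl, rfl⟩, h₅⟩ := h₄
  convert h₃ using 3
  funext i
  by_cases hi : i = z
  · subst hi; simp [h₅]
  · have := hj' i; simp [TyCtx.single, hi] at this; simp [hi]; grind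

/-- A typing whose negative positions have distinct variables has only one term. -/
theorem HasType.coherence {N : ℕ} {Γ : TyCtx} {s s' : Term} {A : Ty} (hN : Γ.Bound N)
    (hD : DistNeg N Γ A) (h : HasType Γ s A) (h' : HasType Γ s' A) : TermEq Γ s s' A := by
  induction hn : A.size + Γ.sum Ty.size N using Nat.strong_induction_on
    generalizing N Γ s s' A with
  | _ n ih =>
  subst hn
  -- By η, `⊸` on the right and `⊗` on the left are invertible: both terms can be put in the same
  -- form, and the sequent shrinks.
  by_cases hA : ∃ A₁ A₂, A = .arr A₁ A₂
  · obtain ⟨A₁, A₂, rfl⟩ := hA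
    have key : ∀ {s}, HasType Γ s (.arr A₁ A₂) →
        HasType (TyCtx.cons A₁ Γ) (.app (s.rename Nat.succ) (.var 0)) A₂ := by
      intro s h
      refine .app (Γ := fun | 0 => none | n + 1 => Γ n) (Δ := TyCtx.single 0 A₁) ?_
        (hasType_rename_succ.2 ⟨rfl, h⟩) (.var rfl)
      rintro (_ | i) <;> simp [TyCtx.single, TyCtx.cons]
    have e := ih (A₂.size + (TyCtx.cons A₁ Γ).sum Ty.size (N + 1))
      (by rw [TyCtx.sum_cons]; simp only [Ty.size]; omega) (fun i hi => ?_) (fun v => ?_)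
      (key h) (key h') rfl
    · exact .trans (.symm ((Redex.eta1 s).termEq (.lam (key h))))
        (.trans (.lam e) ((Redex.eta1 s').termEq (.lam (key h'))))
    · obtain ⟨i, rfl⟩ := Nat.exists_eq_add_of_lt (Nat.lt_of_lt_of_le N.succ_pos hi)
      exact hN _ (by omega)
    · have := hD v
      simp only [Ty.atoms, List.count_append, Bool.not_false] at this
      rw [TyCtx.sum_cons]; omega
  by_cases hΓ : ∃ z A₁ A₂, Γ z = some (.tensor A₁ A₂)
  · obtain ⟨z, A₁, A₂, hz⟩ := hΓ
    obtain ⟨t, h₁, h₂⟩ := h.tensor_expand hz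
    obtain ⟨t', h₃, h₄⟩ := h'.tensor_expand hz
    have hzN : z < N := by by_contra h; rw [hN z (by omega)] at hz; cases hz
    have hsum : ∀ φ, Γ.sum φ N = φ (.tensor A₁ A₂) +
        TyCtx.sum φ N (Function.update Γ z none) := fun φ => by
      rw [← TyCtx.sum_update hzN, ← hz, Function.update_eq_self]
    refine h₂.trans (.trans (.lett (TyCtx.join_single_update hz) (.refl (.var rfl)) ?_) h₄.symm)
    refine ih _ ?_ (N := N + 2) (fun i hi => ?_) (fun v => ?_) h₁ h₃ rfl
    · rw [TyCtx.sum_cons, TyCtx.sum_cons, hsum]; simp only [Ty.size]; omega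
    · obtain ⟨i, rfl⟩ := Nat.exists_eq_add_of_le' (Nat.le_of_add_left_le hi)
      simp only [TyCtx.cons]
      rw [Function.update_of_ne (by omega)]; exact hN _ (by omega)
    · have := hD v
      rw [hsum] at this
      simp only [Ty.atoms, List.count_append] at this
      rw [TyCtx.sum_cons, TyCtx.sum_cons]; omega
  -- Of the cut-free forms there remain only an axiom at an atom, a pair, and the application of a
  -- context variable.
  push Not at hA hΓ
  obtain ⟨s₀, hs, hss⟩ := h.exists_cf
  obtain ⟨s₀', hs', hss'⟩ := h'.exists_cf
  refine (hss.termEq h).trans (.trans ?_ (hss'.termEq h').symm)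
  clear hss hss' h h'
  cases hs with
  | ax i A =>
    cases A with
    | arr A₁ A₂ => exact absurd rfl (hA A₁ A₂)
    | tensor A₁ A₂ => exact absurd (by simp [TyCtx.single]) (hΓ i A₁ A₂)
    | var v =>
      have := hs'.hasType
      generalize hG : TyCtx.single i (.var v) = Γ at *
      generalize hT : Ty.var v = T at *
      cases hs' with
      | ax j A =>
        have := congrFun hG j
        simp only [TyCtx.single] at this
        split_ifs at this with hij
        subst hij; exact .refl (.var rfl)
      | lam => cases hT
      | pair => cases hT
      | lett => exact absurd (Function.update_self ..) (hΓ _ _ _)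
      | @arr Γ₁ Δ Θ f u t A B C hf hj =>
        have h₁ : TyCtx.single i T f = some (.arr A B) := by
          rw [hG]; have := hj f; simp at this; grind
        simp only [TyCtx.single] at h₁; split_ifs at h₁
        rw [← hT] at h₁; cases h₁
  | lam => exact absurd rfl (hA _ _)
  | lett => exact absurd (Function.update_self ..) (hΓ _ _ _)
  | @pair Γ₁ Γ₂ _ s t A₁ A₂ hj hs ht =>
    classical
    have hN₁ : Γ₁.Bound N := fun i hi => by have := hj i; have := hN i hi; grind
    have hN₂ : Γ₂.Bound N := fun i hi => by have := hj i; have := hN i hi; grind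
    have hD' := hD
    simp only [DistNeg, Ty.atoms, List.count_append, hj.sum] at hD'
    -- Colour `true` marks the atoms of the first premise. An atom common to both premises would be
    -- negative in both, against the count in `hD'`, so the second premise has colour `false`.
    have m₁ := hs.mono_of_seqAtom (χ := fun v => decide (SeqAtom false Γ₁ A₁ v)) (c := true)
      fun v hv => by simpa using hv
    have m₂ := ht.mono_of_seqAtom (χ := fun v => decide (SeqAtom false Γ₁ A₁ v)) (c := false)
      fun v hv => by
        have h₂ := hv.one_le hN₂
        have h₃ := hD' v
        rw [decide_eq_false_iff_not]
        intro h₁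
        have := h₁.one_le hN₁
        omega
    obtain ⟨s', t', h₁, h₂, h₃⟩ := hs'.split_tensor rfl m₁.1 m₂.1 fun x T hx => by
      obtain ⟨h₁, -⟩ | ⟨-, h₁⟩ := hj x
      · exact ⟨_, m₁.2 x T (h₁.trans hx)⟩
      · exact ⟨_, m₂.2 x T (h₁.trans hx)⟩
    refine .trans ?_ (h₁.termEq hs'.hasType).symm
    refine .pair hj (ih _ ?_ hN₁ (fun v => ?_) hs.hasType ?_ rfl)
      (ih _ ?_ hN₂ (fun v => ?_) ht.hasType ?_ rfl)
    · simp only [Ty.size, hj.sum]; omega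
    · have := hD' v; omega
    · convert h₂ using 1
      funext i
      obtain ⟨h₁, h₂⟩ | ⟨h₁, h₂⟩ := hj i
      · rw [← TyCtx.col_congr h₁, TyCtx.col_eq_self m₁.2]
      · rw [← TyCtx.col_congr h₂, h₁, TyCtx.col_eq_none_of_ne m₂.2 (by simp)]
    · simp only [Ty.size, hj.sum]; omega
    · have := hD' v; omega
    · convert h₃ using 1
      funext i
      obtain ⟨h₁, h₂⟩ | ⟨h₁, h₂⟩ := hj i
      · rw [← TyCtx.col_congr h₁, h₂, TyCtx.col_eq_none_of_ne m₁.2 (by simp)]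
      · rw [← TyCtx.col_congr h₂, TyCtx.col_eq_self m₂.2]
  | @arr Γ₁ Δ _ f u t B C _ hf hj hu ht =>
    classical
    have hΓf : Γ f = some (.arr B C) ∧ Γ₁ f = none := by have := hj f; simp at this; grind
    have hfN : f < N := by by_contra h; have := hN f (by omega); grind
    have hN₁ : Γ₁.Bound N := fun i hi => by have := hj i; have := hN i hi; grind
    have hN₂ : Δ.Bound N := fun i hi => by
      have h₁ := hj i; have := hN i hi
      rw [Function.update_of_ne (by omega)] at h₁; grind
    have hjn : ∀ i, i ≠ f → (Γ₁ i = Γ i ∧ Δ i = none) ∨ (Γ₁ i = none ∧ Δ i = Γ i) := by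
      intro i hi; have := hj i; rwa [Function.update_of_ne hi] at this
    have hsum : ∀ φ, Γ.sum φ N = Γ₁.sum φ N + (φ (.arr B C) +
        TyCtx.sum φ N (Function.update Δ f none)) := fun φ => by
      rw [hj.sum, TyCtx.sum_update hfN]
    have hsum' : ∀ φ, Δ.sum φ N = φ C + TyCtx.sum φ N (Function.update Δ f none) := fun φ => by
      rw [← TyCtx.sum_update hfN, ← hf, Function.update_eq_self]
    have hD' := hD
    simp only [DistNeg, hsum, Ty.atoms, List.count_append, Bool.not_true] at hD'
    have m₁ := hu.mono_of_seqAtom (χ := fun v => decide (SeqAtom false Γ₁ B v)) (c := true)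
      fun v hv => by simpa using hv
    have m₂ := ht.mono_of_seqAtom (χ := fun v => decide (SeqAtom false Γ₁ B v)) (c := false)
      fun v hv => by
        have h₂ := hv.one_le hN₂
        have h₃ := hD' v
        rw [hsum'] at h₂
        rw [decide_eq_false_iff_not]
        intro h₁
        have := h₁.one_le hN₁
        omega
    -- With atoms coloured by the argument premise, `f` has the only type of the context with both
    -- colours; the other term must therefore apply `f` as well, to an argument in the same context.
    obtain ⟨u', t', h₁, h₂, h₃⟩ := hs'.split_arr hΓf.1 m₁.1 (m₂.2 f C hf) m₂.1 fun x T hxf hx => by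
      obtain ⟨h₁, -⟩ | ⟨-, h₁⟩ := hjn x hxf
      · exact ⟨_, m₁.2 x T (h₁.trans hx)⟩
      · exact ⟨_, m₂.2 x T (h₁.trans hx)⟩
    have e₁ : Γ.col (fun v => decide (SeqAtom false Γ₁ B v)) true = Γ₁ := by
      funext i
      by_cases hi : i = f
      · subst hi
        rw [hΓf.2, TyCtx.col_eq_none hΓf.1 (Ty.not_mono_arr m₁.1 (m₂.2 i C hf))]
      · obtain ⟨h₁, h₂⟩ | ⟨h₁, h₂⟩ := hjn i hi
        · rw [← TyCtx.col_congr h₁, TyCtx.col_eq_self m₁.2]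
        · rw [← TyCtx.col_congr h₂, h₁, TyCtx.col_eq_none_of_ne m₂.2 (by simp)]
    have e₂ : Function.update (Γ.col (fun v => decide (SeqAtom false Γ₁ B v)) false) f (some C) =
        Δ := by
      funext i
      by_cases hi : i = f
      · subst hi; rw [Function.update_self, hf]
      · rw [Function.update_of_ne hi]
        obtain ⟨h₁, h₂⟩ | ⟨h₁, h₂⟩ := hjn i hi
        · rw [← TyCtx.col_congr h₁, h₂, TyCtx.col_eq_none_of_ne m₁.2 (by simp)]
        · rw [← TyCtx.col_congr h₂, TyCtx.col_eq_self m₂.2]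
    rw [e₁] at h₂
    rw [e₂] at h₃
    refine .trans ?_ (h₁.termEq hs'.hasType).symm
    have h₄ := ih _ (by simp only [hsum, Ty.size]; omega) hN₁
      (fun v => by have := hD' v; omega) hu.hasType h₂ rfl
    -- The variable `f`, now of type `C`, is moved to index `0`, so that both terms are instances
    -- and `TermEq.inst` applies.
    have h₅ := ih (A.size + (TyCtx.cons C (Function.update Δ f none)).sum Ty.size (N + 1))
      (by simp only [TyCtx.sum_cons, hsum, Ty.size]; omega)
      (fun i hi => by
        obtain ⟨i, rfl⟩ := Nat.exists_eq_add_of_lt (Nat.lt_of_lt_of_le N.succ_pos hi)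
        simp only [TyCtx.cons]
        by_cases h : 0 + i = f
        · simp [h]
        · rw [Function.update_of_ne h]; exact hN₂ _ (by omega))
      (fun v => by rw [TyCtx.sum_cons]; have := hD' v; omega)
      (hasType_toFront hf ht.hasType) (hasType_toFront hf h₃) rfl
    have hj₁ : (TyCtx.single f (.arr B C)).Join Γ₁
        (Function.update Γ₁ f (some (.arr B C))) := by
      intro i
      by_cases hi : i = f
      · subst hi; simp [TyCtx.single, hΓf.2]
      · simp [TyCtx.single, hi]
    rw [Term.subst_repl, Term.subst_repl]
    refine .inst (Γ := Function.update Γ₁ f (some (.arr B C))) (fun i => ?_)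
      (.app hj₁ (.refl (.var rfl)) h₄) h₅ (.app hj₁ (.var rfl) hu.hasType)
      (.app hj₁ (.var rfl) h₂) (hasType_toFront hf ht.hasType) (hasType_toFront hf h₃)
    by_cases hi : i = f
    · subst hi; simp [hΓf.1]
    · simp only [Function.update_of_ne hi]; exact hjn i hi

/-! ## Distinct closed terms have typings that differ -/

/-- The type `A` with pairwise distinct variables `(k, v), (k + 1, v'), …` in place of its
variables `v, v', …`. -/
def Ty.label : ℕ → Ty → Ty
  | k, .var v => .var (Nat.pair k v)
  | k, .tensor A B => .tensor (A.label k) (B.label (k + A.size))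
  | k, .arr A B => .arr (A.label k) (B.label (k + A.size))

theorem Ty.ren_label (A : Ty) (k : ℕ) : (A.label k).ren (fun n => n.unpair.2) = A := by
  induction A generalizing k with
  | var v => simp [Ty.label, Ty.subst]
  | tensor A B ih₁ ih₂ | arr A B ih₁ ih₂ =>
    simp only [Ty.ren] at ih₁ ih₂
    simp only [Ty.label, Ty.ren, Ty.subst, ih₁, ih₂]

theorem Ty.mem_atoms_label {A : Ty} {k v : ℕ} {b : Bool} (h : v ∈ (A.label k).atoms b) :
    k ≤ v.unpair.1 ∧ v.unpair.1 < k + A.size := by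
  induction A generalizing k b with
  | var v => cases b <;> simp [Ty.label, Ty.atoms, Ty.size] at *; simp [h]
  | tensor A B ih₁ ih₂ | arr A B ih₁ ih₂ =>
    simp only [Ty.label, Ty.atoms, List.mem_append, Ty.size] at *
    rcases h with h | h
    · have := ih₁ h; omega
    · have := ih₂ h; omega

/-- The two components of a type use disjoint intervals of first coordinates, whatever the polarity.
-/
theorem Ty.count_atoms_label (A : Ty) (k v : ℕ) (b : Bool) :
    ((A.label k).atoms b).count v ≤ 1 := by
  induction A generalizing k b with
  | var v => cases b <;> simp [Ty.label, Ty.atoms]; exact List.count_le_length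
  | tensor A B ih₁ ih₂ | arr A B ih₁ ih₂ =>
    simp only [Ty.label, Ty.atoms, List.count_append]
    have key : ∀ c, ¬ (1 ≤ ((A.label k).atoms c).count v ∧
        1 ≤ ((B.label (k + A.size)).atoms b).count v) := by
      rintro c ⟨h₁, h₂⟩
      have := Ty.mem_atoms_label (List.one_le_count_iff.1 h₁)
      have := Ty.mem_atoms_label (List.one_le_count_iff.1 h₂)
      omega
    have := key b; have := key (!b)
    have := ih₁ k b; have := ih₁ k (!b); have := ih₂ (k + A.size) b
    omega

theorem Ty.Agree.refl (b : Bool) (A : Ty) : A.Agree b A := by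
  induction A generalizing b with
  | var v => exact fun _ => rfl
  | tensor A B ih₁ ih₂ | arr A B ih₁ ih₂ => exact ⟨ih₁ _, ih₂ _⟩

/-- The labels depend on `A` and not on the term, so two terms of type `A` receive the same negative
atoms. The second coordinate of a label remembers the original variable. -/
theorem HasType.exists_label {s : Term} {A : Ty} (h : HasType TyCtx.nil s A) :
    ∃ A', HasType TyCtx.nil s A' ∧ (A.label 0).Agree false A' ∧
      A'.ren (fun n => n.unpair.2) = A := by
  obtain ⟨s', h₁, h₂⟩ := h.exists_cf
  obtain ⟨Γ, A', h₃, h₄, h₅, -, h₆⟩ := h₁.exists_labelling (fun n => n.unpair.2) (fun _ => A)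
    (A.label 0) (by rw [Ty.ren_label]; exact .refl _ _) fun x T hx => by cases hx
  have : Γ = TyCtx.nil := funext fun i => by simpa [TyCtx.nil] using congrFun h₆ i
  exact ⟨A', h₂.hasType_iff.2 (this ▸ h₃), h₄, h₅⟩

/-- If the relabelled types coincided, `HasType.coherence` would equate the terms, and forgetting
the labels would bring the equation back to `A`. -/
theorem HasType.exists_types_ne {s₁ s₂ : Term} {A : Ty} (h₁ : HasType TyCtx.nil s₁ A)
    (h₂ : HasType TyCtx.nil s₂ A) (hne : ¬ TermEq TyCtx.nil s₁ s₂ A) :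
    ∃ A₁ A₂, HasType TyCtx.nil s₁ A₁ ∧ HasType TyCtx.nil s₂ A₂ ∧ A₁.Agree false A₂ ∧ A₁ ≠ A₂ := by
  obtain ⟨A₁, k₁, k₂, k₃⟩ := h₁.exists_label
  obtain ⟨A₂, l₁, l₂, -⟩ := h₂.exists_label
  refine ⟨A₁, A₂, k₁, l₁, k₂.symm.trans l₂, ?_⟩
  rintro rfl
  refine hne ?_
  have := (HasType.coherence (N := 0) (fun _ _ => rfl) (fun v => ?_) k₁ l₁).tySubst
    fun n => .var n.unpair.2
  · rw [← k₃]; exact this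
  · rw [← k₂.atoms_eq]; exact Ty.count_atoms_label A 0 v false

/-! ## Linear booleans -/

theorem BC.beta1_2 {t : Term} (h₁ : t.occ 1 = 1) (h₀ : t.occ 0 = 1) (a b : Term) :
    BC (.app (.app (.lam (.lam t)) a) b) (t.subst (scons b (scons a .var))) := by
  refine (BC.app (.beta1 (by simpa [Term.occ] using h₁) a) (.refl b)).trans ?_
  rw [← Term.subst_ups_inst]
  exact .beta1 (by rwa [Term.occ_zero_ups]) b

theorem BC.beta1_3 {t : Term} (h₂ : t.occ 2 = 1) (h₁ : t.occ 1 = 1) (h₀ : t.occ 0 = 1)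
    (a b c : Term) : BC (.app (.app (.app (.lam (.lam (.lam t))) a) b) c)
      (t.subst (scons c (scons b (scons a .var)))) := by
  refine (BC.app (.beta1_2 (by simpa [Term.occ] using h₂) (by simpa [Term.occ] using h₁) a b)
    (.refl c)).trans ?_
  rw [← Term.subst_ups_inst t c]
  exact .beta1 (by rwa [Term.occ_zero_ups]) c

/-- The linear booleans: `0` is `λ k x y. k x y` and `1` is `λ k x y. k y x`. -/
def bit (n : ZMod 2) : Term :=
  if n = 0 then .lam (.lam (.lam (.app (.app (.var 2) (.var 1)) (.var 0))))
  else .lam (.lam (.lam (.app (.app (.var 2) (.var 0)) (.var 1))))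

/-- The sum `λ m n k. m (n k)` of linear booleans. -/
def mul : Term := .lam (.lam (.lam (.app (.var 2) (.app (.var 1) (.var 0)))))

/-- `bit n` applied to `λ c d z. c (d z)` and identities, which is the identity. -/
def eat (t : Term) : Term :=
  .app (.app (.app t (.lam (.lam (.lam (.app (.var 2) (.app (.var 1) (.var 0)))))))
    (.lam (.var 0))) (.lam (.var 0))

theorem zmod_two_cases (n : ZMod 2) : n = 0 ∨ n = 1 := by
  revert n; decide

theorem bit_closed (n : ZMod 2) : (bit n).Closed := by
  intro k; rw [bit]; split_ifs <;> simp [Term.occ]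

theorem mul_closed : mul.Closed := by
  intro k; simp [mul, Term.occ]

theorem bit_zero_app (k x y : Term) :
    BC (.app (.app (.app (bit 0) k) x) y) (.app (.app k x) y) :=
  BC.beta1_3 (t := .app (.app (.var 2) (.var 1)) (.var 0)) rfl rfl rfl k x y

theorem bit_one_app (k x y : Term) :
    BC (.app (.app (.app (bit 1) k) x) y) (.app (.app k y) x) :=
  BC.beta1_3 (t := .app (.app (.var 2) (.var 0)) (.var 1)) rfl rfl rfl k x y

theorem bit_app_lam (n : ZMod 2) (k : Term) : BC (.app (bit n) k)
    (.lam (.lam (if n = 0 then .app (.app ((k.rename Nat.succ).rename Nat.succ) (.var 1)) (.var 0)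
      else .app (.app ((k.rename Nat.succ).rename Nat.succ) (.var 0)) (.var 1)))) := by
  rw [bit]
  split_ifs <;> exact .beta1 (by simp [Term.occ]) k

theorem BC.lam_id_app (t : Term) : BC (.app (.lam (.var 0)) t) t :=
  .beta1 (t := .var 0) rfl t

/-- The boolean can only exchange two copies of the identity, so its value does not matter. -/
theorem eat_bit (n : ZMod 2) (t : Term) : BC (.app (eat (bit n)) t) t := by
  have : BC (eat (bit n)) (eat (bit 0)) := by
    obtain rfl | rfl := zmod_two_cases n
    · exact .refl _
    · exact (bit_one_app _ _ _).trans (bit_zero_app _ _ _).symm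
  refine (BC.app (this.trans (bit_zero_app _ _ _)) (.refl t)).trans ?_
  refine (BC.beta1_3 (t := .app (.var 2) (.app (.var 1) (.var 0))) rfl rfl rfl _ _ _).trans ?_
  exact (BC.lam_id_app _).trans (BC.lam_id_app _)

theorem BC.eat {t t' : Term} (h : BC t t') : BC (eat t) (eat t') :=
  .app (.app (.app h (.refl _)) (.refl _)) (.refl _)

/-- A boolean keeps or exchanges the two arguments of `k`; composing such permutations is addition
modulo `2`. -/
theorem mul_bit (m n : ZMod 2) : BC (.app (.app mul (bit m)) (bit n)) (bit (m + n)) := by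
  refine (BC.beta1_2 (by simp [Term.occ]) (by simp [Term.occ]) (bit m) (bit n)).trans ?_
  have e₁ : ∀ (ρ : ℕ → ℕ), (bit m).rename ρ = bit m := fun ρ => (bit_closed m).rename ρ
  have e₂ : ∀ (ρ : ℕ → ℕ), (bit n).rename ρ = bit n := fun ρ => (bit_closed n).rename ρ
  simp only [Term.subst, ups, scons, e₁, e₂]
  have h := (bit_app_lam m (.app (bit n) (.var 0))).lam
  refine h.trans ?_
  simp only [Term.rename, e₂]
  obtain rfl | rfl := zmod_two_cases m <;> obtain rfl | rfl := zmod_two_cases n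
  · exact .lam (.lam (.lam (bit_zero_app _ _ _)))
  · exact .lam (.lam (.lam (bit_one_app _ _ _)))
  · exact .lam (.lam (.lam (bit_zero_app _ _ _)))
  · exact .lam (.lam (.lam (bit_one_app _ _ _)))

theorem BC.mul {s t : Term} {m n : ZMod 2} (hs : BC s (bit m)) (ht : BC t (bit n)) :
    BC (.app (.app mul s) t) (bit (m + n)) :=
  (BC.app (.app (.refl _) hs) ht).trans (mul_bit m n)

/-! ## Realizability -/

/-- The terms that realize the type `A` with the weight `n`. A realizer of a variable `v` is a pair
of the value `hv v` of the variable and of the weight. -/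
def Rz (hv : ℕ → ZMod 2) : Ty → ZMod 2 → Term → Prop
  | .var v, n, t => BC t (.pair (bit (hv v)) (bit n))
  | .tensor A B, n, t => ∃ n₁ n₂ x y, n₁ + n₂ = n ∧ BC t (.pair x y) ∧ Rz hv A n₁ x ∧ Rz hv B n₂ y
  | .arr A B, n, t => ∀ m x, Rz hv A m x → Rz hv B (n + m) (.app t x)

section
variable {hv : ℕ → ZMod 2}

theorem Rz.of_bc {A : Ty} {n : ZMod 2} {t t' : Term} (h : BC t t') (ht : Rz hv A n t') :
    Rz hv A n t := by
  induction A generalizing n t t' with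
  | var v => exact h.trans ht
  | tensor A B =>
    obtain ⟨n₁, n₂, x, y, h₁, h₂, h₃⟩ := ht
    exact ⟨n₁, n₂, x, y, h₁, h.trans h₂, h₃⟩
  | arr A B _ ih => exact fun m x hx => ih (h.app (.refl x)) (ht m x hx)

/-- The sum of the weights of the variables of a context. -/
def TyCtx.wsum (w : ℕ → ZMod 2) (N : ℕ) (Γ : TyCtx) : ZMod 2 :=
  ∑ i ∈ Finset.range N, (Γ i).elim 0 fun _ => w i

theorem TyCtx.Join.wsum {w : ℕ → ZMod 2} {N : ℕ} {Γ Δ Θ : TyCtx} (h : Γ.Join Δ Θ) :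
    Θ.wsum w N = Γ.wsum w N + Δ.wsum w N := by
  rw [TyCtx.wsum, TyCtx.wsum, TyCtx.wsum, ← Finset.sum_add_distrib]
  refine Finset.sum_congr rfl fun i _ => ?_
  obtain ⟨h₁, h₂⟩ | ⟨h₁, h₂⟩ := h i <;> simp [h₁, h₂]

theorem TyCtx.wsum_cons (w : ℕ → ZMod 2) (N : ℕ) (Γ : TyCtx) (A : Ty) (m : ZMod 2) :
    (TyCtx.cons A Γ).wsum (fun | 0 => m | i + 1 => w i) (N + 1) = Γ.wsum w N + m := by
  rw [TyCtx.wsum, Finset.sum_range_succ']; rfl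

/-- Every typable term realizes its type. -/
theorem HasType.rz {Γ : TyCtx} {t : Term} {A : Ty} (h : HasType Γ t A) {N : ℕ} (hN : Γ.Bound N)
    {w : ℕ → ZMod 2} {σ : ℕ → Term} (hσ : ∀ x T, Γ x = some T → Rz hv T (w x) (σ x)) :
    Rz hv A (Γ.wsum w N) (t.subst σ) := by
  induction h generalizing N w σ with
  | @var Γ i A h =>
    subst h
    have hi : i < N := by by_contra h; have := hN i (by omega); simp [TyCtx.single] at this
    have : (TyCtx.single i A).wsum w N = w i := by
      rw [TyCtx.wsum, Finset.sum_eq_single_of_mem i (Finset.mem_range.2 hi)]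
      · simp [TyCtx.single]
      · intro j _ hj; simp [TyCtx.single, hj]
    rw [this]
    exact hσ i A (by simp [TyCtx.single])
  | @lam Γ t A B h ih =>
    intro m x hx
    rw [← TyCtx.wsum_cons w N Γ A m]
    refine Rz.of_bc (t' := t.subst (scons x σ)) ?_ (ih ?_ ?_)
    · rw [← Term.subst_ups_inst]
      exact .beta1 (by rw [Term.occ_zero_ups]; exact h.occ_eq_one (k := 0) rfl) x
    · intro i hi
      obtain ⟨i, rfl⟩ := Nat.exists_eq_add_of_lt (Nat.lt_of_lt_of_le N.succ_pos hi)
      exact hN _ (by omega)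
    · rintro (_ | i) T hT
      · cases hT; exact hx
      · exact hσ i T hT
  | @app Γ Δ Θ t s A B hj _ _ iht ihs =>
    rw [hj.wsum]
    exact iht (fun i hi => by have := hj i; have := hN i hi; grind)
      (fun x T hx => hσ x T (by have := hj x; grind)) _ _
      (ihs (fun i hi => by have := hj i; have := hN i hi; grind)
        fun x T hx => hσ x T (by have := hj x; grind))
  | @pair Γ Δ Θ s t A B hj _ _ ihs iht =>
    exact ⟨_, _, _, _, hj.wsum.symm, .refl _,
      ihs (fun i hi => by have := hj i; have := hN i hi; grind)
        fun x T hx => hσ x T (by have := hj x; grind),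
      iht (fun i hi => by have := hj i; have := hN i hi; grind)
        fun x T hx => hσ x T (by have := hj x; grind)⟩
  | @lett Γ Δ Θ s t A B C hj _ ht ihs iht =>
    obtain ⟨n₁, n₂, x, y, h₁, h₂, h₃, h₄⟩ :=
      ihs (N := N) (w := w) (σ := σ) (fun i hi => by have := hj i; have := hN i hi; grind)
        fun x T hx => hσ x T (by have := hj x; grind)
    -- The weight of the pair is divided between the two bound variables, which leaves the total
    -- unchanged.
    have h₅ : Θ.wsum w N = (TyCtx.cons A (TyCtx.cons B Δ)).wsum
        (fun | 0 => n₁ | i + 1 => (fun | 0 => n₂ | i + 1 => w i : ℕ → ZMod 2) i) (N + 1 + 1) := by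
      rw [TyCtx.wsum_cons, TyCtx.wsum_cons, hj.wsum, ← h₁]; ring
    rw [h₅]
    refine Rz.of_bc (t' := t.subst (scons x (scons y σ))) ?_ (iht ?_ ?_)
    · refine (BC.lett h₂ (.refl _)).trans ?_
      have h₀ := ht.occ_eq_one (k := 0) rfl
      have h₁ := ht.occ_eq_one (k := 1) rfl
      convert BC.beta2 (t := t.subst (ups (ups σ))) (by rwa [Term.occ_zero_ups_ups])
        (by rwa [Term.occ_one_ups_ups]) x y using 1
      rw [Term.subst_subst]
      congr 1; funext n
      match n with
      | 0 => rfl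
      | 1 => rfl
      | n + 2 =>
        simp only [scons, ups, Term.subst_rename, Term.rename_rename]
        exact (Term.subst_var _).symm
    · intro i hi
      match i, hi with
      | i + 2, hi =>
        have h₁ := hj i
        have h₂ := hN i (by omega)
        simp only [TyCtx.cons]; grind
    · intro i T hT
      match i with
      | 0 => cases hT; exact h₃
      | 1 => cases hT; exact h₄
      | i + 2 => exact hσ i T (by have := hj i; simp only [TyCtx.cons] at hT; grind)

theorem HasType.rz_closed {t : Term} {A : Ty} (h : HasType TyCtx.nil t A) (hv : ℕ → ZMod 2) :
    Rz hv A 0 t := by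
  have := h.rz (hv := hv) (N := 0) (fun _ _ => rfl) (w := fun _ => 0) (σ := .var)
    fun x T hx => by cases hx
  rwa [Term.subst_var] at this

end

/-! ## Tests and generators -/

/-- The test (`b = true`), which maps the realizers of a type to booleans, and the generator
(`b = false`), which maps booleans to realizers. The variables of the type that are read by a test
are those at the positive positions that are `1` in `K`. -/
def prob (hv : ℕ → ZMod 2) : Bool → Ty → Term
  | true, .var l => .lam (.lett (.var 0)
      (.app (.app mul (if l = 1 then .var 0 else .app (eat (.var 0)) (bit 0))) (.var 1)))
  | false, .var l => .lam (.pair (bit (hv l)) (.var 0))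
  | true, .tensor A B => .lam (.lett (.var 0)
      (.app (.app mul (.app (prob hv true A) (.var 0))) (.app (prob hv true B) (.var 1))))
  | false, .tensor A B =>
      .lam (.pair (.app (prob hv false A) (.var 0)) (.app (prob hv false B) (bit 0)))
  | true, .arr A B => .lam (.app (prob hv true B) (.app (.var 0) (.app (prob hv false A) (bit 0))))
  | false, .arr A B => .lam (.lam
      (.app (prob hv false B) (.app (.app mul (.var 1)) (.app (prob hv true A) (.var 0)))))

/-- The sum of the values of the variables of `A` that are read by `prob hv b K`. -/
def wt (hv : ℕ → ZMod 2) : Bool → Ty → Ty → ZMod 2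
  | true, .var l, .var v => if l = 1 then hv v else 0
  | b, .tensor K L, .tensor A B => wt hv b K A + wt hv b L B
  | b, .arr K L, .arr A B => wt hv (!b) K A + wt hv b L B
  | _, _, _ => 0

section
variable {hv : ℕ → ZMod 2}

theorem prob_closed (b : Bool) (K : Ty) : (prob hv b K).Closed := by
  intro k
  induction K generalizing b k with
  | var l =>
    have h₁ := bit_closed; have h₂ := mul_closed
    simp only [Term.Closed] at h₁ h₂
    cases b
    · simp [prob, Term.occ, h₁]
    · by_cases hl : l = 1 <;> simp [prob, Term.occ, h₁, h₂, hl, eat]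
  | tensor A B ih₁ ih₂ | arr A B ih₁ ih₂ =>
    have h₁ := bit_closed; have h₂ := mul_closed
    simp only [Term.Closed] at h₁ h₂
    cases b <;> simp [prob, Term.occ, ih₁, ih₂, h₁, h₂]

theorem BC.app_lam_lett {t x a c : Term} (h₀ : t.occ 0 = 1) (h₁ : t.occ 1 = 1)
    (h₂ : ∀ k, t.occ (k + 2) = 0) (hx : BC x (.pair a c)) :
    BC (.app (.lam (.lett (.var 0) t)) x) (t.subst (scons a (scons c .var))) := by
  have h₃ : t.subst (ups (ups (scons x .var))) = t :=
    (Term.subst_congr fun k hk => by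
      match k, hk with
      | 0, _ => rfl
      | 1, _ => rfl
      | k + 2, hk => exact absurd (h₂ k) hk).trans t.subst_var
  have := BC.beta1 (t := .lett (.var 0) t) (by simp [Term.occ, h₂]) x
  simp only [Term.inst, Term.subst, scons, h₃] at this
  exact this.trans ((BC.lett hx (.refl _)).trans (.beta2 h₀ h₁ a c))

/-- Tests and generators are treated together because they exchange roles to the left of `⊸`.
Agreement at the polarity `!b` makes each generator leaf emit the value of the atom of `A`; the
other leaves of `K` are free to mark what is read. -/
theorem prob_spec {b : Bool} {K A : Ty} (h : K.Agree (!b) A) :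
    (b = true → ∀ n x, Rz hv A n x → BC (.app (prob hv b K) x) (bit (n + wt hv b K A))) ∧
    (b = false → ∀ n x, BC x (bit n) → Rz hv A (n + wt hv b K A) (.app (prob hv b K) x)) := by
  have hb := bit_closed; have hm := mul_closed
  have hp := fun b K => prob_closed (hv := hv) b K
  have hb' := fun n k => hb n k; have hm' := fun k => hm k; have hp' := fun b K k => hp b K k
  induction K generalizing b A with
  | var l =>
    cases A <;> try exact h.elim
    rename_i v
    cases b with
    | false =>
      refine ⟨by simp, fun _ n x hx => ?_⟩
      rw [wt, add_zero, ← h rfl]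
      · have := BC.beta1 (t := .pair (bit (hv l)) (.var 0)) (by simp [Term.occ, hb']) x
        simp only [Term.inst, Term.subst, (hb _).subst, scons] at this
        exact this.trans (.pair (.refl _) hx)
      all_goals simp
    | true =>
      refine ⟨fun _ n x hx => ?_, by simp⟩
      rw [prob, wt]
      split_ifs with hl
      · refine (BC.app_lam_lett (by simp [Term.occ, hm']) (by simp [Term.occ, hm'])
          (by simp [Term.occ, hm']) hx).trans ?_
        simp only [Term.subst, hm.subst, scons]
        rw [add_comm]; exact mul_bit _ _
      · refine (BC.app_lam_lett (by simp [Term.occ, hm', hb', eat])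
          (by simp [Term.occ, hm', hb', eat]) (by simp [Term.occ, hm', hb', eat]) hx).trans ?_
        simp only [Term.subst, hm.subst, hb _ |>.subst, scons, eat, ups, Term.rename]
        rw [add_comm]; exact .mul (eat_bit _ _) (.refl _)
  | tensor K L ih₁ ih₂ =>
    cases A <;> try exact h.elim
    rename_i A B
    cases b with
    | true =>
      refine ⟨fun _ n x hx => ?_, by simp⟩
      obtain ⟨n₁, n₂, a, c, rfl, h₁, h₂, h₃⟩ := hx
      rw [prob, wt]
      refine (BC.app_lam_lett (by simp [Term.occ, hm', hp']) (by simp [Term.occ, hm', hp'])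
          (by simp [Term.occ, hm', hp']) h₁).trans ?_
      simp only [Term.subst, hm.subst, (hp _ _).subst, scons]
      rw [add_add_add_comm]
      exact .mul ((ih₁ h.1).1 rfl _ _ h₂) ((ih₂ h.2).1 rfl _ _ h₃)
    | false =>
      refine ⟨by simp, fun _ n x hx => ?_⟩
      rw [prob, wt]
      -- The whole input weight goes to the first component; the second is generated from `bit 0`.
      refine ⟨_, _, _, _, ?_, ?_, (ih₁ h.1).2 rfl n x hx, (ih₂ h.2).2 rfl 0 _ (.refl _)⟩
      · ring
      · have := BC.beta1 (t := .pair (.app (prob hv false K) (.var 0))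
          (.app (prob hv false L) (bit 0))) (by simp [Term.occ, hb', hp']) x
        simpa only [Term.inst, Term.subst, (hb _).subst, (hp _ _).subst, scons] using this
  | arr K L ih₁ ih₂ =>
    cases A <;> try exact h.elim
    rename_i A B
    cases b with
    | true =>
      refine ⟨fun _ n x hx => ?_, by simp⟩
      rw [prob, wt]
      · have := BC.beta1 (t := .app (prob hv true L) (.app (.var 0) (.app (prob hv false K) (bit 0))))
          (by simp [Term.occ, hb', hp']) x
        simp only [Term.inst, Term.subst, (hb _).subst, (hp _ _).subst, scons] at this
        refine this.trans ?_
        -- The argument is generated from `bit 0`, so it adds only what its generator has read.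
        convert (ih₂ h.2).1 rfl _ _ (hx _ _ ((ih₁ h.1).2 rfl 0 _ (.refl _))) using 2
        simp only [Bool.not_true]; ring
    | false =>
      refine ⟨by simp, fun _ n x hx => ?_⟩
      intro m y hy
      rw [prob, wt]
      · have := BC.beta1_2 (t := .app (prob hv false L)
          (.app (.app mul (.var 1)) (.app (prob hv true K) (.var 0))))
          (by simp [Term.occ, hm', hp']) (by simp [Term.occ, hm', hp']) x y
        simp only [Term.subst, hm.subst, (hp _ _).subst, scons] at this
        refine Rz.of_bc this ?_
        -- The argument cannot be discarded: it is tested, and the outcome joins the weight of the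
        -- result.
        convert (ih₂ h.2).2 rfl _ _ (BC.mul hx ((ih₁ (b := true) h.1).1 rfl m y hy)) using 1
        simp only [Bool.not_false]; ring

/-- A type without read positions. -/
theorem exists_wt_eq_zero (b : Bool) (A : Ty) : ∃ K : Ty, ∀ A' : Ty, A.Agree (!b) A' →
    K.Agree (!b) A' ∧ ∀ hv, wt hv b K A' = 0 := by
  induction A generalizing b with
  | var v =>
    cases b with
    | true =>
      -- Any label other than `1` marks a position as not read.
      refine ⟨.var 0, fun A' h => ?_⟩
      cases A' <;> try exact h.elim
      exact ⟨by simp [Ty.Agree], fun hv => by simp [wt]⟩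
    | false =>
      refine ⟨.var v, fun A' h => ?_⟩
      cases A' <;> try exact h.elim
      exact ⟨h, fun hv => by simp [wt]⟩
  | tensor A B ih₁ ih₂ =>
    obtain ⟨K, hK⟩ := ih₁ b
    obtain ⟨L, hL⟩ := ih₂ b
    refine ⟨.tensor K L, fun A' h => ?_⟩
    cases A' <;> try exact h.elim
    have h₁ := hK _ h.1
    have h₂ := hL _ h.2
    exact ⟨⟨h₁.1, h₂.1⟩, fun hv => by rw [wt, h₁.2, h₂.2, add_zero]⟩
  | arr A B ih₁ ih₂ =>
    obtain ⟨K, hK⟩ := ih₁ (!b)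
    obtain ⟨L, hL⟩ := ih₂ b
    refine ⟨.arr K L, fun A' h => ?_⟩
    cases A' <;> try exact h.elim
    have h₁ := hK _ h.1
    have h₂ := hL _ h.2
    exact ⟨⟨h₁.1, h₂.1⟩, fun hv => by rw [wt, h₁.2, h₂.2, add_zero]⟩

/-- Different types that agree at the negative positions can be told apart. -/
theorem exists_wt_ne {b : Bool} {A A' : Ty} (h : A.Agree (!b) A') (hne : A ≠ A') :
    ∃ hv K, K.Agree (!b) A ∧ K.Agree (!b) A' ∧ wt hv b K A ≠ wt hv b K A' := by
  induction A generalizing b A' with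
  | var v =>
    cases A' <;> try exact h.elim
    rename_i v'
    cases b with
    | true =>
      -- The value `1` is given to the atom `v` only, and the label `1` makes the test read this
      -- position.
      refine ⟨fun n => if n = v then 1 else 0, .var 1, by simp [Ty.Agree], by simp [Ty.Agree], ?_⟩
      have : v' ≠ v := by rintro rfl; exact hne rfl
      simp [wt, this]
    | false => exact absurd (congrArg _ (h rfl)) hne
  | tensor A B ih₁ ih₂ =>
    cases A' <;> try exact h.elim
    rename_i A' B'
    by_cases hA : A = A'
    · subst hA
      obtain ⟨hv, L, h₁, h₂, h₃⟩ := ih₂ h.2 fun e => hne (by rw [e])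
      obtain ⟨K, hK⟩ := exists_wt_eq_zero b A
      have h₄ := hK A (.refl _ _)
      exact ⟨hv, .tensor K L, ⟨h₄.1, h₁⟩, ⟨h₄.1, h₂⟩, by simpa [wt, h₄.2] using h₃⟩
    · obtain ⟨hv, K, h₁, h₂, h₃⟩ := ih₁ h.1 hA
      -- The second components may differ as well; one `L` serves both, as it depends only on the
      -- positions where they agree.
      obtain ⟨L, hL⟩ := exists_wt_eq_zero b B
      have h₄ := hL B (.refl _ _)
      have h₅ := hL B' h.2
      exact ⟨hv, .tensor K L, ⟨h₁, h₄.1⟩, ⟨h₂, h₅.1⟩, by simpa [wt, h₄.2, h₅.2] using h₃⟩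
  | arr A B ih₁ ih₂ =>
    cases A' <;> try exact h.elim
    rename_i A' B'
    by_cases hA : A = A'
    · subst hA
      obtain ⟨hv, L, h₁, h₂, h₃⟩ := ih₂ h.2 fun e => hne (by rw [e])
      obtain ⟨K, hK⟩ := exists_wt_eq_zero (!b) A
      have h₄ := hK A (.refl _ _)
      exact ⟨hv, .arr K L, ⟨h₄.1, h₁⟩, ⟨h₄.1, h₂⟩, by simpa [wt, h₄.2] using h₃⟩
    · obtain ⟨hv, K, h₁, h₂, h₃⟩ := ih₁ (b := !b) h.1 hA
      obtain ⟨L, hL⟩ := exists_wt_eq_zero b B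
      have h₄ := hL B (.refl _ _)
      have h₅ := hL B' h.2
      exact ⟨hv, .arr K L, ⟨h₁, h₄.1⟩, ⟨h₂, h₅.1⟩, by simpa [wt, h₄.2, h₅.2] using h₃⟩

/-- Terms with typings that agree at the negative positions only are separated by a test. -/
theorem exists_test {s₁ s₂ : Term} {A₁ A₂ : Ty} (h₁ : HasType TyCtx.nil s₁ A₁)
    (h₂ : HasType TyCtx.nil s₂ A₂) (h : A₁.Agree false A₂) (hne : A₁ ≠ A₂) :
    ∃ (D : Term) (n₁ n₂ : ZMod 2), D.Closed ∧ n₁ ≠ n₂ ∧ BC (.app D s₁) (bit n₁) ∧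
      BC (.app D s₂) (bit n₂) := by
  obtain ⟨hv, K, h₃, h₄, h₅⟩ := exists_wt_ne (b := true) h hne
  refine ⟨prob hv true K, _, _, prob_closed _ _, h₅, ?_, ?_⟩
  · simpa using (prob_spec h₃).1 rfl _ _ (h₁.rz_closed hv)
  · simpa using (prob_spec h₄).1 rfl _ _ (h₂.rz_closed hv)

/-- For every type there is a term that maps its closed terms to booleans. -/
theorem exists_test_of_type (B : Ty) : ∃ D : Term, D.Closed ∧
    ∀ t, HasType TyCtx.nil t B → ∃ n, BC (.app D t) (bit n) :=
  ⟨prob (fun _ => 0) true B, prob_closed _ _, fun _ ht =>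
    ⟨_, (prob_spec (.refl _ _)).1 rfl _ _ (ht.rz_closed _)⟩⟩

end

/-! ## The selection of a function by a boolean -/

/-- `λ p q r. eat (E (q c)) (p r)`, which behaves as `λ p q. p` if `E (q c)` is a boolean. -/
def first (E c : Term) : Term :=
  .lam (.lam (.lam (.app (eat (.app E (.app (.var 1) c))) (.app (.var 2) (.var 0)))))

/-- `λ s r. D s (first E c) X Y r`. -/
def select (D E c X Y : Term) : Term :=
  .lam (.lam (.app (.app (.app (.app (.app D (.var 1)) (first E c)) X) Y) (.var 0)))

/-- `q` is consumed rather than dropped: `E` makes a boolean of `q c`, and `eat` makes of it an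
identity applied to `p r`. -/
theorem first_app {E c p q r : Term} (hE : E.Closed) (hc : c.Closed) {n : ZMod 2}
    (hn : BC (.app E (.app q c)) (bit n)) :
    BC (.app (.app (.app (first E c) p) q) r) (.app p r) := by
  have hE' := fun k => hE k; have hc' := fun k => hc k
  refine (BC.beta1_3 ?_ ?_ ?_ p q r).trans ?_
  · simp [Term.occ, eat, hE', hc']
  · simp [Term.occ, eat, hE', hc']
  · simp [Term.occ, eat, hE', hc']
  · simp only [Term.subst, eat, scons, ups, Term.rename, hE.subst, hc.subst]
    exact (BC.app (BC.eat hn) (.refl _)).trans (eat_bit _ _)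

/-- `bit n` hands `X` and `Y` to `first E c` in this order or exchanged. Either may be the rejected
one, so both must be testable at `c`. -/
theorem select_app {D E c X Y s r : Term} (hD : D.Closed) (hE : E.Closed) (hc : c.Closed)
    (hX : X.Closed) (hY : Y.Closed) {n m m' : ZMod 2} (hs : BC (.app D s) (bit n))
    (hXc : BC (.app E (.app X c)) (bit m)) (hYc : BC (.app E (.app Y c)) (bit m')) :
    BC (.app (.app (select D E c X Y) s) r) (.app (if n = 0 then X else Y) r) := by
  have hD' := fun k => hD k; have hX' := fun k => hX k; have hY' := fun k => hY k
  have hF : (first E c).Closed := by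
    have hE' := fun k => hE k; have hc' := fun k => hc k
    intro k; simp [first, Term.occ, eat, hE', hc']
  have hF' := fun k => hF k
  refine (BC.beta1_2 ?_ ?_ s r).trans ?_
  · simp [Term.occ, hD', hF', hX', hY']
  · simp [Term.occ, hD', hF', hX', hY']
  · simp only [Term.subst, scons, hD.subst, hF.subst, hX.subst, hY.subst]
    refine (BC.app (.app (.app (.app hs (.refl _)) (.refl _)) (.refl _)) (.refl _)).trans ?_
    obtain rfl | rfl := zmod_two_cases n
    · exact (BC.app (bit_zero_app _ _ _) (.refl _)).trans (first_app hE hc hYc)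
    · exact (BC.app (bit_one_app _ _ _) (.refl _)).trans (first_app hE hc hXc)

/-- The conversion holds for every `r`, typable or not; `c` serves only to use up the function that
is not selected. -/
theorem exists_separator {A B : Ty} {s u : Fin 2 → Term} {c : Term}
    (hs : ∀ i, HasType TyCtx.nil (s i) A) (hne : ¬ TermEq TyCtx.nil (s 0) (s 1) A)
    (hu : ∀ i, (u i).Closed) (hc : c.Closed)
    (huc : ∀ i, HasType TyCtx.nil (.app (u i) c) B) :
    ∃ t : Term, ∀ i r, BC (.app (.app t (s i)) r) (.app (u i) r) := by
  obtain ⟨A₁, A₂, h₁, h₂, h₃, h₄⟩ := (hs 0).exists_types_ne (hs 1) hne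
  obtain ⟨D, n₁, n₂, hD, h₅, h₆, h₇⟩ := exists_test h₁ h₂ h₃ h₄
  obtain ⟨E, hE, h₈⟩ := exists_test_of_type B
  choose n hn using fun i => h₈ _ (huc i)
  by_cases h : n₁ = 0
  · have h' : n₂ ≠ 0 := fun e => h₅ (h.trans e.symm)
    refine ⟨select D E c (u 0) (u 1), fun i r => ?_⟩
    fin_cases i
    · simpa [h] using select_app (r := r) hD hE hc (hu 0) (hu 1) h₆ (hn 0) (hn 1)
    · simpa [h'] using select_app (r := r) hD hE hc (hu 0) (hu 1) h₇ (hn 0) (hn 1)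
  · have h' : n₂ = 0 := by
      obtain e | e := zmod_two_cases n₂
      · exact e
      · exact absurd (((zmod_two_cases n₁).resolve_left h).trans e.symm) h₅
    refine ⟨select D E c (u 1) (u 0), fun i r => ?_⟩
    fin_cases i
    · simpa [h] using select_app (r := r) hD hE hc (hu 1) (hu 0) h₆ (hn 1) (hn 0)
    · simpa [h'] using select_app (r := r) hD hE hc (hu 1) (hu 0) h₇ (hn 1) (hn 0)

/-! ## Principal types -/

/-- Every typing of `t` is an instance of the typing `Γ ⊢ t : P`. -/
def Principal (Γ : TyCtx) (t : Term) (P : Ty) : Prop :=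
  HasType Γ t P ∧ ∀ (Γ' : TyCtx) (A' : Ty), HasType Γ' t A' →
    ∃ θ : ℕ → Ty, A' = P.subst θ ∧ Γ' = fun i => (Γ i).map (Ty.subst θ)

theorem Ty.subst_subst (A : Ty) (θ θ' : ℕ → Ty) :
    (A.subst θ).subst θ' = A.subst fun n => (θ n).subst θ' := by
  induction A <;> simp_all [Ty.subst]

/-- Different tags make principal types disjoint. Since `θ` is constrained only on the variables
tagged `k`, instances for several tags can be glued into one substitution. -/
theorem Principal.tag {Γ : TyCtx} {t : Term} {P : Ty} (h : Principal Γ t P) (k : ℕ) :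
    HasType (fun i => (Γ i).map (Ty.ren (Nat.pair k))) t (P.ren (Nat.pair k)) ∧
    ∀ (Γ' : TyCtx) (A' : Ty), HasType Γ' t A' → ∃ θ₀ : ℕ → Ty, ∀ θ : ℕ → Ty,
      (∀ n, θ (Nat.pair k n) = θ₀ n) → A' = (P.ren (Nat.pair k)).subst θ ∧
      ∀ i, Γ' i = ((Γ i).map (Ty.ren (Nat.pair k))).map (Ty.subst θ) := by
  refine ⟨h.1.tySubst _, fun Γ' A' h' => ?_⟩
  obtain ⟨θ₀, rfl, rfl⟩ := h.2 Γ' A' h'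
  refine ⟨θ₀, fun θ hθ => ?_⟩
  have key : ∀ A : Ty, (A.ren (Nat.pair k)).subst θ = A.subst θ₀ := fun A => by
    rw [Ty.ren, Ty.subst_subst]; simp only [Ty.subst, hθ]
  refine ⟨(key _).symm, fun i => ?_⟩
  simp only [Option.map_map]
  exact congrArg (fun g => (Γ i).map g) (funext fun A => (key A).symm)

theorem Principal.isPrincipalType {Γ : TyCtx} {t : Term} {P : Ty} (h : Principal Γ t P) (k : ℕ) :
    IsPrincipalType t (P.ren (Nat.pair k)) := by
  refine ⟨_, (h.tag k).1, fun Γ' A' h' => ?_⟩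
  obtain ⟨θ₀, h₀⟩ := (h.tag k).2 Γ' A' h'
  obtain ⟨h₁, h₂⟩ := h₀ (fun n => θ₀ n.unpair.2) fun n => by simp
  exact ⟨_, h₁, funext h₂⟩

theorem Principal.of_bc {Γ : TyCtx} {t t' : Term} {P : Ty} (h : Principal Γ t P) (e : BC t' t) :
    Principal Γ t' P :=
  ⟨e.hasType_iff.2 h.1, fun Γ' A' h' => h.2 Γ' A' (e.hasType_iff.1 h')⟩

/-- No unification is needed: cut-free rules combine the types of their premises without identifying
any, so the principal typings of the premises only have to be renamed apart. -/
theorem CF.exists_principal {Γ : TyCtx} {t : Term} {A : Ty} (h : CF Γ t A) :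
    ∃ Γ' P, Principal Γ' t P := by
  induction h with
  | ax i A =>
    refine ⟨_, _, .var (A := .var 0) rfl, fun Γ' A' h' => ?_⟩
    rw [hasType_var] at h'; subst h'
    exact ⟨fun _ => A', rfl, by rw [TyCtx.map_single]; rfl⟩
  | @lam Γ t A B h ih =>
    obtain ⟨Γ₁, P, h₁, h₂⟩ := ih
    obtain ⟨X, hX⟩ := Option.ne_none_iff_exists'.1
      (mt (h.hasType.eq_none_iff h₁ 0).2 (by simp [TyCtx.cons]))
    rw [TyCtx.eq_cons hX] at h₁
    refine ⟨_, _, .lam h₁, fun Γ' A' h' => ?_⟩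
    obtain ⟨A', B', rfl, h₆⟩ := hasType_lam.1 h'
    obtain ⟨θ, h₃, h₄⟩ := h₂ _ _ h₆
    have h₅ := congrFun h₄ 0
    simp only [TyCtx.cons, hX, Option.map_some, Option.some.injEq] at h₅
    exact ⟨θ, by rw [Ty.subst, h₃, h₅], funext fun i => congrFun h₄ (i + 1)⟩
  | @pair Γ Δ Θ s t A B hj hs ht ihs iht =>
    obtain ⟨Γ₁, P, hP⟩ := ihs
    obtain ⟨Δ₁, Q, hQ⟩ := iht
    obtain ⟨h₁, h₂⟩ := hP.tag 0
    obtain ⟨h₃, h₄⟩ := hQ.tag 1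
    have hj' := TyCtx.join_union (Γ := fun i => (Γ₁ i).map (Ty.ren (Nat.pair 0)))
      (Δ := fun i => (Δ₁ i).map (Ty.ren (Nat.pair 1))) fun i => by
        have := hs.hasType.eq_none_iff h₁ i
        have := ht.hasType.eq_none_iff h₃ i
        have := hj i
        grind
    refine ⟨_, _, .pair hj' h₁ h₃, fun Γ' A' h' => ?_⟩
    obtain ⟨Γ₂, Δ₂, A', B', rfl, hj₂, k₁, k₂⟩ := hasType_pair.1 h'
    obtain ⟨θ₁, hθ₁⟩ := h₂ _ _ k₁
    obtain ⟨θ₂, hθ₂⟩ := h₄ _ _ k₂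
    obtain ⟨l₁, l₂⟩ := hθ₁ (fun n => if n.unpair.1 = 0 then θ₁ n.unpair.2 else θ₂ n.unpair.2)
      fun n => by simp
    obtain ⟨l₃, l₄⟩ := hθ₂ (fun n => if n.unpair.1 = 0 then θ₁ n.unpair.2 else θ₂ n.unpair.2)
      fun n => by simp
    refine ⟨_, by rw [Ty.subst, ← l₁, ← l₃], funext fun i => ?_⟩
    have := hj₂ i; have := l₂ i; have := l₄ i; have := hj' i
    grind
  | @lett Δ z t A B C hz ht ih =>
    obtain ⟨Γ₁, P, h₁, h₂⟩ := ih
    have hn := ht.hasType.eq_none_iff h₁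
    obtain ⟨X, hX⟩ := Option.ne_none_iff_exists'.1 (mt (hn 0).2 (by simp [TyCtx.cons]))
    obtain ⟨Y, hY⟩ := Option.ne_none_iff_exists'.1 (mt (hn 1).2 (by simp [TyCtx.cons]))
    have hz₁ := (hn (z + 2)).1 hz
    rw [TyCtx.eq_cons hX, TyCtx.eq_cons (Γ := Γ₁ ∘ Nat.succ) hY] at h₁
    refine ⟨_, _, .lett_var hz₁ h₁, fun Γ' A' h' => ?_⟩
    obtain ⟨Γ₂, Δ₂, A₂, B₂, hj₂, k₁, k₂⟩ := hasType_lett.1 h'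
    rw [hasType_var] at k₁; subst k₁
    obtain ⟨θ, h₃, h₄⟩ := h₂ _ _ k₂
    have h₅ := congrFun h₄ 0
    have h₆ := congrFun h₄ 1
    simp only [TyCtx.cons, hX, hY, Option.map_some, Option.some.injEq] at h₅ h₆
    refine ⟨θ, h₃, funext fun i => ?_⟩
    have h₇ := hj₂ i
    have h₈ : Δ₂ i = (Γ₁ (i + 2)).map (Ty.subst θ) := congrFun h₄ (i + 2)
    by_cases hi : i = z
    · subst hi
      simp [TyCtx.single] at h₇
      simp [Ty.subst, ← h₅, ← h₆, h₇]
    · simp [TyCtx.single, hi] at h₇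
      rw [Function.update_of_ne hi]
      simp only [Function.comp, ← h₈]
      grind
  | @arr Γ Δ Θ f u t A B C hf hj hu ht ihu iht =>
    obtain ⟨Γ₁, P, hP⟩ := ihu
    obtain ⟨Δ₁, Q, hQ⟩ := iht
    obtain ⟨h₁, h₂⟩ := hP.tag 0
    obtain ⟨h₃, h₄⟩ := hQ.tag 1
    have hn₁ := hu.hasType.eq_none_iff h₁
    have hn₂ := ht.hasType.eq_none_iff h₃
    obtain ⟨Y, hY⟩ := Option.ne_none_iff_exists'.1 (mt (hn₂ f).2 (by simp [hf]))
    have hΓf : Γ f = none := by have := hj f; simp at this; grind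
    have hj' := TyCtx.join_union (Γ := fun i => (Γ₁ i).map (Ty.ren (Nat.pair 0)))
      (Δ := Function.update (fun i => (Δ₁ i).map (Ty.ren (Nat.pair 1))) f
        (some (.arr (P.ren (Nat.pair 0)) Y))) fun i => by
          have := hn₁ i; have := hn₂ i; have := hj i
          by_cases hi : i = f
          · subst hi; grind
          · rw [Function.update_of_ne hi] at *; grind
    refine ⟨_, _, .subst_app hY hj' h₁ h₃, fun Γ' A' h' => ?_⟩
    obtain ⟨Γ₂, Δ₂, B₂, hj₂, hB₂, hfu, k₂⟩ :=
      (hasType_subst_repl (ht.hasType.occ_eq_one hf)).1 h'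
    obtain ⟨Γ₃, Γ₄, A₂, hj₃, hf', k₁⟩ := hasType_app.1 hfu
    rw [hasType_var] at hf'; subst hf'
    obtain ⟨θ₁, hθ₁⟩ := h₂ _ _ k₁
    obtain ⟨θ₂, hθ₂⟩ := h₄ _ _ k₂
    obtain ⟨l₁, l₂⟩ := hθ₁ (fun n => if n.unpair.1 = 0 then θ₁ n.unpair.2 else θ₂ n.unpair.2)
      fun n => by simp
    obtain ⟨l₃, l₄⟩ := hθ₂ (fun n => if n.unpair.1 = 0 then θ₁ n.unpair.2 else θ₂ n.unpair.2)
      fun n => by simp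
    refine ⟨_, l₃, funext fun i => ?_⟩
    have h₅ := hj₂ i; have h₆ := hj₃ i; have h₇ := l₂ i; have h₈ := l₄ i; have h₉ := hj' i
    by_cases hi : i = f
    · subst hi
      have : ((Γ₁ i).map (Ty.ren (Nat.pair 0))) = none := (hn₁ i).1 hΓf
      rw [hY, hB₂, Option.map_some, Option.some.injEq] at h₈
      simp [this] at h₉
      rw [← h₉]
      simp [TyCtx.single] at h₅ h₆
      simp only [Option.map_some, Ty.subst, ← l₁, ← h₈]
      grind
    · simp [TyCtx.single, hi] at h₅ h₆ h₉
      grind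

/-- Every typable term has a principal type. -/
theorem HasType.exists_principal {Γ : TyCtx} {t : Term} {A : Ty} (h : HasType Γ t A) :
    ∃ Γ' P, Principal Γ' t P := by
  obtain ⟨t', h₁, h₂⟩ := h.exists_cf
  obtain ⟨Γ', P, h₃⟩ := h₁.exists_principal
  exact ⟨Γ', P, h₃.of_bc h₂⟩

theorem hasType_nil_app {t s : Term} {B : Ty} : HasType TyCtx.nil (.app t s) B ↔
    ∃ A, HasType TyCtx.nil t (.arr A B) ∧ HasType TyCtx.nil s A := by
  rw [hasType_app]
  constructor
  · rintro ⟨Γ, Δ, A, hj, h₁, h₂⟩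
    have e₁ : Γ = TyCtx.nil := funext fun i => by have := hj i; simp only [TyCtx.nil] at *; grind
    have e₂ : Δ = TyCtx.nil := funext fun i => by have := hj i; simp only [TyCtx.nil] at *; grind
    subst e₁ e₂
    exact ⟨A, h₁, h₂⟩
  · rintro ⟨A, h₁, h₂⟩
    exact ⟨_, _, A, TyCtx.join_nil_left _, h₁, h₂⟩

/-- Each of the three principal types is instantiated to the type that its term has in this
application. Other choices of `s`, `r` may use `t` at a different type. -/
theorem PolyTypable.of_hasType_app {t s r : Term} {A A₀ B : Ty} (hs : ClosedOf s A)
    (hr : ClosedOf r A₀) (h : HasType TyCtx.nil (.app (.app t s) r) B) :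
    PolyTypable t [A, A₀] B [s, r] := by
  obtain ⟨A₂, h₁, h₂⟩ := hasType_nil_app.1 h
  obtain ⟨A₁, h₃, h₄⟩ := hasType_nil_app.1 h₁
  refine ⟨⟨[A₁, A₂], B, rfl, h₃⟩, .cons hs (.cons hr .nil), ?_⟩
  obtain ⟨_, P, hP⟩ := h₃.exists_principal
  obtain ⟨_, Q, hQ⟩ := h₄.exists_principal
  obtain ⟨_, R, hR⟩ := h₂.exists_principal
  obtain ⟨θ₁, hθ₁⟩ := (hP.tag 0).2 _ _ h₃
  obtain ⟨θ₂, hθ₂⟩ := (hQ.tag 1).2 _ _ h₄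
  obtain ⟨θ₃, hθ₃⟩ := (hR.tag 2).2 _ _ h₂
  let θ : ℕ → Ty := fun n => if n.unpair.1 = 0 then θ₁ n.unpair.2 else
    if n.unpair.1 = 1 then θ₂ n.unpair.2 else θ₃ n.unpair.2
  refine ⟨_, [_, _], θ, hP.isPrincipalType 0,
    .cons (hQ.isPrincipalType 1) (.cons (hR.isPrincipalType 2) .nil), ?_⟩
  rw [← (hθ₁ θ fun n => by simp [θ]).1]
  simp only [List.map, ← (hθ₂ θ fun n => by simp [θ]).1, ← (hθ₃ θ fun n => by simp [θ]).1]
  rfl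

/-- `u` and `r` are closed, so their principal typings have empty contexts; instantiated by `θ`,
they fit together in an application. -/
theorem PolyTypable.hasType_app {u r : Term} {A₀ B : Ty} (h : PolyTypable u [A₀] B [r]) :
    u.Closed ∧ HasType TyCtx.nil (.app u r) B := by
  obtain ⟨⟨As, B', -, h₁⟩, h₂, P, Qs, θ, ⟨Γ, hP, -⟩, hQs, h₃⟩ := h
  have hu := HasType.closed h₁
  cases hQs with
  | cons hQ hQs' =>
    cases hQs'
    obtain ⟨Δ, hQ, -⟩ := hQ
    cases h₂ with
    | cons hr _ =>
      have hr := HasType.closed hr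
      have key : ∀ {t : Term} {Γ : TyCtx} {T : Ty}, t.Closed → HasType Γ t T →
          HasType TyCtx.nil t (T.subst θ) := by
        intro t Γ T ht h
        convert h.tySubst θ using 1
        funext i
        obtain ⟨h₁, -⟩ | ⟨-, h₁⟩ := h.occ i
        · rw [h₁]; rfl
        · rw [ht i] at h₁; cases h₁
      have k₁ := key hu hP
      rw [h₃] at k₁
      exact ⟨hu, hasType_nil_app.2 ⟨_, k₁, key hr hQ⟩⟩

end LinLam

open LinLam
theorem mainTheorem3 (A A0 B : Ty) (s r u : Fin 2 → Term)
    (hs : ∀ i, ClosedOf (s i) A)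
    (hne : ¬ ClosedEq A (s 0) (s 1))
    (hr : ∀ j, ClosedOf (r j) A0)
    (hu : ∀ i j, PolyTypable (u i) [A0] B [r j])
    (hset : ∃ b : Fin 2 → Term, (∀ k, ClosedOf (b k) B) ∧
      ∀ i j, ∃ k, ClosedEq B (.app (u i) (r j)) (b k)) :
    ∃ t : Term,
      (∀ i j, PolyTypable t [A, A0] B [s i, r j]) ∧
      ∀ i j, ClosedEq B (.app (.app t (s i)) (r j)) (.app (u i) (r j)) := by
  have huc := fun i j => (hu i j).hasType_app
  -- Both `u i (r 0)` have type `B`, so `r 0` can be the argument on which the rejected function is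
  -- spent.
  obtain ⟨t, ht⟩ := exists_separator hs hne (fun i => (huc i 0).1) (HasType.closed (hr 0))
    fun i => (huc i 0).2
  -- The typing of `u i (r j)` is carried backwards along the linear conversion.
  have key : ∀ i j, HasType TyCtx.nil (.app (.app t (s i)) (r j)) B := fun i j =>
    (ht i (r j)).hasType_iff.2 (huc i j).2
  exact ⟨t, fun i j => .of_hasType_app (hs i) (hr j) (key i j), fun i j =>
    (ht i (r j)).termEq (key i j)⟩
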